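/- Let $d\ge 1$, let $\mathcal D\subset\mathbb R^d$ be an open set whose closure is triangulated by a finite conforming simplicial mesh $\mathcal T_h$ with faces $\mathcal F_h$, and let $p\ge 0$. Let $\mathbf V_h^p$ and $W_h^p$ be the vector fields and the functions that are complex polynomials of degree $\le p$ (componentwise) on each element, let $M_h^p$ be the functions on the faces that are polynomials of degree $\le p$ on each face, and let $\mathbf W=W_h^p\times M_h^p$. Write $(\cdot,\cdot)_{\mathcal T_h}$, $\langle\cdot,\cdot\rangle_{\partial\mathcal T_h}$ and $\langle\cdot,\cdot\rangle_{\partial\mathcal D}$ for the $L^2$ products (antilinear in the second argument) over all elements, all element boundaries, and the domain boundary. Let $\boldsymbol n$ be the outward unit normal and let $\tau>0$. Let $\boldsymbol l(w),\boldsymbol m(\mu)\in\mathbf V_h^p$ be given by $(\boldsymbol l(w),\boldsymbol r)_{\mathcal T_h}=-(w,\nabla\cdot\boldsymbol r)_{\mathcal T_h}$ and $(\boldsymbol m(\mu),\boldsymbol r)_{\mathcal T_h}=\langle\mu,\boldsymbol r\cdot\boldsymbol n\rangle_{\partial\mathcal T_h}$ for all $\boldsymbol r\in\mathbf V_h^p$.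 For $\mathbf v=(v,\eta)$ and $\mathbf w=(w,\mu)$ in $\mathbf W$ put $\boldsymbol q=\boldsymbol l(v)+\boldsymbol m(\eta)$ and $$\begin{aligned}a_h(\mathbf v,\mathbf w;(\kappa,\varrho,\nu))={}&(\kappa\boldsymbol q,\nabla w)_{\mathcal T_h}-\langle\kappa\boldsymbol q\cdot\boldsymbol n-\kappa\tau(v-\eta),w\rangle_{\partial\mathcal T_h}+(\varrho v,w)_{\mathcal T_h}\\&+\langle\kappa\boldsymbol q\cdot\boldsymbol n-\kappa\tau(v-\eta),\mu\rangle_{\partial\mathcal T_h}+\langle\nu\eta,\mu\rangle_{\partial\mathcal D},\end{aligned}$$ $$b_h(\mathbf w)=(f,w)_{\mathcal T_h}+\langle g,\mu\rangle_{\partial\mathcal D},\qquad(\mathbf v,\mathbf w)_{\mathbf W}=a_h(\mathbf v,\mathbf w;(1,1,1)),\qquad\|\mathbf w\|_{\mathbf W}=\sqrt{(\mathbf w,\mathbf w)_{\mathbf W}}.$$ Here $\varrho,f$ are complex-valued and integrable on $\mathcal D$, and $\nu,g$ are complex-valued and integrable on $\partial\mathcal D$. Let $\kappa(x,y)=\bar\kappa(x)+\sum_{q=1}^Q\psi_q(x)y_q$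 for $y\in\Lambda=\prod_{q=1}^Q[-\gamma_q,\gamma_q]$, where $\bar\kappa,\psi_q$ are real, measurable and bounded on each closed element (they may jump between elements). Write $a_h(\cdot,\cdot;y)=a_h(\cdot,\cdot;(\kappa(\cdot,y),\varrho,\nu))$, and let $\ell_h:\mathbf W\to\mathbb C$ be linear. For $y\in\Lambda$ let $\mathbf u_h(y)\in\mathbf W$ solve $a_h(\mathbf u_h(y),\mathbf w;y)=b_h(\mathbf w)$ for all $\mathbf w\in\mathbf W$, and let $s_h(y)=\operatorname{Re}\ell_h(\mathbf u_h(y))$. Let $(\zeta_n^{\rm pr})_{n\le N_{\max}}$ and $(\zeta_n^{\rm du})_{n\le N_{\max}}$ be $(\cdot,\cdot)_{\mathbf W}$-orthonormal families in $\mathbf W$, let $1\le N\le N_{\max}$, and let $\mathbf W_N^{\rm pr},\mathbf W_N^{\rm du}$ be the spans of their first $N$ members. For $y\in\Lambda$ let $\mathbf u_N(y)\in\mathbf W_N^{\rm pr}$ and $\boldsymbol\phi_N(y)\in\mathbf W_N^{\rm du}$ satisfy $a_h(\mathbf u_N(y),\mathbf w;y)=b_h(\mathbf w)$ for all $\mathbf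 w\in\mathbf W_N^{\rm pr}$ and $a_h(\mathbf w,\boldsymbol\phi_N(y);y)=-\ell_h(\mathbf w)$ for all $\mathbf w\in\mathbf W_N^{\rm du}$, and set $$s_N(y)=\operatorname{Re}\bigl(\ell_h(\mathbf u_N(y))+a_h(\mathbf u_N(y),\boldsymbol\phi_N(y);y)-b_h(\boldsymbol\phi_N(y))\bigr).$$ Let $\tilde\beta(y)$ satisfy, for every $y\in\Lambda$, $$0<\tilde\beta(y)\le\beta_h(y)=\inf_{\mathbf w\ne0}\sup_{\mathbf v\ne0}\frac{|a_h(\mathbf w,\mathbf v;y)|}{\|\mathbf w\|_{\mathbf W}\|\mathbf v\|_{\mathbf W}}.$$ With $\|r\|_{\mathbf W'}=\sup_{\mathbf w\neq 0}|r(\mathbf w)|/\|\mathbf w\|_{\mathbf W}$ let $$\Delta_N^{\rm pr}(y)=\frac{\|b_h-a_h(\mathbf u_N(y),\cdot;y)\|_{\mathbf W'}}{\tilde\beta(y)},\qquad\Delta_N^{\rm du}(y)=\frac{\|-\ell_h-a_h(\cdot,\boldsymbol\phi_N(y);y)\|_{\mathbf W'}}{\tilde\beta(y)},\qquad\Delta_N^s=\tilde\beta\,\Delta_N^{\rm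 pr}\,\Delta_N^{\rm du}.$$ Assume that $s_N$ and $\Delta_N^s$ are measurable. Let $\rho(y)=\prod_q\rho_q(y_q)$ with bounded probability densities $\rho_q$ on $[-\gamma_q,\gamma_q]$, let $y_1,y_2,\dots$ be independent random vectors in $\Lambda$ with density $\rho$, and let $E[s_h]=\int_\Lambda s_h(y)\rho(y)\,dy$. For a function $s$ on $\Lambda$ put $$E_M[s]=\frac1M\sum_{m=1}^M s(y_m),\qquad V_M[s]=\frac1{M-1}\sum_{m=1}^M\bigl(E_M[s]-s(y_m)\bigr)^2,$$ and let $$\Delta^E_{N,M}=\frac1M\sum_{m=1}^M\Delta_N^s(y_m),\qquad\Delta^V_{N,M}=\frac1{M-1}\sum_{m=1}^M\bigl(\Delta_N^s(y_m)+\Delta^E_{N,M}\bigr)\bigl(\Delta_N^s(y_m)+2|s_N(y_m)|\bigr).$$ For $a>0$ set $$\widetilde\Delta^E_{N,M}=a\sqrt{\frac{V_M[s_N]+\Delta^V_{N,M}}{M}}+\Delta^E_{N,M}.$$ Then the following limit exists and satisfies $$\lim_{M\to\infty}\Pr\Bigl(\bigl|E[s_h]-E_M[s_N]\bigr|\le\widetilde\Delta^E_{N,M}\Bigr)\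 \ge\ \operatorname{erf}\Bigl(\frac{a}{\sqrt2}\Bigr).$$ -/

import Mathlib

open MeasureTheory ProbabilityTheory Filter Topology

noncomputable section

namespace HDG

open scoped Classical ComplexConjugate

/-! ## Triangulations -/

/-- A triangulation of the physical domain `domain ⊆ ℝᵈ`: a finite simplicial complex, all of whose
simplices are faces of `d`-simplices, that covers the closure of the domain. (Being a simplicial
complex, it is conforming: two simplices meet in a common face or not at all.) -/
structure Mesh (d : ℕ) where
  domain : Set (EuclideanSpace ℝ (Fin d))
  isOpen_domain : IsOpen domain
  complex : Geometry.SimplicialComplex ℝ (EuclideanSpace ℝ (Fin d))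
  finite_faces : complex.faces.Finite
  pure : ∀ s ∈ complex.faces, ∃ t ∈ complex.faces, s ⊆ t ∧ t.card = d + 1
  space_eq : complex.space = closure domain

variable {d : ℕ}

namespace Mesh

/-- The elements `T ∈ 𝒯_h`, given by their `d + 1` vertices. -/
def Elem (𝒯 : Mesh d) : Type :=
  {T : Finset (EuclideanSpace ℝ (Fin d)) // T ∈ 𝒯.complex.faces ∧ T.card = d + 1}

/-- The faces `F ∈ ℱ_h` of the elements, given by their `d` vertices. -/
def Face (𝒯 : Mesh d) : Type :=
  {F : Finset (EuclideanSpace ℝ (Fin d)) // F ∈ 𝒯.complex.faces ∧ F.card = d}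

instance (𝒯 : Mesh d) : Fintype 𝒯.Elem :=
  @Fintype.ofFinite _ ((𝒯.finite_faces.subset fun _ h => h.1 :
    {T | T ∈ 𝒯.complex.faces ∧ T.card = d + 1}.Finite).to_subtype)

instance (𝒯 : Mesh d) : Fintype 𝒯.Face :=
  @Fintype.ofFinite _ ((𝒯.finite_faces.subset fun _ h => h.1 :
    {F | F ∈ 𝒯.complex.faces ∧ F.card = d}.Finite).to_subtype)

/-- The closed simplex spanned by an element. -/
def Elem.hull {𝒯 : Mesh d} (T : 𝒯.Elem) : Set (EuclideanSpace ℝ (Fin d)) :=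
  convexHull ℝ (T.1 : Set (EuclideanSpace ℝ (Fin d)))

/-- The closed `(d - 1)`-simplex spanned by a face. -/
def Face.hull {𝒯 : Mesh d} (F : 𝒯.Face) : Set (EuclideanSpace ℝ (Fin d)) :=
  convexHull ℝ (F.1 : Set (EuclideanSpace ℝ (Fin d)))

/-- The faces that make up the boundary `∂T` of an element `T`. -/
def Elem.faces {𝒯 : Mesh d} (T : 𝒯.Elem) : Finset 𝒯.Face :=
  Finset.univ.filter fun F => F.1 ⊆ T.1

/-- The faces that make up the boundary `∂𝒟` of the domain. -/
def boundaryFaces (𝒯 : Mesh d) : Finset 𝒯.Face :=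
  Finset.univ.filter fun F => F.hull ⊆ frontier 𝒯.domain

/-- The outward unit normal `n` of the element `T` on its face `F`: the normalized component,
orthogonal to `F`, of the vector from the barycentre of `T` to the barycentre of `F`. -/
def normal {𝒯 : Mesh d} (T : 𝒯.Elem) (F : 𝒯.Face) : EuclideanSpace ℝ (Fin d) :=
  let v := (vectorSpan ℝ (F.1 : Set (EuclideanSpace ℝ (Fin d))))ᗮ.starProjection
    (F.1.centroid ℝ id - T.1.centroid ℝ id)
  ‖v‖⁻¹ • v

end Mesh

/-! ## Piecewise polynomial spaces -/

/-- Complex polynomials in `d` variables of total degree at most `p`. -/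
abbrev Poly (d p : ℕ) : Submodule ℂ (MvPolynomial (Fin d) ℂ) :=
  MvPolynomial.restrictTotalDegree (Fin d) ℂ p

/-- The value of a complex polynomial at a point of `ℝᵈ`, as a linear map in the polynomial. -/
def evalAt (x : EuclideanSpace ℝ (Fin d)) : MvPolynomial (Fin d) ℂ →ₗ[ℂ] ℂ :=
  (MvPolynomial.aeval fun i => ((x i : ℝ) : ℂ)).toLinearMap

/-- Restriction of a polynomial to a set `S`; the value is set to `0` outside `S`. -/
def restrictTo (S : Set (EuclideanSpace ℝ (Fin d))) :
    MvPolynomial (Fin d) ℂ →ₗ[ℂ] (EuclideanSpace ℝ (Fin d) → ℂ) where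
  toFun q := S.indicator fun x => evalAt x q
  map_add' q r := by
    funext x; by_cases hx : x ∈ S <;> simp [hx]
  map_smul' c q := by
    funext x; by_cases hx : x ∈ S <;> simp [hx]

/-- `P_p(F)`: the functions on a face that are restrictions of polynomials of degree `≤ p`. -/
def FacePoly (p : ℕ) {𝒯 : Mesh d} (F : 𝒯.Face) :
    Submodule ℂ (EuclideanSpace ℝ (Fin d) → ℂ) :=
  (Poly d p).map (restrictTo F.hull)

/-- `V_h^p`: vector fields whose components are, on each element, polynomials of degree `≤ p`. -/
abbrev VSpace (𝒯 : Mesh d) (p : ℕ) : Type := 𝒯.Elem → Fin d → Poly d p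

/-- `W_h^p`: functions that are, on each element, polynomials of degree `≤ p`. -/
abbrev WSpace (𝒯 : Mesh d) (p : ℕ) : Type := 𝒯.Elem → Poly d p

/-- `M_h^p`: functions on the skeleton that are, on each face, polynomials of degree `≤ p`. -/
abbrev MSpace (𝒯 : Mesh d) (p : ℕ) : Type := ∀ F : 𝒯.Face, FacePoly p F

/-- The product approximation space `𝐖_h^p = W_h^p × M_h^p`. -/
abbrev Space (𝒯 : Mesh d) (p : ℕ) : Type := WSpace 𝒯 p × MSpace 𝒯 p

variable {𝒯 : Mesh d} {p : ℕ}

/-- The value of `w ∈ W_h^p` at `x`, taken from the element `T`. -/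
def WSpace.val (w : WSpace 𝒯 p) (T : 𝒯.Elem) (x : EuclideanSpace ℝ (Fin d)) : ℂ :=
  evalAt x (w T : MvPolynomial (Fin d) ℂ)

/-- The `i`-th component of the gradient of `w ∈ W_h^p` at `x`, taken from the element `T`. -/
def WSpace.grad (w : WSpace 𝒯 p) (T : 𝒯.Elem) (x : EuclideanSpace ℝ (Fin d)) (i : Fin d) : ℂ :=
  evalAt x (MvPolynomial.pderiv i (w T : MvPolynomial (Fin d) ℂ))

/-- The `i`-th component of `r ∈ V_h^p` at `x`, taken from the element `T`. -/
def VSpace.val (r : VSpace 𝒯 p) (T : 𝒯.Elem) (x : EuclideanSpace ℝ (Fin d)) (i : Fin d) : ℂ :=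
  evalAt x (r T i : MvPolynomial (Fin d) ℂ)

/-- The divergence of `r ∈ V_h^p` at `x`, taken from the element `T`. -/
def VSpace.div (r : VSpace 𝒯 p) (T : 𝒯.Elem) (x : EuclideanSpace ℝ (Fin d)) : ℂ :=
  ∑ i, evalAt x (MvPolynomial.pderiv i (r T i : MvPolynomial (Fin d) ℂ))

/-- The normal component `r · n` at a point `x` of the face `F` of `T`, taken from `T`. -/
def VSpace.flux (r : VSpace 𝒯 p) (T : 𝒯.Elem) (F : 𝒯.Face)
    (x : EuclideanSpace ℝ (Fin d)) : ℂ :=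
  ∑ i, VSpace.val r T x i * ((Mesh.normal T F i : ℝ) : ℂ)

/-- The value of `μ ∈ M_h^p` at a point `x` of the face `F`. -/
def MSpace.val (μ : MSpace 𝒯 p) (F : 𝒯.Face) (x : EuclideanSpace ℝ (Fin d)) : ℂ :=
  (μ F : EuclideanSpace ℝ (Fin d) → ℂ) x

/-! ## The HDG forms -/

/-- `∑_{T ∈ 𝒯_h} ∫_T φ dx`, for an integrand given element by element. -/
def intElems (φ : 𝒯.Elem → EuclideanSpace ℝ (Fin d) → ℂ) : ℂ :=
  ∑ T, ∫ x in T.hull, φ T x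

/-- `∑_{T ∈ 𝒯_h} ∫_{∂T} φ ds`, for an integrand given element by element and face by face; `ds` is
the `(d - 1)`-dimensional surface measure. -/
def intSkeleton (φ : 𝒯.Elem → 𝒯.Face → EuclideanSpace ℝ (Fin d) → ℂ) : ℂ :=
  ∑ T, ∑ F ∈ T.faces, ∫ x in F.hull, φ T F x ∂μHE[d - 1]

/-- `∫_{∂𝒟} φ ds`. -/
def intBoundary (φ : 𝒯.Face → EuclideanSpace ℝ (Fin d) → ℂ) : ℂ :=
  ∑ F ∈ 𝒯.boundaryFaces, ∫ x in F.hull, φ F x ∂μHE[d - 1]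

lemma hull_interior (T : 𝒯.Elem) : (interior T.hull).Nonempty := by
  have h := 𝒯.complex.indep T.2.1
  have h2 : affineSpan ℝ (T.1 : Set (EuclideanSpace ℝ (Fin d))) = ⊤ := by
    have := h.affineSpan_eq_top_iff_card_eq_finrank_add_one
    simp only [Subtype.range_coe_subtype, Finset.setOfPred_mem, Fintype.card_coe,
      finrank_euclideanSpace_fin] at this
    exact this.2 T.2.2
  exact interior_convexHull_nonempty_iff_affineSpan_eq_top.2 h2

lemma evalAt_continuous (q : MvPolynomial (Fin d) ℂ) :
    Continuous fun x : EuclideanSpace ℝ (Fin d) => evalAt x q := by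
  have : Continuous fun x : EuclideanSpace ℝ (Fin d) => fun i => ((x i : ℝ) : ℂ) := by fun_prop
  exact (MvPolynomial.continuous_eval q).comp this

lemma eq_zero_of_open (q : MvPolynomial (Fin d) ℂ) (U : Set (EuclideanSpace ℝ (Fin d)))
    (hU : IsOpen U) (hne : U.Nonempty) (h : ∀ x ∈ U, evalAt x q = 0) : q = 0 := by
  obtain ⟨x0, hx0⟩ := hne
  have hU' : IsOpen ((WithLp.toLp 2 : (Fin d → ℝ) → _) ⁻¹' U) :=
    hU.preimage (PiLp.continuous_toLp 2 _)
  obtain ⟨ε, hε, hb⟩ := Metric.isOpen_iff.1 hU' (WithLp.ofLp x0) (by simpa using hx0)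
  refine MvPolynomial.funext_set (fun i => (fun t : ℝ => (t : ℂ)) '' Metric.ball (x0 i) ε)
    (fun i => ?_) fun z hz => ?_
  · refine Set.Infinite.image (Complex.ofReal_injective.injOn) ?_
    rw [Real.ball_eq_Ioo]
    exact Set.Ioo_infinite (by linarith)
  · have hz' : ∀ i, ∃ t ∈ Metric.ball (x0 i) ε, (t : ℂ) = z i := fun i => hz i (Set.mem_univ i)
    choose t ht htz using hz'
    have hm : t ∈ Metric.ball (WithLp.ofLp x0) ε := by
      rw [Metric.mem_ball, dist_pi_lt_iff hε]; exact ht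
    have := h _ (hb hm)
    obtain rfl : (fun i => (t i : ℂ)) = z := funext htz
    rw [map_zero, ← this]
    exact (DFunLike.congr_fun (MvPolynomial.coe_aeval_eq_eval (fun i => (t i : ℂ))) q).symm

lemma hull_compact (T : 𝒯.Elem) : IsCompact T.hull :=
  T.1.finite_toSet.isCompact_convexHull ℝ

lemma intOn (T : 𝒯.Elem) {h : EuclideanSpace ℝ (Fin d) → ℂ} (hh : Continuous h) :
    IntegrableOn h T.hull :=
  hh.continuousOn.integrableOn_compact (hull_compact T)

/-- The inner product `(q, r)_{𝒯_h}` on `V_h^p`. -/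
def gram (q r : VSpace 𝒯 p) : ℂ :=
  intElems (fun T x => ∑ i, VSpace.val q T x i * conj (VSpace.val r T x i))

lemma val_cont (q : VSpace 𝒯 p) (T : 𝒯.Elem) (i : Fin d) :
    Continuous fun x => VSpace.val q T x i := evalAt_continuous _

lemma gram_int (q r : VSpace 𝒯 p) (T : 𝒯.Elem) :
    IntegrableOn (fun x => ∑ i, VSpace.val q T x i * conj (VSpace.val r T x i)) T.hull := by
  refine intOn T ?_
  have := val_cont q T
  have := val_cont r T
  fun_prop

lemma gram_def (q : VSpace 𝒯 p) (h : gram q q = 0) : q = 0 := by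
  have key : ∀ T : 𝒯.Elem, ∫ x in T.hull, ∑ i, ‖VSpace.val q T x i‖ ^ 2 = 0 := by
    have h1 : gram q q =
        ((∑ T : 𝒯.Elem, ∫ x in T.hull, ∑ i, ‖VSpace.val q T x i‖ ^ 2 : ℝ) : ℂ) := by
      simp only [gram, intElems, Complex.mul_conj']
      push_cast
      refine Finset.sum_congr rfl fun T _ => ?_
      rw [← integral_complex_ofReal]
      push_cast
      rfl
    rw [h1, Complex.ofReal_eq_zero, Finset.sum_eq_zero_iff_of_nonneg] at h
    · exact fun T => h T (Finset.mem_univ T)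
    · exact fun T _ => integral_nonneg fun x => Finset.sum_nonneg fun i _ => sq_nonneg _
  funext T i
  have hc : Continuous fun x => ∑ i, ‖VSpace.val q T x i‖ ^ 2 := by
    have := val_cont q T
    fun_prop
  have h0 := (setIntegral_eq_zero_iff_of_nonneg_ae
    (Filter.Eventually.of_forall fun x => Finset.sum_nonneg fun i _ => sq_nonneg _)
    (hc.continuousOn.integrableOn_compact (hull_compact T))).1 (key T)
  have h2 : (fun x => ∑ i, ‖VSpace.val q T x i‖ ^ 2) =ᵐ[volume.restrict (interior T.hull)] 0 :=
    ae_restrict_of_ae_restrict_of_subset interior_subset h0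
  have h3 := Measure.eqOn_open_of_ae_eq h2 isOpen_interior hc.continuousOn continuousOn_const
  refine Subtype.ext (eq_zero_of_open _ _ isOpen_interior (hull_interior T) fun x hx => ?_)
  have h4 := (Finset.sum_eq_zero_iff_of_nonneg (fun i _ => sq_nonneg _)).1 (h3 hx) i
    (Finset.mem_univ i)
  simpa [VSpace.val] using h4

lemma val_add (q r : VSpace 𝒯 p) (T : 𝒯.Elem) (x) (i : Fin d) :
    VSpace.val (q + r) T x i = VSpace.val q T x i + VSpace.val r T x i := by
  simp [VSpace.val]

lemma val_smul (c : ℂ) (r : VSpace 𝒯 p) (T : 𝒯.Elem) (x) (i : Fin d) :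
    VSpace.val (c • r) T x i = c * VSpace.val r T x i := by
  simp [VSpace.val]

lemma gram_add_left (q q' r : VSpace 𝒯 p) : gram (q + q') r = gram q r + gram q' r := by
  simp only [gram, intElems, ← Finset.sum_add_distrib]
  refine Finset.sum_congr rfl fun T _ => ?_
  rw [← integral_add (gram_int _ _ _) (gram_int _ _ _)]
  simp only [val_add, add_mul, Finset.sum_add_distrib]

lemma gram_smul_left (c : ℂ) (q r : VSpace 𝒯 p) : gram (c • q) r = c * gram q r := by
  simp only [gram, intElems, Finset.mul_sum]
  refine Finset.sum_congr rfl fun T _ => ?_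
  rw [← integral_const_mul]
  simp only [val_smul, Finset.mul_sum, mul_assoc]

lemma gram_conj (q r : VSpace 𝒯 p) : conj (gram q r) = gram r q := by
  simp only [gram, intElems, map_sum, ← integral_conj]
  refine Finset.sum_congr rfl fun T _ => ?_
  simp only [map_mul, Complex.conj_conj, mul_comm]

/-- Every antilinear functional on `V_h^p` is represented by a unique element of `V_h^p`. -/
theorem existsUnique_riesz (φ : VSpace 𝒯 p → ℂ) (hadd : ∀ r s, φ (r + s) = φ r + φ s)
    (hsmul : ∀ (c : ℂ) r, φ (c • r) = conj c * φ r) :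
    ∃! q : VSpace 𝒯 p, ∀ r : VSpace 𝒯 p, gram q r = φ r := by
  let G : VSpace 𝒯 p →ₗ[ℝ] Module.Dual ℂ (VSpace 𝒯 p) :=
    { toFun q :=
        { toFun r := gram r q
          map_add' r s := gram_add_left r s q
          map_smul' c r := gram_smul_left c r q }
      map_add' q q' := by
        refine LinearMap.ext fun r => ?_
        change gram r (q + q') = gram r q + gram r q'
        rw [← gram_conj, gram_add_left, map_add, gram_conj, gram_conj]
      map_smul' c q := by
        refine LinearMap.ext fun r => ?_
        change gram r ((c : ℂ) • q) = (c : ℂ) * gram r q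
        rw [← gram_conj, gram_smul_left, map_mul, gram_conj, Complex.conj_ofReal] }
  have hinj : Function.Injective G := by
    rw [injective_iff_map_eq_zero]
    intro q hq
    exact gram_def q (DFunLike.congr_fun hq q)
  have : FiniteDimensional ℝ (VSpace 𝒯 p) := FiniteDimensional.complexToReal _
  have : FiniteDimensional ℝ (Module.Dual ℂ (VSpace 𝒯 p)) := FiniteDimensional.complexToReal _
  have hsurj : Function.Surjective G := by
    refine (LinearMap.injective_iff_surjective_of_finrank_eq_finrank ?_).1 hinj
    rw [finrank_real_of_complex, finrank_real_of_complex, Subspace.dual_finrank_eq]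
  obtain ⟨q, hq⟩ := hsurj
    { toFun r := conj (φ r)
      map_add' r s := by rw [hadd, map_add]
      map_smul' c r := by simp [hsmul] }
  have hq' : ∀ r, gram q r = φ r := fun r => by
    have : gram r q = conj (φ r) := DFunLike.congr_fun hq r
    rw [← gram_conj, this, Complex.conj_conj]
  refine ⟨q, hq', fun q' hq'' => hinj ?_⟩
  refine LinearMap.ext fun r => ?_
  change gram r q' = gram r q
  rw [← gram_conj q', ← gram_conj q, hq' r]
  exact congrArg _ (hq'' r)


/-- The element of `V_h^p` that represents the antilinear functional `φ` with respect to
`(·, ·)_{𝒯_h}`, i.e. the `q` with `(q, r)_{𝒯_h} = φ r` for all `r ∈ V_h^p`. -/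
def riesz (φ : VSpace 𝒯 p → ℂ) : VSpace 𝒯 p :=
  Classical.epsilon fun q : VSpace 𝒯 p => ∀ r : VSpace 𝒯 p, gram q r = φ r

theorem gram_riesz (φ : VSpace 𝒯 p → ℂ) (hadd : ∀ r s, φ (r + s) = φ r + φ s)
    (hsmul : ∀ (c : ℂ) r, φ (c • r) = conj c * φ r) (r : VSpace 𝒯 p) :
    gram (riesz φ) r = φ r :=
  Classical.epsilon_spec (p := fun q : VSpace 𝒯 p => ∀ r : VSpace 𝒯 p, gram q r = φ r)
    (existsUnique_riesz φ hadd hsmul).exists r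

/-- The lifting `l : W_h^p → V_h^p`, `(l(w), r)_{𝒯_h} = - (w, ∇·r)_{𝒯_h}`. -/
def liftW (w : WSpace 𝒯 p) : VSpace 𝒯 p :=
  riesz fun r => - intElems (fun T x => WSpace.val w T x * conj (VSpace.div r T x))

/-- The lifting `m : M_h^p → V_h^p`, `(m(μ), r)_{𝒯_h} = ⟨μ, r·n⟩_{∂𝒯_h}`. -/
def liftM (μ : MSpace 𝒯 p) : VSpace 𝒯 p :=
  riesz fun r => intSkeleton (fun T F x => MSpace.val μ F x * conj (VSpace.flux r T F x))

/-- The form `a_h((v, η), (w, μ); (κ, ϱ, ν))` with stabilization parameter `τ`. The coefficient `κ`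
is given element by element (`κ T x` for `x` in the closed simplex `T`), so that it may jump across
interelement faces; in integrals over `∂T` the branch belonging to `T` is used. -/
def aForm (τ : ℝ) (κ : 𝒯.Elem → EuclideanSpace ℝ (Fin d) → ℝ)
    (ϱ ν : EuclideanSpace ℝ (Fin d) → ℂ) (v w : Space 𝒯 p) : ℂ :=
  let q : VSpace 𝒯 p := liftW v.1 + liftM v.2
  let flux : 𝒯.Elem → 𝒯.Face → EuclideanSpace ℝ (Fin d) → ℂ := fun T F x =>
    (κ T x : ℂ) * VSpace.flux q T F x
      - (κ T x : ℂ) * (τ : ℂ) * (WSpace.val v.1 T x - MSpace.val v.2 F x)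
  intElems (fun T x => ∑ i, (κ T x : ℂ) * VSpace.val q T x i * conj (WSpace.grad w.1 T x i))
    - intSkeleton (fun T F x => flux T F x * conj (WSpace.val w.1 T x))
    + intElems (fun T x => ϱ x * WSpace.val v.1 T x * conj (WSpace.val w.1 T x))
    + intSkeleton (fun T F x => flux T F x * conj (MSpace.val w.2 F x))
    + intBoundary (fun F x => ν x * MSpace.val v.2 F x * conj (MSpace.val w.2 F x))

/-- The functional `b_h((w, μ)) = (f, w)_{𝒯_h} + ⟨g, μ⟩_{∂𝒟}`. -/
def bForm (f g : EuclideanSpace ℝ (Fin d) → ℂ) (w : Space 𝒯 p) : ℂ :=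
  intElems (fun T x => f x * conj (WSpace.val w.1 T x))
    + intBoundary (fun F x => g x * conj (MSpace.val w.2 F x))

/-- The inner product `(v, w)_𝐖 = a_h(v, w; (1, 1, 1))`. -/
def innerW (τ : ℝ) (v w : Space 𝒯 p) : ℂ :=
  aForm τ (fun _ _ => 1) (fun _ => 1) (fun _ => 1) v w

/-- The norm `‖w‖_𝐖 = √((w, w)_𝐖)`. -/
def normW (τ : ℝ) (w : Space 𝒯 p) : ℝ := √(innerW τ w w).re

/-! ## The parametrized problem and its reduced basis approximation -/

/-- The data of the stochastic boundary value problem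
`-∇·(κ∇u) + ϱ u = f` in `𝒟`, `κ∇u·n + ν u = g` on `∂𝒟`, with
`κ(x, y) = κ̄(x) + ∑_q ψ_q(x) y_q`, and of its HDG discretization. -/
structure Problem (𝒯 : Mesh d) (p Q : ℕ) where
  τ : ℝ
  τ_pos : 0 < τ
  κbar : 𝒯.Elem → EuclideanSpace ℝ (Fin d) → ℝ
  ψ : Fin Q → 𝒯.Elem → EuclideanSpace ℝ (Fin d) → ℝ
  ϱ : EuclideanSpace ℝ (Fin d) → ℂ
  ν : EuclideanSpace ℝ (Fin d) → ℂ
  f : EuclideanSpace ℝ (Fin d) → ℂ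
  g : EuclideanSpace ℝ (Fin d) → ℂ
  measurable_κbar : ∀ T, Measurable (κbar T)
  measurable_ψ : ∀ q T, Measurable (ψ q T)
  bounded_κbar : ∃ C, ∀ T, ∀ x ∈ T.hull, |κbar T x| ≤ C
  bounded_ψ : ∃ C, ∀ q T, ∀ x ∈ T.hull, |ψ q T x| ≤ C
  integrable_ϱ : ∀ T : 𝒯.Elem, IntegrableOn ϱ T.hull
  integrable_f : ∀ T : 𝒯.Elem, IntegrableOn f T.hull
  integrable_ν : ∀ F ∈ 𝒯.boundaryFaces, IntegrableOn ν F.hull μHE[d - 1]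
  integrable_g : ∀ F ∈ 𝒯.boundaryFaces, IntegrableOn g F.hull μHE[d - 1]
  /-- the discrete output functional `ℓ_h` -/
  ℓ : Space 𝒯 p →ₗ[ℂ] ℂ

namespace Problem

variable {Q : ℕ} (D : Problem 𝒯 p Q)

/-- `κ(x, y) = κ̄(x) + ∑_q ψ_q(x) y_q`. -/
def κ (y : Fin Q → ℝ) (T : 𝒯.Elem) (x : EuclideanSpace ℝ (Fin d)) : ℝ :=
  D.κbar T x + ∑ q, D.ψ q T x * y q

/-- `a_h(v, w; y)`. -/
def a (y : Fin Q → ℝ) (v w : Space 𝒯 p) : ℂ := aForm D.τ (D.κ y) D.ϱ D.ν v w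

/-- `b_h(w)`. -/
def b (w : Space 𝒯 p) : ℂ := bForm D.f D.g w

/-- `u` is the HDG solution at `y`: `a_h(u, w; y) = b_h(w)` for all `w ∈ 𝐖_h^p`. -/
def IsHDG (y : Fin Q → ℝ) (u : Space 𝒯 p) : Prop := ∀ w, D.a y u w = D.b w

/-- `u` is the primal reduced basis approximation at `y` in the space `S`. -/
def IsPrimalRB (S : Submodule ℂ (Space 𝒯 p)) (y : Fin Q → ℝ) (u : Space 𝒯 p) : Prop :=
  u ∈ S ∧ ∀ w ∈ S, D.a y u w = D.b w

/-- `φ` is the dual reduced basis approximation at `y` in the space `S`. -/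
def IsDualRB (S : Submodule ℂ (Space 𝒯 p)) (y : Fin Q → ℝ) (φ : Space 𝒯 p) : Prop :=
  φ ∈ S ∧ ∀ w ∈ S, D.a y w φ = - D.ℓ w

/-- The (real) HDG output `s_h(y) = Re ℓ_h(u_h(y))`. -/
def hdgOutput (uh : (Fin Q → ℝ) → Space 𝒯 p) (y : Fin Q → ℝ) : ℝ := (D.ℓ (uh y)).re

/-- The (real) reduced basis output
`s_N(y) = Re (ℓ_h(u_N(y)) + a_h(u_N(y), φ_N(y); y) - b_h(φ_N(y)))`. -/
def rbOutput (uN φN : (Fin Q → ℝ) → Space 𝒯 p) (y : Fin Q → ℝ) : ℝ :=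
  (D.ℓ (uN y) + D.a y (uN y) (φN y) - D.b (φN y)).re

/-- The dual norm `‖r‖_{𝐖'} = sup_w |r(w)| / ‖w‖_𝐖` (the quotient is read as `0` for `w = 0`). -/
def dualNorm (r : Space 𝒯 p → ℂ) : ℝ := ⨆ w : Space 𝒯 p, ‖r w‖ / normW D.τ w

/-- The inf-sup constant `β_h(y) = inf_{w ≠ 0} sup_{v ≠ 0} |a_h(w, v; y)| / (‖w‖_𝐖 ‖v‖_𝐖)`. -/
def infSup (y : Fin Q → ℝ) : ℝ :=
  ⨅ w : {w : Space 𝒯 p // w ≠ 0}, ⨆ v : {v : Space 𝒯 p // v ≠ 0},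
    ‖D.a y w.1 v.1‖ / (normW D.τ w.1 * normW D.τ v.1)

/-- The primal error bound `Δ_N^pr(y) = ‖b_h - a_h(u_N(y), ·; y)‖_{𝐖'} / β̃(y)`. -/
def primalBound (β : (Fin Q → ℝ) → ℝ) (uN : (Fin Q → ℝ) → Space 𝒯 p) (y : Fin Q → ℝ) : ℝ :=
  D.dualNorm (fun w => D.b w - D.a y (uN y) w) / β y

/-- The dual error bound `Δ_N^du(y) = ‖-ℓ_h - a_h(·, φ_N(y); y)‖_{𝐖'} / β̃(y)`. -/
def dualBound (β : (Fin Q → ℝ) → ℝ) (φN : (Fin Q → ℝ) → Space 𝒯 p) (y : Fin Q → ℝ) : ℝ :=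
  D.dualNorm (fun w => - D.ℓ w - D.a y w (φN y)) / β y

/-- The output error bound `Δ_N^s(y) = β̃(y) Δ_N^pr(y) Δ_N^du(y)`. -/
def outputBound (β : (Fin Q → ℝ) → ℝ) (uN φN : (Fin Q → ℝ) → Space 𝒯 p) (y : Fin Q → ℝ) : ℝ :=
  β y * D.primalBound β uN y * D.dualBound β φN y

end Problem

/-- The reduced basis space `span {ζ_n, 1 ≤ n ≤ N}` (the indices of `ζ` start at `0`). -/
def rbSpace {Nmax : ℕ} (ζ : Fin Nmax → Space 𝒯 p) (N : ℕ) : Submodule ℂ (Space 𝒯 p) :=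
  Submodule.span ℂ {v | ∃ n : Fin Nmax, (n : ℕ) < N ∧ ζ n = v}

/-! ## Random parameters and Monte Carlo estimators -/

/-- The parameter domain `Λ = ∏_q [-γ_q, γ_q]`. -/
def paramBox {Q : ℕ} (γ : Fin Q → ℝ) : Set (Fin Q → ℝ) :=
  Set.univ.pi fun q => Set.Icc (-γ q) (γ q)

/-- `ρ_q`, `q = 1, …, Q`, are bounded probability densities on `Λ_q = [-γ_q, γ_q]`. -/
structure IsDensity {Q : ℕ} (γ : Fin Q → ℝ) (ρ : Fin Q → ℝ → ℝ) : Prop where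
  measurable : ∀ q, Measurable (ρ q)
  nonneg : ∀ q, ∀ t ∈ Set.Icc (-γ q) (γ q), 0 ≤ ρ q t
  bounded : ∃ C, ∀ q, ∀ t ∈ Set.Icc (-γ q) (γ q), ρ q t ≤ C
  integral_eq_one : ∀ q, ∫ t in Set.Icc (-γ q) (γ q), ρ q t = 1

/-- The joint density `ρ(y) = ∏_q ρ_q(y_q)`. -/
def jointDensity {Q : ℕ} (ρ : Fin Q → ℝ → ℝ) (y : Fin Q → ℝ) : ℝ := ∏ q, ρ q (y q)

/-- The law on `Λ` with density `ρ(y) = ∏_q ρ_q(y_q)`. -/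
def paramLaw {Q : ℕ} (γ : Fin Q → ℝ) (ρ : Fin Q → ℝ → ℝ) : Measure (Fin Q → ℝ) :=
  (volume.restrict (paramBox γ)).withDensity fun y => ENNReal.ofReal (jointDensity ρ y)

/-- `E[s] = ∫_Λ s(y) ρ(y) dy`. -/
def expect {Q : ℕ} (γ : Fin Q → ℝ) (ρ : Fin Q → ℝ → ℝ) (s : (Fin Q → ℝ) → ℝ) : ℝ :=
  ∫ y in paramBox γ, s y * jointDensity ρ y

/-- The Monte Carlo mean `E_M[s]` over the samples `y_0, …, y_{M-1}`. -/
def mcMean {Q : ℕ} (s : (Fin Q → ℝ) → ℝ) (Y : ℕ → Fin Q → ℝ) (M : ℕ) : ℝ :=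
  1 / (M : ℝ) * ∑ m ∈ Finset.range M, s (Y m)

/-- The Monte Carlo variance `V_M[s]` over the samples `y_0, …, y_{M-1}`. -/
def mcVar {Q : ℕ} (s : (Fin Q → ℝ) → ℝ) (Y : ℕ → Fin Q → ℝ) (M : ℕ) : ℝ :=
  1 / ((M : ℝ) - 1) * ∑ m ∈ Finset.range M, (mcMean s Y M - s (Y m)) ^ 2

/-- `Δ^V_{N,M} = 1/(M-1) ∑_m (Δ_N^s(y_m) + Δ^E_{N,M}) (Δ_N^s(y_m) + 2 |s_N(y_m)|)`, where
`Δ^E_{N,M} = E_M[Δ_N^s]`. -/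
def mcVarBound {Q : ℕ} (sN Δs : (Fin Q → ℝ) → ℝ) (Y : ℕ → Fin Q → ℝ) (M : ℕ) : ℝ :=
  1 / ((M : ℝ) - 1) * ∑ m ∈ Finset.range M,
    (Δs (Y m) + mcMean Δs Y M) * (Δs (Y m) + 2 * |sN (Y m)|)

/-- `Δ̃^E_{N,M} = a √((V_M[s_N] + Δ^V_{N,M}) / M) + Δ^E_{N,M}`. -/
def mcTotalBound {Q : ℕ} (a : ℝ) (sN Δs : (Fin Q → ℝ) → ℝ) (Y : ℕ → Fin Q → ℝ) (M : ℕ) : ℝ :=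
  a * √((mcVar sN Y M + mcVarBound sN Δs Y M) / M) + mcMean Δs Y M

/-- The error function `erf x = 2/√π ∫_0^x exp(-t²) dt`. -/
def erf (x : ℝ) : ℝ := 2 / √Real.pi * ∫ t in (0 : ℝ)..x, Real.exp (-t ^ 2)

end HDG

end

/-!
The inf-sup bound turns the residuals into a pointwise estimate `|s_h - s_N| ≤ Δ_N^s`: the output
error is, up to sign, the real part of the dual residual at `e = u_h - u_N`, and `β̃ ‖e‖` is at most
the dual norm of the primal residual. Averaging over the samples gives
`|E_M[s_h] - E_M[s_N]| ≤ Δ^E_{N,M}` and `V_M[s_h] ≤ V_M[s_N] + Δ^V_{N,M}`, so the interval in the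
theorem contains the confidence interval for `E[s_h]` built from `s_h` itself, whose coverage tends
to `erf (a / √2)` by the central limit theorem.

For the existence of the limit, the event says that the normalized error `√M (E_M[s_h] - E[s_h])`
lies between two random endpoints. By the strong law each endpoint converges almost surely to a
constant, which is infinite when `Δ_N^s` fails to be square integrable or to vanish in the mean.
After applying `arctan` the limits are finite, and Slutsky's theorem gives the limit of the
probabilities.

Two facts about the discretization enter. The form `(·,·)_𝐖` is positive definite: integration by
parts on each element, which rests on the divergence theorem for simplices, writes `(w, w)_𝐖` as a
sum of squares. And `s_h` is continuous on the compact parameter domain, hence bounded, because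
Cramer's rule expresses the HDG solution through the entries of a matrix depending affinely on `y`.
-/

namespace HDG

open scoped ComplexConjugate Matrix

/-! ## The error function and the normal distribution -/

lemma gaussianPDFReal_zero_eq (v : NNReal) (x : ℝ) :
    gaussianPDFReal 0 v x = (√Real.pi)⁻¹ * ((√(2 * v))⁻¹ * Real.exp (-((√(2 * v))⁻¹ * x) ^ 2)) := by
  have hsqrt : √(2 * Real.pi * v) = √Real.pi * √(2 * v) := by
    rw [← Real.sqrt_mul Real.pi_pos.le]; ring_nf
  have hexp : -((√(2 * v))⁻¹ * x) ^ 2 = -(x - 0) ^ 2 / (2 * v) := by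
    rw [mul_pow, inv_pow, Real.sq_sqrt (by positivity)]; field_simp; ring
  rw [gaussianPDFReal, hsqrt, hexp, mul_inv, mul_assoc]

lemma integral_neg_self_exp_neg_sq (b : ℝ) :
    ∫ t in (-b)..b, Real.exp (-t ^ 2) = 2 * ∫ t in (0 : ℝ)..b, Real.exp (-t ^ 2) := by
  have hint : ∀ s t : ℝ, IntervalIntegrable (fun t : ℝ => Real.exp (-t ^ 2)) volume s t :=
    fun s t => (by fun_prop : Continuous fun t : ℝ => Real.exp (-t ^ 2)).intervalIntegrable _ _
  have hsymm : ∫ t in (-b)..0, Real.exp (-t ^ 2) = ∫ t in (0 : ℝ)..b, Real.exp (-t ^ 2) := by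
    have hneg := intervalIntegral.integral_comp_neg (a := 0) (b := b)
      fun t : ℝ => Real.exp (-t ^ 2)
    simpa using hneg.symm
  rw [← intervalIntegral.integral_add_adjacent_intervals (hint _ 0) (hint 0 _), hsymm, two_mul]

lemma gaussianReal_real_Icc {v : NNReal} (hv : v ≠ 0) {a b : ℝ} (hab : a ≤ b) :
    (gaussianReal 0 v).real (Set.Icc a b) = ∫ x in a..b, gaussianPDFReal 0 v x := by
  rw [intervalIntegral.integral_of_le hab, ← integral_Icc_eq_integral_Ioc, measureReal_def,
    gaussianReal_apply_eq_integral 0 hv, ENNReal.toReal_ofReal]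
  exact integral_nonneg fun x => gaussianPDFReal_nonneg 0 v x

lemma gaussianReal_real_Icc_eq_erf {v : NNReal} (hv : v ≠ 0) {a : ℝ} (ha : 0 ≤ a) :
    (gaussianReal 0 v).real (Set.Icc (-(a * √v)) (a * √v)) = erf (a / √2) := by
  have hscale : (√(2 * v))⁻¹ * (a * √v) = a / √2 := by
    have : 0 < √(v : ℝ) := Real.sqrt_pos.2 (by positivity)
    rw [Real.sqrt_mul (by norm_num)]; field_simp
  rw [gaussianReal_real_Icc hv (neg_le_self (by positivity))]
  simp only [gaussianPDFReal_zero_eq]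
  rw [intervalIntegral.integral_const_mul, intervalIntegral.integral_const_mul,
    intervalIntegral.mul_integral_comp_mul_left (f := fun t => Real.exp (-t ^ 2)), mul_neg,
    hscale, integral_neg_self_exp_neg_sq, erf]
  ring

lemma erf_div_sqrt_two_le_one {a : ℝ} (ha : 0 ≤ a) : erf (a / √2) ≤ 1 := by
  rw [← gaussianReal_real_Icc_eq_erf one_ne_zero ha]
  exact measureReal_le_one

/-! ## Random intervals with convergent endpoints -/

section RandomInterval

variable {Ω : Type*} [MeasurableSpace Ω] {P : Measure Ω}

/-- The random variables `T n` converge almost surely to a constant in `[s, ∞]`. -/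
def HasLimitGE (P : Measure Ω) (T : ℕ → Ω → ℝ) (s : ℝ) : Prop :=
  (∃ t, s ≤ t ∧ ∀ᵐ ω ∂P, Tendsto (fun n => T n ω) atTop (𝓝 t)) ∨
    ∀ᵐ ω ∂P, Tendsto (fun n => T n ω) atTop atTop

lemma HasLimitGE.add {T T' : ℕ → Ω → ℝ} {s s' : ℝ} (h : HasLimitGE P T s)
    (h' : HasLimitGE P T' s') : HasLimitGE P (fun n ω => T n ω + T' n ω) (s + s') := by
  rcases h with ⟨t, ht, h⟩ | h <;> rcases h' with ⟨t', ht', h'⟩ | h'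
  · refine .inl ⟨t + t', add_le_add ht ht', ?_⟩
    filter_upwards [h, h'] with ω hω hω' using hω.add hω'
  · refine .inr ?_
    filter_upwards [h, h'] with ω hω hω' using hω.add_atTop hω'
  · refine .inr ?_
    filter_upwards [h, h'] with ω hω hω' using hω.atTop_add hω'
  · refine .inr ?_
    filter_upwards [h, h'] with ω hω hω' using Tendsto.atTop_add_atTop hω hω'

lemma HasLimitGE.const_mul_sqrt {T : ℕ → Ω → ℝ} {v a : ℝ} (ha : 0 < a) (h : HasLimitGE P T v) :
    HasLimitGE P (fun n ω => a * √(T n ω)) (a * √v) := by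
  rcases h with ⟨t, ht, h⟩ | h
  · exact .inl ⟨a * √t, by gcongr, h.mono fun ω hω =>
      ((Real.continuous_sqrt.tendsto t).comp hω).const_mul a⟩
  · exact .inr (h.mono fun ω hω => (Real.tendsto_sqrt_atTop.comp hω).const_mul_atTop ha)

lemma HasLimitGE.arctan {T : ℕ → Ω → ℝ} {s : ℝ} (h : HasLimitGE P T s) :
    ∃ t, Real.arctan s ≤ t ∧ ∀ᵐ ω ∂P, Tendsto (fun n => Real.arctan (T n ω)) atTop (𝓝 t) := by
  rcases h with ⟨t, ht, h⟩ | h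
  · exact ⟨Real.arctan t, Real.arctan_strictMono.monotone ht, h.mono fun ω hω =>
      (Real.continuous_arctan.tendsto t).comp hω⟩
  · exact ⟨Real.pi / 2, (Real.arctan_lt_pi_div_two s).le, h.mono fun ω hω =>
      (Real.tendsto_arctan_atTop.mono_right nhdsWithin_le_nhds).comp hω⟩

variable [IsProbabilityMeasure P] {Ω' : Type*} [MeasurableSpace Ω'] {P' : Measure Ω'}
  [IsProbabilityMeasure P']

lemma tendsto_measureReal_preimage_of_null_frontier {ι E : Type*} [TopologicalSpace E]
    [MeasurableSpace E] [OpensMeasurableSpace E] [HasOuterApproxClosed E] {l : Filter ι}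
    {X : ι → Ω → E} {Z : Ω' → E} (h : TendstoInDistribution X l Z (fun _ => P) P') {C : Set E}
    (hC : MeasurableSet C) (hfr : P' (Z ⁻¹' frontier C) = 0) :
    Tendsto (fun i => P.real (X i ⁻¹' C)) l (𝓝 (P'.real (Z ⁻¹' C))) := by
  have hfr' : (P'.map Z) (frontier C) = 0 := by
    rwa [Measure.map_apply_of_aemeasurable h.aemeasurable_limit measurableSet_frontier]
  have hlim := ProbabilityMeasure.tendsto_measure_of_null_frontier_of_tendsto' h.tendsto
    (E := C) hfr'
  simp only [ProbabilityMeasure.coe_mk, Measure.map_apply_of_aemeasurable h.aemeasurable_limit hC,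
    Measure.map_apply_of_aemeasurable (h.forall_aemeasurable _) hC] at hlim
  exact (ENNReal.tendsto_toReal (measure_ne_top _ _)).comp hlim

lemma tendsto_measureReal_between {Z T₁ T₂ : ℕ → Ω → ℝ} {X : Ω' → ℝ} {t₁ t₂ : ℝ}
    (hZ : TendstoInDistribution Z atTop X (fun _ => P) P') (hX : ∀ t, P' (X ⁻¹' {t}) = 0)
    (hm₁ : ∀ n, AEMeasurable (T₁ n) P) (hm₂ : ∀ n, AEMeasurable (T₂ n) P)
    (h₁ : ∀ᵐ ω ∂P, Tendsto (fun n => T₁ n ω) atTop (𝓝 t₁))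
    (h₂ : ∀ᵐ ω ∂P, Tendsto (fun n => T₂ n ω) atTop (𝓝 t₂)) :
    Tendsto (fun n => P.real {ω | -T₁ n ω ≤ Z n ω ∧ Z n ω ≤ T₂ n ω}) atTop
      (𝓝 (P'.real {ω | -t₁ ≤ X ω ∧ X ω ≤ t₂})) := by
  have hmeas : ∀ n, AEMeasurable (fun ω => (T₁ n ω, T₂ n ω)) P := fun n => (hm₁ n).prodMk (hm₂ n)
  have hT : TendstoInMeasure P (fun n ω => (T₁ n ω, T₂ n ω)) atTop fun _ => (t₁, t₂) := by
    refine tendstoInMeasure_of_tendsto_ae (fun n => (hmeas n).aestronglyMeasurable) ?_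
    filter_upwards [h₁, h₂] with ω hω₁ hω₂ using hω₁.prodMk_nhds hω₂
  have hslutsky := hZ.continuous_comp_prodMk_of_tendstoInMeasure_const
    (g := fun x : ℝ × ℝ × ℝ => (x.1 + x.2.1, x.2.2 - x.1)) (by fun_prop) hT hmeas
  have hset : ∀ z s₁ s₂ : ℝ,
      (z + s₁, s₂ - z) ∈ Set.Ici (0 : ℝ) ×ˢ Set.Ici (0 : ℝ) ↔ -s₁ ≤ z ∧ z ≤ s₂ := by
    intro z s₁ s₂
    rw [Set.mem_prod, Set.mem_Ici, Set.mem_Ici, sub_nonneg, neg_le_iff_add_nonneg]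
  have hfr : P' ((fun ω => (X ω + t₁, t₂ - X ω)) ⁻¹'
      frontier (Set.Ici (0 : ℝ) ×ˢ Set.Ici (0 : ℝ))) = 0 := by
    refine measure_mono_null (fun ω hω => ?_) (measure_union_null (hX (-t₁)) (hX t₂))
    simp only [frontier_prod_eq, closure_Ici, frontier_Ici, Set.mem_preimage, Set.mem_union,
      Set.mem_prod, Set.mem_singleton_iff] at hω ⊢
    grind
  simpa only [Set.preimage, hset] using tendsto_measureReal_preimage_of_null_frontier hslutsky
    (measurableSet_Ici.prod measurableSet_Ici) hfr

/-- `arctan` turns endpoints that may tend to `∞` into convergent ones. -/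
lemma exists_tendsto_measureReal_between {Z T₁ T₂ : ℕ → Ω → ℝ} {X : Ω' → ℝ} {s : ℝ}
    (hZ : TendstoInDistribution Z atTop X (fun _ => P) P') (hX : ∀ t, P' (X ⁻¹' {t}) = 0)
    (hm₁ : ∀ n, AEMeasurable (T₁ n) P) (hm₂ : ∀ n, AEMeasurable (T₂ n) P)
    (h₁ : HasLimitGE P T₁ s) (h₂ : HasLimitGE P T₂ s) :
    ∃ L : ℝ, Tendsto (fun n => P.real {ω | -T₁ n ω ≤ Z n ω ∧ Z n ω ≤ T₂ n ω}) atTop (𝓝 L) ∧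
      P'.real {ω | -s ≤ X ω ∧ X ω ≤ s} ≤ L := by
  obtain ⟨t₁, hs₁, ht₁⟩ := h₁.arctan
  obtain ⟨t₂, hs₂, ht₂⟩ := h₂.arctan
  have hatom : ∀ t, P' ((Real.arctan ∘ X) ⁻¹' {t}) = 0 := by
    intro t
    by_cases ht : ∃ x, Real.arctan x = t
    · obtain ⟨x, rfl⟩ := ht
      refine measure_mono_null (fun ω hω => ?_) (hX x)
      exact Real.arctan_injective hω
    · convert measure_empty (μ := P')
      exact Set.eq_empty_of_forall_notMem fun ω hω => ht ⟨X ω, hω⟩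
  have hlim := tendsto_measureReal_between (hZ.continuous_comp Real.continuous_arctan) hatom
    (fun n => Real.measurable_arctan.comp_aemeasurable (hm₁ n))
    (fun n => Real.measurable_arctan.comp_aemeasurable (hm₂ n)) ht₁ ht₂
  simp only [Function.comp_apply, ← Real.arctan_neg, Real.arctan_le_arctan_iff] at hlim
  refine ⟨_, hlim, measureReal_mono fun ω hω => ?_⟩
  have h₁ := Real.arctan_le_arctan_iff.2 hω.1
  have h₂ := Real.arctan_le_arctan_iff.2 hω.2
  rw [Real.arctan_neg] at h₁
  exact ⟨(neg_le_neg hs₁).trans h₁, h₂.trans hs₂⟩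

end RandomInterval

/-! ## Divergence in the law of large numbers -/

section LawOfLargeNumbers

variable {Ω : Type*} [MeasurableSpace Ω] {P : Measure Ω} [IsFiniteMeasure P]

lemma integrable_min_natCast {f : Ω → ℝ} (hf : AEMeasurable f P) (h0 : 0 ≤ᵐ[P] f) (k : ℕ) :
    Integrable (fun ω => min (f ω) k) P := by
  refine Integrable.of_bound (hf.min aemeasurable_const).aestronglyMeasurable (k : ℝ) ?_
  filter_upwards [h0] with ω hω
  rw [Real.norm_of_nonneg (le_min hω k.cast_nonneg)]
  exact min_le_right _ _

lemma exists_lt_integral_min_natCast {f : Ω → ℝ} (hf : AEMeasurable f P) (h0 : 0 ≤ᵐ[P] f)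
    (hfi : ¬ Integrable f P) (c : ℝ) : ∃ k : ℕ, c < ∫ ω, min (f ω) k ∂P := by
  by_contra! hc
  refine hfi ⟨hf.aestronglyMeasurable, ?_⟩
  have hlim : Tendsto (fun k : ℕ => ∫⁻ ω, ENNReal.ofReal (min (f ω) k) ∂P) atTop
      (𝓝 (∫⁻ ω, ENNReal.ofReal (f ω) ∂P)) := by
    refine lintegral_tendsto_of_tendsto_of_monotone
      (fun k => (hf.min aemeasurable_const).ennreal_ofReal)
      (ae_of_all _ fun ω i j hij => ENNReal.ofReal_le_ofReal
        (min_le_min_left _ (by exact_mod_cast hij))) (ae_of_all _ fun ω => ?_)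
    obtain ⟨n, hn⟩ := exists_nat_ge (f ω)
    refine tendsto_const_nhds.congr' ?_
    filter_upwards [eventually_ge_atTop n] with k hk
    rw [min_eq_left (hn.trans (by exact_mod_cast hk))]
  have hle : ∫⁻ ω, ENNReal.ofReal (f ω) ∂P ≤ ENNReal.ofReal c := by
    refine le_of_tendsto' hlim fun k => ?_
    rw [← ofReal_integral_eq_lintegral_ofReal (integrable_min_natCast hf h0 k)
      (h0.mono fun ω hω => le_min hω k.cast_nonneg)]
    exact ENNReal.ofReal_le_ofReal (hc k)
  rw [hasFiniteIntegral_iff_ofReal h0]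
  exact hle.trans_lt ENNReal.ofReal_lt_top

lemma tendsto_sum_div_atTop_of_not_integrable {X : ℕ → Ω → ℝ} (h0 : 0 ≤ᵐ[P] X 0)
    (hX : ¬ Integrable (X 0) P) (hindep : Pairwise (Function.onFun (· ⟂ᵢ[P] ·) X))
    (hident : ∀ i, IdentDistrib (X i) (X 0) P P) :
    ∀ᵐ ω ∂P, Tendsto (fun n : ℕ => (∑ i ∈ Finset.range n, X i ω) / n) atTop atTop := by
  have hX0 : AEMeasurable (X 0) P := (hident 0).aemeasurable_snd
  have htrunc : ∀ k : ℕ, Measurable fun x : ℝ => min x k := fun k =>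
    measurable_id.min measurable_const
  have hlaw : ∀ᵐ ω ∂P, ∀ k : ℕ, Tendsto
      (fun n : ℕ => (∑ i ∈ Finset.range n, min (X i ω) k) / n) atTop
      (𝓝 (∫ ω, min (X 0 ω) k ∂P)) :=
    ae_all_iff.2 fun k => strong_law_ae_real (fun i ω => min (X i ω) k)
      (integrable_min_natCast hX0 h0 k) (fun i j hij => (hindep hij).comp (htrunc k) (htrunc k))
      fun i => (hident i).comp (htrunc k)
  filter_upwards [hlaw] with ω hω
  refine tendsto_atTop.2 fun c => ?_
  obtain ⟨k, hk⟩ := exists_lt_integral_min_natCast hX0 h0 hX c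
  filter_upwards [(hω k).eventually_const_lt hk] with n hn
  refine hn.le.trans ?_
  gcongr
  exact min_le_left _ _

end LawOfLargeNumbers

/-! ## Monte Carlo means -/

section Samples

variable {Q : ℕ} (Y : ℕ → Fin Q → ℝ) (M : ℕ)

lemma mcMean_eq_sum_div (s : (Fin Q → ℝ) → ℝ) :
    mcMean s Y M = (∑ m ∈ Finset.range M, s (Y m)) / M := by
  rw [mcMean, one_div_mul_eq_div]

variable {Y M} in
lemma mcMean_mono {s t : (Fin Q → ℝ) → ℝ} (h : ∀ m, s (Y m) ≤ t (Y m)) :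
    mcMean s Y M ≤ mcMean t Y M :=
  mul_le_mul_of_nonneg_left (Finset.sum_le_sum fun m _ => h m) (by positivity)

variable {Y M} in
lemma mcMean_nonneg {s : (Fin Q → ℝ) → ℝ} (h : ∀ m, 0 ≤ s (Y m)) : 0 ≤ mcMean s Y M :=
  mul_nonneg (by positivity) (Finset.sum_nonneg fun m _ => h m)

lemma mcMean_add (s t : (Fin Q → ℝ) → ℝ) :
    mcMean (fun y => s y + t y) Y M = mcMean s Y M + mcMean t Y M := by
  simp only [mcMean, Finset.sum_add_distrib, mul_add]

lemma mcMean_sub (s t : (Fin Q → ℝ) → ℝ) :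
    mcMean (fun y => s y - t y) Y M = mcMean s Y M - mcMean t Y M := by
  simp only [mcMean, Finset.sum_sub_distrib, mul_sub]

variable {M}

lemma mul_mcMean (hM : 0 < M) (s : (Fin Q → ℝ) → ℝ) :
    M * mcMean s Y M = ∑ m ∈ Finset.range M, s (Y m) := by
  rw [mcMean_eq_sum_div]; field_simp

lemma mcVar_eq (hM : 0 < M) (s : (Fin Q → ℝ) → ℝ) :
    mcVar s Y M = M / ((M : ℝ) - 1) * (mcMean (fun y => s y ^ 2) Y M - mcMean s Y M ^ 2) := by
  have h₁ := mul_mcMean Y hM s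
  have h₂ := mul_mcMean Y hM fun y => s y ^ 2
  simp only [mcVar, sub_sq, Finset.sum_add_distrib, Finset.sum_sub_distrib, Finset.sum_const,
    Finset.card_range, nsmul_eq_mul, ← Finset.mul_sum]
  rw [← h₁, ← h₂]
  ring

lemma mcVarBound_eq (hM : 0 < M) (s r : (Fin Q → ℝ) → ℝ) :
    mcVarBound s r Y M = M / ((M : ℝ) - 1) * (mcMean (fun y => r y * (r y + 2 * |s y|)) Y M
      + mcMean r Y M * mcMean (fun y => r y + 2 * |s y|) Y M) := by
  have h₁ := mul_mcMean Y hM fun y => r y * (r y + 2 * |s y|)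
  have h₂ := mul_mcMean Y hM fun y => r y + 2 * |s y|
  simp only [mcVarBound, add_mul (r _), Finset.sum_add_distrib (f := fun m => r (Y m) * _),
    ← Finset.mul_sum]
  rw [← h₁, ← h₂]
  ring

lemma mcVar_nonneg (hM : 1 < M) (s : (Fin Q → ℝ) → ℝ) : 0 ≤ mcVar s Y M := by
  have hM' : (0 : ℝ) < (M : ℝ) - 1 := sub_pos.2 (by exact_mod_cast hM)
  exact mul_nonneg (by positivity) (Finset.sum_nonneg fun m _ => sq_nonneg _)

/-- Since `δ(y_m) - E_M[δ]` has mean zero, the constant factor `E_M[δ] + 2 E_M[t]` drops out. -/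
lemma sum_sq_mcMean_add_sub (hM : 0 < M) (t δ : (Fin Q → ℝ) → ℝ) :
    ∑ m ∈ Finset.range M, (mcMean (fun y => t y + δ y) Y M - (t (Y m) + δ (Y m))) ^ 2
      = ∑ m ∈ Finset.range M, ((mcMean t Y M - t (Y m)) ^ 2
        + (δ (Y m) - mcMean δ Y M) * (δ (Y m) + 2 * t (Y m))) := by
  have hmean : ∑ m ∈ Finset.range M, (mcMean δ Y M - δ (Y m)) = 0 := by
    rw [Finset.sum_sub_distrib, ← mul_mcMean Y hM, Finset.sum_const, Finset.card_range,
      nsmul_eq_mul, sub_self]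
  have hsplit : ∀ m, (mcMean (fun y => t y + δ y) Y M - (t (Y m) + δ (Y m))) ^ 2
      = (mcMean t Y M - t (Y m)) ^ 2 + (δ (Y m) - mcMean δ Y M) * (δ (Y m) + 2 * t (Y m))
        + (mcMean δ Y M + 2 * mcMean t Y M) * (mcMean δ Y M - δ (Y m)) := by
    intro m
    rw [mcMean_add]
    ring
  simp only [hsplit]
  rw [Finset.sum_add_distrib, ← Finset.mul_sum, hmean, mul_zero, add_zero]

variable {Y} {s t r : (Fin Q → ℝ) → ℝ} (h : ∀ m, |s (Y m) - t (Y m)| ≤ r (Y m))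
include h

lemma abs_mcMean_sub_mcMean_le : |mcMean s Y M - mcMean t Y M| ≤ mcMean r Y M := by
  rw [abs_sub_le_iff, ← mcMean_sub, ← mcMean_sub]
  exact ⟨mcMean_mono fun m => (abs_sub_le_iff.1 (h m)).1,
    mcMean_mono fun m => (abs_sub_le_iff.1 (h m)).2⟩

lemma mcVar_le_mcVar_add_mcVarBound (hM : 1 < M) :
    mcVar s Y M ≤ mcVar t Y M + mcVarBound t r Y M := by
  have hM' : (0 : ℝ) < (M : ℝ) - 1 := sub_pos.2 (by exact_mod_cast hM)
  set δ : (Fin Q → ℝ) → ℝ := fun y => s y - t y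
  have hs : s = fun y => t y + δ y := funext fun y => by ring
  have hmean : |mcMean δ Y M| ≤ mcMean r Y M := by
    rw [mcMean_sub]; exact abs_mcMean_sub_mcMean_le h
  rw [mcVar, mcVar, mcVarBound, ← mul_add, ← Finset.sum_add_distrib, hs,
    sum_sq_mcMean_add_sub Y (by omega)]
  refine mul_le_mul_of_nonneg_left (Finset.sum_le_sum fun m _ => ?_) (by positivity)
  refine add_le_add_right ?_ _
  refine (le_abs_self _).trans ?_
  rw [abs_mul]
  have hsub : |δ (Y m) - mcMean δ Y M| ≤ r (Y m) + mcMean r Y M :=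
    (abs_sub _ _).trans (add_le_add (h m) hmean)
  have hadd : |δ (Y m) + 2 * t (Y m)| ≤ r (Y m) + 2 * |t (Y m)| := by
    refine (abs_add_le _ _).trans (add_le_add (h m) ?_)
    rw [abs_mul, abs_two]
  exact mul_le_mul hsub hadd (abs_nonneg _) ((abs_nonneg _).trans hsub)

omit h in
lemma mcMean_sq_le_mcVarBound (hr : ∀ m, 0 ≤ r (Y m)) (hM : 1 < M) :
    mcMean (fun y => r y ^ 2) Y M ≤ mcVarBound t r Y M := by
  have hM' : (0 : ℝ) < (M : ℝ) - 1 := sub_pos.2 (by exact_mod_cast hM)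
  have hmean : 0 ≤ mcMean r Y M := mcMean_nonneg hr
  refine mul_le_mul (one_div_le_one_div_of_le hM' (by linarith))
    (Finset.sum_le_sum fun m _ => ?_) (Finset.sum_nonneg fun m _ => sq_nonneg _) (by positivity)
  have hrm := hr m
  calc r (Y m) ^ 2 = r (Y m) * r (Y m) := sq _
    _ ≤ (r (Y m) + mcMean r Y M) * (r (Y m) + 2 * |t (Y m)|) := by
      gcongr
      · exact le_add_of_nonneg_right hmean
      · exact le_add_of_nonneg_right (by positivity)

lemma abs_mcMean_sub_mcMean_le_mcTotalBound {a : ℝ} (ha : 0 ≤ a) :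
    |mcMean s Y M - mcMean t Y M| ≤ mcTotalBound a t r Y M :=
  (abs_mcMean_sub_mcMean_le h).trans (le_add_of_nonneg_left (by positivity))

end Samples

/-- After scaling by `√M`, the event that the confidence interval covers `e` says that the
normalized error of the exact mean lies between two endpoints. -/
lemma abs_sub_mcMean_le_mcTotalBound_iff {Q : ℕ} {Y : ℕ → Fin Q → ℝ} {M : ℕ} (hM : 0 < M)
    (s t r : (Fin Q → ℝ) → ℝ) (a e : ℝ) :
    |e - mcMean t Y M| ≤ mcTotalBound a t r Y M ↔
      -(a * √(mcVar t Y M + mcVarBound t r Y M)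
          + √M * mcMean (fun y => r y - (s y - t y)) Y M) ≤ √M * (mcMean s Y M - e) ∧
        √M * (mcMean s Y M - e) ≤ a * √(mcVar t Y M + mcVarBound t r Y M)
          + √M * mcMean (fun y => r y + (s y - t y)) Y M := by
  have hM' : 0 < √(M : ℝ) := Real.sqrt_pos.2 (by exact_mod_cast hM)
  have hscale : a * √(mcVar t Y M + mcVarBound t r Y M)
      = √M * (a * √((mcVar t Y M + mcVarBound t r Y M) / M)) := by
    rw [Real.sqrt_div' _ (by positivity)]; field_simp
  rw [hscale, ← mul_add, ← mul_add, ← mul_neg, mul_le_mul_iff_right₀ hM',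
    mul_le_mul_iff_right₀ hM', mcMean_sub, mcMean_sub, mcMean_add, mcMean_sub, mcTotalBound, abs_le]
  constructor <;> rintro ⟨h₁, h₂⟩ <;> constructor <;> linarith

/-! ## Coverage of the Monte Carlo confidence interval -/

section Sampling

variable {Ω E : Type*} [MeasurableSpace Ω] [MeasurableSpace E] {P : Measure Ω} {μ : Measure E}
  {Y : ℕ → Ω → E} (hYi : iIndepFun Y P) (hY : ∀ m, HasLaw (Y m) μ P)

include hY

lemma ae_forall_sample {p : E → Prop} (h : ∀ᵐ y ∂μ, p y) : ∀ᵐ ω ∂P, ∀ m, p (Y m ω) :=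
  ae_all_iff.2 fun m => ae_of_ae_map (hY m).aemeasurable (by rwa [(hY m).map_eq])

lemma aemeasurable_comp_sample {f : E → ℝ} (hf : AEMeasurable f μ) (m : ℕ) :
    AEMeasurable (fun ω => f (Y m ω)) P :=
  AEMeasurable.comp_aemeasurable (by rwa [(hY m).map_eq]) (hY m).aemeasurable

lemma identDistrib_comp_sample {f : E → ℝ} (hf : AEMeasurable f μ) (m : ℕ) :
    IdentDistrib (fun ω => f (Y m ω)) (fun ω => f (Y 0 ω)) P P :=
  ((hY m).identDistrib (hY 0)).comp_of_aemeasurable (by rwa [(hY m).map_eq])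

include hYi in
lemma iIndepFun_comp_sample {f : E → ℝ} (hf : AEMeasurable f μ) :
    iIndepFun (fun m ω => f (Y m ω)) P :=
  hYi.comp₀ (fun _ => f) (fun m => (hY m).aemeasurable) fun m => by rwa [(hY m).map_eq]

lemma integrable_comp_sample_iff {f : E → ℝ} (hf : AEMeasurable f μ) (m : ℕ) :
    Integrable (fun ω => f (Y m ω)) P ↔ Integrable f μ := by
  rw [← (hY m).map_eq] at hf ⊢
  exact (integrable_map_measure hf.aestronglyMeasurable (hY m).aemeasurable).symm

end Sampling

section MonteCarlo

variable {Q : ℕ} {Ω : Type*} [MeasurableSpace Ω] {P : Measure Ω} {μ : Measure (Fin Q → ℝ)}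
  {Y : ℕ → Ω → Fin Q → ℝ} (hYi : iIndepFun Y P) (hY : ∀ m, HasLaw (Y m) μ P)

include hY

lemma aemeasurable_mcMean {s : (Fin Q → ℝ) → ℝ} (hs : AEMeasurable s μ) (M : ℕ) :
    AEMeasurable (fun ω => mcMean s (fun m => Y m ω) M) P :=
  (Finset.aemeasurable_fun_sum _ fun m _ => aemeasurable_comp_sample hY hs m).const_mul _

lemma aemeasurable_mcVar {t : (Fin Q → ℝ) → ℝ} (ht : AEMeasurable t μ) (M : ℕ) :
    AEMeasurable (fun ω => mcVar t (fun m => Y m ω) M) P :=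
  (Finset.aemeasurable_fun_sum _ fun m _ => ((aemeasurable_mcMean hY ht M).sub
    (aemeasurable_comp_sample hY ht m)).pow_const 2).const_mul _

lemma aemeasurable_mcVarBound {t r : (Fin Q → ℝ) → ℝ} (ht : AEMeasurable t μ)
    (hr : AEMeasurable r μ) (M : ℕ) :
    AEMeasurable (fun ω => mcVarBound t r (fun m => Y m ω) M) P := by
  refine (Finset.aemeasurable_fun_sum _ fun m _ => ?_).const_mul _
  have hrm := aemeasurable_comp_sample hY hr m
  have htm : AEMeasurable (fun ω => |t (Y m ω)|) P :=
    (aemeasurable_comp_sample hY ht m).abs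
  exact (hrm.add (aemeasurable_mcMean hY hr M)).mul (hrm.add (htm.const_mul 2))

include hYi

lemma tendsto_mcMean {f : (Fin Q → ℝ) → ℝ} (hf : Integrable f μ) :
    ∀ᵐ ω ∂P, Tendsto (fun M => mcMean f (fun m => Y m ω) M) atTop (𝓝 (∫ y, f y ∂μ)) := by
  have hfm := hf.aemeasurable
  have hlaw := strong_law_ae_real (fun m ω => f (Y m ω))
    ((integrable_comp_sample_iff hY hfm 0).2 hf)
    (fun i j hij => (iIndepFun_comp_sample hYi hY hfm).indepFun hij)
    (identDistrib_comp_sample hY hfm)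
  simp only [mcMean_eq_sum_div]
  rwa [← (hY 0).integral_comp hf.aestronglyMeasurable]

lemma tendsto_mcMean_atTop [IsFiniteMeasure P] {f : (Fin Q → ℝ) → ℝ} (hf : AEMeasurable f μ)
    (h0 : 0 ≤ᵐ[μ] f) (hfi : ¬ Integrable f μ) :
    ∀ᵐ ω ∂P, Tendsto (fun M => mcMean f (fun m => Y m ω) M) atTop atTop := by
  simp only [mcMean_eq_sum_div]
  exact tendsto_sum_div_atTop_of_not_integrable
    ((ae_forall_sample hY h0).mono fun ω hω => hω 0)
    ((integrable_comp_sample_iff hY hf 0).not.2 hfi)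
    (fun i j hij => (iIndepFun_comp_sample hYi hY hf).indepFun hij)
    (identDistrib_comp_sample hY hf)

lemma hasLimitGE_sqrt_mul_mcMean [IsFiniteMeasure P] {f : (Fin Q → ℝ) → ℝ}
    (hf : AEMeasurable f μ) (h0 : 0 ≤ᵐ[μ] f) :
    HasLimitGE P (fun M ω => √M * mcMean f (fun m => Y m ω) M) 0 := by
  have hsqrt : Tendsto (fun M : ℕ => √(M : ℝ)) atTop atTop :=
    Real.tendsto_sqrt_atTop.comp tendsto_natCast_atTop_atTop
  by_cases hfi : Integrable f μ
  · rcases (integral_nonneg_of_ae h0).eq_or_lt with h | h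
    · have hzero : ∀ᵐ y ∂μ, f y = 0 := (integral_eq_zero_iff_of_nonneg_ae h0 hfi).1 h.symm
      refine .inl ⟨0, le_rfl, ?_⟩
      filter_upwards [ae_forall_sample hY hzero] with ω hω
      simp [mcMean, hω]
    · refine .inr ?_
      filter_upwards [tendsto_mcMean hYi hY hfi] with ω hω
      exact hsqrt.atTop_mul_pos h hω
  · refine .inr ?_
    filter_upwards [tendsto_mcMean_atTop hYi hY hf h0 hfi] with ω hω
    exact hsqrt.atTop_mul_atTop₀ hω

variable [IsProbabilityMeasure P]

lemma tendsto_mcVar {s : (Fin Q → ℝ) → ℝ} (hs : MemLp s 2 μ) :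
    ∀ᵐ ω ∂P, Tendsto (fun M => mcVar s (fun m => Y m ω) M) atTop (𝓝 Var[s; μ]) := by
  have := (hY 0).isProbabilityMeasure_iff.1 ‹_›
  filter_upwards [tendsto_mcMean hYi hY (hs.integrable one_le_two),
    tendsto_mcMean hYi hY hs.integrable_sq] with ω h₁ h₂
  rw [variance_eq_sub hs, ← one_mul (_ - _)]
  refine ((tendsto_natCast_div_add_atTop (-1 : ℝ)).mul (h₂.sub (h₁.pow 2))).congr' ?_
  filter_upwards [eventually_gt_atTop 0] with M hM
  rw [mcVar_eq _ hM, ← sub_eq_add_neg]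

lemma tendsto_mcVarBound {t r : (Fin Q → ℝ) → ℝ} (ht : MemLp t 2 μ) (hr : MemLp r 2 μ) :
    ∀ᵐ ω ∂P, Tendsto (fun M => mcVarBound t r (fun m => Y m ω) M) atTop
      (𝓝 ((∫ y, r y * (r y + 2 * |t y|) ∂μ)
        + (∫ y, r y ∂μ) * ∫ y, r y + 2 * |t y| ∂μ)) := by
  have := (hY 0).isProbabilityMeasure_iff.1 ‹_›
  have hu : MemLp (fun y => r y + 2 * |t y|) 2 μ := hr.add (ht.abs.const_mul 2)
  filter_upwards [tendsto_mcMean hYi hY (hr.integrable_mul hu),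
    tendsto_mcMean hYi hY (hr.integrable one_le_two),
    tendsto_mcMean hYi hY (hu.integrable one_le_two)] with ω h₁ h₂ h₃
  rw [← one_mul (_ + _)]
  refine ((tendsto_natCast_div_add_atTop (-1 : ℝ)).mul (h₁.add (h₂.mul h₃))).congr' ?_
  filter_upwards [eventually_gt_atTop 0] with M hM
  rw [mcVarBound_eq _ hM, ← sub_eq_add_neg]
  rfl

lemma tendstoInDistribution_sqrt_mul_mcMean_sub {s : (Fin Q → ℝ) → ℝ} (hs : MemLp s 2 μ) :
    TendstoInDistribution (fun (M : ℕ) ω => √M * (mcMean s (fun m => Y m ω) M - ∫ y, s y ∂μ))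
      atTop id (fun _ => P) (gaussianReal 0 Var[s; μ].toNNReal) := by
  have hsm := hs.aestronglyMeasurable.aemeasurable
  have hvar : Var[fun ω => s (Y 0 ω); P] = Var[s; μ] := by
    rw [← (hY 0).map_eq, variance_map (by rwa [(hY 0).map_eq]) (hY 0).aemeasurable]
    rfl
  have hmean : ∫ ω, s (Y 0 ω) ∂P = ∫ y, s y ∂μ :=
    (hY 0).integral_comp hs.aestronglyMeasurable
  have hs0 : MemLp (fun ω => s (Y 0 ω)) 2 P := by
    rw [← (hY 0).map_eq] at hs
    exact hs.comp_of_map (hY 0).aemeasurable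
  have hclt := tendstoInDistribution_inv_sqrt_mul_sum_sub (X := fun m ω => s (Y m ω))
    (P' := gaussianReal 0 Var[s; μ].toNNReal) (by rw [hvar]; exact HasLaw.id) hs0
    (iIndepFun_comp_sample hYi hY hsm) (identDistrib_comp_sample hY hsm)
  convert hclt using 3 with M ω
  rw [hmean]
  rcases M.eq_zero_or_pos with rfl | hM
  · simp
  · rw [← mul_mcMean (fun m => Y m ω) hM s, ← mul_sub, ← mul_assoc, inv_mul_eq_div,
      Real.div_sqrt]

variable {s t r : (Fin Q → ℝ) → ℝ} (hs : MemLp s 2 μ) (ht : AEMeasurable t μ)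
  (hr : AEMeasurable r μ) (hst : ∀ᵐ y ∂μ, |s y - t y| ≤ r y)

include hs ht hr hst

lemma hasLimitGE_mcVar_add_mcVarBound :
    HasLimitGE P (fun M ω => mcVar t (fun m => Y m ω) M + mcVarBound t r (fun m => Y m ω) M)
      Var[s; μ] := by
  by_cases hri : Integrable (fun y => r y ^ 2) μ
  · have hr2 : MemLp r 2 μ := (memLp_two_iff_integrable_sq hr.aestronglyMeasurable).2 hri
    have ht2 : MemLp t 2 μ := by
      have hdiff : MemLp (s - t) 2 μ :=
        hr2.mono (hs.aestronglyMeasurable.sub ht.aestronglyMeasurable)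
          (hst.mono fun y hy => hy.trans (le_abs_self _))
      simpa only [sub_sub_cancel] using hs.sub hdiff
    have hlim := (tendsto_mcVar hYi hY ht2).and (tendsto_mcVarBound hYi hY ht2 hr2)
    refine .inl ⟨_, ?_, hlim.mono fun ω hω => hω.1.add hω.2⟩
    obtain ⟨ω, h₁, h₂, h⟩ :=
      (hlim.and ((tendsto_mcVar hYi hY hs).and (ae_forall_sample hY hst))).exists
    refine le_of_tendsto_of_tendsto h₂ (h₁.1.add h₁.2) ?_
    filter_upwards [eventually_gt_atTop 1] with M hM
    exact mcVar_le_mcVar_add_mcVarBound h hM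
  · refine .inr ?_
    filter_upwards [tendsto_mcMean_atTop hYi hY (hr.pow_const 2) (ae_of_all _ fun y => sq_nonneg _)
      hri, ae_forall_sample hY hst] with ω hω h
    refine tendsto_atTop_mono' _ ?_ hω
    filter_upwards [eventually_gt_atTop 1] with M hM
    exact (mcMean_sq_le_mcVarBound (fun m => (abs_nonneg _).trans (h m)) hM).trans
      (le_add_of_nonneg_left (mcVar_nonneg _ hM _))

omit hYi ht hr in
lemma tendsto_measureReal_mcTotalBound_of_variance_eq_zero (hv : Var[s; μ] = 0) {a : ℝ}
    (ha : 0 ≤ a) :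
    Tendsto (fun M : ℕ => P.real {ω | |∫ y, s y ∂μ - mcMean t (fun m => Y m ω) M|
      ≤ mcTotalBound a t r (fun m => Y m ω) M}) atTop (𝓝 1) := by
  have := (hY 0).isProbabilityMeasure_iff.1 ‹_›
  refine tendsto_const_nhds.congr' ?_
  filter_upwards [eventually_ne_atTop 0] with M hM
  rw [← probReal_univ (μ := P)]
  refine measureReal_congr ?_
  filter_upwards [ae_forall_sample hY (ae_eq_integral_of_variance_eq_zero hs hv),
    ae_forall_sample hY hst] with ω hω h
  have hmean : mcMean s (fun m => Y m ω) M = ∫ y, s y ∂μ := by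
    simp [mcMean, hω, hM]
  refine propext ⟨fun _ => ?_, fun _ => trivial⟩
  change |∫ y, s y ∂μ - mcMean t (fun m => Y m ω) M| ≤ _
  rw [← hmean]
  exact abs_mcMean_sub_mcMean_le_mcTotalBound h ha

/-- The endpoints of the interval for the normalized error are `a √W + √M E_M[r ∓ (s - t)]`, where
`W` dominates the sample variance of `s`; both have limits that are at least `a √Var[s]`. -/
theorem exists_tendsto_measureReal_mcTotalBound {a : ℝ} (ha : 0 < a) :
    ∃ L : ℝ, Tendsto (fun M : ℕ => P.real {ω | |∫ y, s y ∂μ - mcMean t (fun m => Y m ω) M|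
        ≤ mcTotalBound a t r (fun m => Y m ω) M}) atTop (𝓝 L) ∧ erf (a / √2) ≤ L := by
  by_cases hv : Var[s; μ] = 0
  · exact ⟨1, tendsto_measureReal_mcTotalBound_of_variance_eq_zero hY hs hst hv ha.le,
      erf_div_sqrt_two_le_one ha.le⟩
  have hsm := hs.aestronglyMeasurable.aemeasurable
  have hm₁ : AEMeasurable (fun y => r y - (s y - t y)) μ := hr.sub (hsm.sub ht)
  have hm₂ : AEMeasurable (fun y => r y + (s y - t y)) μ := hr.add (hsm.sub ht)
  have hWm : ∀ M, AEMeasurable (fun ω => a * √(mcVar t (fun m => Y m ω) M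
      + mcVarBound t r (fun m => Y m ω) M)) P := fun M =>
    ((aemeasurable_mcVar hY ht M).add (aemeasurable_mcVarBound hY ht hr M)).sqrt.const_mul a
  have hW := (hasLimitGE_mcVar_add_mcVarBound hYi hY hs ht hr hst).const_mul_sqrt ha
  have hT₁ := hW.add (hasLimitGE_sqrt_mul_mcMean hYi hY hm₁ (hst.mono fun y hy =>
    sub_nonneg.2 (abs_le.1 hy).2))
  have hT₂ := hW.add (hasLimitGE_sqrt_mul_mcMean hYi hY hm₂ (hst.mono fun y hy =>
    neg_le_iff_add_nonneg'.1 (abs_le.1 hy).1))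
  rw [add_zero] at hT₁ hT₂
  set v : NNReal := Var[s; μ].toNNReal
  have hvr : (v : ℝ) = Var[s; μ] := Real.coe_toNNReal _ (variance_nonneg _ _)
  have hv0 : v ≠ 0 := fun h => hv (by rw [← hvr, h, NNReal.coe_zero])
  have := nullSingletonClass_gaussianReal (μ := 0) hv0
  obtain ⟨L, hL, hle⟩ := exists_tendsto_measureReal_between
    (tendstoInDistribution_sqrt_mul_mcMean_sub hYi hY hs) (fun t => measure_singleton t)
    (fun M => (hWm M).add ((aemeasurable_mcMean hY hm₁ M).const_mul _))
    (fun M => (hWm M).add ((aemeasurable_mcMean hY hm₂ M).const_mul _)) hT₁ hT₂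
  refine ⟨L, hL.congr' ?_, ?_⟩
  · filter_upwards [eventually_gt_atTop 0] with M hM
    simp only [abs_sub_mcMean_le_mcTotalBound_iff hM s]
    rfl
  · rwa [← gaussianReal_real_Icc_eq_erf hv0 ha.le, hvr]

end MonteCarlo

/-! ## Sesquilinear forms on finite-dimensional spaces -/

/-- The Hermitian part of a sesquilinear form with positive definite real part, as an inner product.
It makes the results on inner product spaces available without knowing that the form itself is
Hermitian. -/
noncomputable abbrev hermitianCore {V : Type*} [AddCommGroup V] [Module ℂ V]
    (B : V →ₗ[ℂ] V →ₗ⋆[ℂ] ℂ) (hB : ∀ w, w ≠ 0 → 0 < (B w w).re) : InnerProductSpace.Core ℂ V where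
  inner x y := (B y x + conj (B x y)) / 2
  conj_inner_symm x y := by
    simp only [map_div₀, map_add, Complex.conj_conj, map_ofNat, add_comm]
  re_inner_nonneg x := by
    rcases eq_or_ne x 0 with rfl | hx
    · simp
    · simpa [Complex.add_conj] using (hB x hx).le
  add_left x y z := by
    simp only [map_add, LinearMap.add_apply]
    ring
  smul_left x y r := by
    simp only [LinearMap.map_smulₛₗ, LinearMap.smul_apply, smul_eq_mul, map_mul, RingHom.id_apply]
    ring
  definite x hx := by
    contrapose! hx
    have hpos := hB x hx
    rw [Complex.add_conj]
    simpa [Complex.ext_iff] using hpos.ne'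

lemma exists_norm_le_mul_sqrt {V : Type*} [AddCommGroup V] [Module ℂ V] [FiniteDimensional ℂ V]
    (B : V →ₗ[ℂ] V →ₗ⋆[ℂ] ℂ) (hB : ∀ w, w ≠ 0 → 0 < (B w w).re) (l : V →ₗ[ℂ] ℂ) :
    ∃ C, ∀ w, ‖l w‖ ≤ C * √(B w w).re := by
  let c := hermitianCore B hB
  let _ : NormedAddCommGroup V := c.toNormedAddCommGroup
  let _ : InnerProductSpace ℂ V := InnerProductSpace.ofCore c.toCore
  have norm_eq (w : V) : ‖w‖ = √(B w w).re := by
    rw [norm_eq_sqrt_re_inner (𝕜 := ℂ) w]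
    change √((B w w + conj (B w w)) / 2).re = _
    simp [Complex.add_conj]
  exact ⟨‖l.toContinuousLinearMap‖, fun w => norm_eq w ▸ l.toContinuousLinearMap.le_opNorm w⟩

section Cramer

variable {ι V : Type*} [Fintype ι] [AddCommGroup V] [Module ℂ V]

/-- The matrix of a sesquilinear form in a basis, indexed so that it acts on the coordinates of the
first argument. -/
noncomputable def sesqMatrix (e : Module.Basis ι ℂ V) (A : V →ₗ[ℂ] V →ₗ⋆[ℂ] ℂ) : Matrix ι ι ℂ :=
  Matrix.of fun j i => A (e i) (e j)

variable (e : Module.Basis ι ℂ V) {A : V →ₗ[ℂ] V →ₗ⋆[ℂ] ℂ}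

lemma sesqMatrix_mulVec (c : ι → ℂ) :
    sesqMatrix e A *ᵥ c = fun j => A (∑ i, c i • e i) (e j) := by
  funext j
  simp only [Matrix.mulVec, dotProduct, sesqMatrix, Matrix.of_apply, map_sum, map_smul,
    LinearMap.sum_apply, LinearMap.smul_apply, smul_eq_mul, mul_comm]

variable [DecidableEq ι]

lemma det_sesqMatrix_ne_zero (hA : ∀ w, (∀ v, A w v = 0) → w = 0) :
    (sesqMatrix e A).det ≠ 0 := by
  intro hdet
  obtain ⟨c, hc, h⟩ := Matrix.exists_mulVec_eq_zero_iff.2 hdet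
  rw [sesqMatrix_mulVec] at h
  have hw : A (∑ i, c i • e i) = 0 := e.ext fun j => congrFun h j
  exact hc (funext (Fintype.linearIndependent_iff.1 e.linearIndependent c
    (hA _ fun v => by rw [hw, LinearMap.zero_apply])))

lemma repr_eq_det_inv_smul_adjugate_mulVec (hA : ∀ w, (∀ v, A w v = 0) → w = 0) {u : V}
    {b : V → ℂ} (hu : ∀ w, A u w = b w) :
    ⇑(e.repr u) = (sesqMatrix e A).det⁻¹ • ((sesqMatrix e A).adjugate *ᵥ fun j => b (e j)) := by
  have hsys : sesqMatrix e A *ᵥ e.repr u = fun j => b (e j) := by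
    rw [sesqMatrix_mulVec, e.sum_repr]
    exact funext fun j => hu _
  rw [← hsys, Matrix.mulVec_mulVec, Matrix.adjugate_mul, Matrix.smul_mulVec, Matrix.one_mulVec,
    smul_smul, inv_mul_cancel₀ (det_sesqMatrix_ne_zero e hA), one_smul]

end Cramer

lemma continuousOn_solution {V X : Type*} [AddCommGroup V] [Module ℂ V] [FiniteDimensional ℂ V]
    [TopologicalSpace X] {A : X → V →ₗ[ℂ] V →ₗ⋆[ℂ] ℂ} (hA : ∀ v w, Continuous fun y => A y v w)
    {K : Set X} (hK : ∀ y ∈ K, ∀ w, (∀ v, A y w v = 0) → w = 0) {u : X → V} {b : V → ℂ}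
    (hu : ∀ y ∈ K, ∀ w, A y (u y) w = b w) (l : V →ₗ[ℂ] ℂ) :
    ContinuousOn (fun y => l (u y)) K := by
  let e := Module.finBasis ℂ V
  have hM : Continuous fun y => sesqMatrix e (A y) := continuous_matrix fun i j => hA _ _
  have hrepr (i) : ContinuousOn (fun y => e.repr (u y) i) K := by
    have hdet : ContinuousOn (fun y => (sesqMatrix e (A y)).det⁻¹) K :=
      hM.matrix_det.continuousOn.inv₀ fun y hy => det_sesqMatrix_ne_zero e (hK y hy)
    have hadj : Continuous fun y => (sesqMatrix e (A y)).adjugate *ᵥ fun j => b (e j) :=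
      hM.matrix_adjugate.matrix_mulVec continuous_const
    refine (hdet.mul ((continuous_apply i).comp hadj).continuousOn).congr fun y hy => ?_
    exact congrFun (repr_eq_det_inv_smul_adjugate_mulVec e (hK y hy) (hu y hy)) i
  have hl (y) : l (u y) = ∑ i, e.repr (u y) i * l (e i) := by
    conv_lhs => rw [← e.sum_repr (u y)]
    simp only [map_sum, map_smul, smul_eq_mul]
  simp only [hl]
  exact continuousOn_finsetSum _ fun i _ => (hrepr i).mul continuousOn_const

section AffineSesq

variable {Q : ℕ} {V₁ V₂ : Type*} [AddCommGroup V₁] [Module ℂ V₁] [AddCommGroup V₂] [Module ℂ V₂]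

/-- `B y` is a sesquilinear form for each `y` and depends affinely on `y ∈ ℝ^Q`. The case `Q = 0` is
that of a single sesquilinear form. -/
def IsAffineSesq (B : (Fin Q → ℝ) → V₁ → V₂ → ℂ) : Prop :=
  ∃ (A₀ : V₁ →ₗ[ℂ] V₂ →ₗ⋆[ℂ] ℂ) (A : Fin Q → V₁ →ₗ[ℂ] V₂ →ₗ⋆[ℂ] ℂ),
    ∀ y v w, B y v w = A₀ v w + ∑ q, (y q : ℂ) * A q v w

namespace IsAffineSesq

variable {B B' : (Fin Q → ℝ) → V₁ → V₂ → ℂ}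

lemma add (h : IsAffineSesq B) (h' : IsAffineSesq B') :
    IsAffineSesq fun y v w => B y v w + B' y v w := by
  obtain ⟨A₀, A, hA⟩ := h
  obtain ⟨A₀', A', hA'⟩ := h'
  refine ⟨A₀ + A₀', fun q => A q + A' q, fun y v w => ?_⟩
  simp only [hA, hA', LinearMap.add_apply, mul_add, Finset.sum_add_distrib]
  ring

lemma neg (h : IsAffineSesq B) : IsAffineSesq fun y v w => -B y v w := by
  obtain ⟨A₀, A, hA⟩ := h
  refine ⟨-A₀, fun q => -A q, fun y v w => ?_⟩
  simp only [hA, LinearMap.neg_apply, mul_neg, Finset.sum_neg_distrib]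
  ring

lemma sub (h : IsAffineSesq B) (h' : IsAffineSesq B') :
    IsAffineSesq fun y v w => B y v w - B' y v w := by
  simpa only [sub_eq_add_neg] using h.add h'.neg

lemma sum {ι : Type*} (s : Finset ι) {B : ι → (Fin Q → ℝ) → V₁ → V₂ → ℂ}
    (h : ∀ i ∈ s, IsAffineSesq (B i)) : IsAffineSesq fun y v w => ∑ i ∈ s, B i y v w := by
  classical
  induction s using Finset.induction_on with
  | empty => exact ⟨0, 0, fun y v w => by simp⟩
  | insert i s hi ih =>
    simp only [Finset.sum_insert hi]
    exact (h i (Finset.mem_insert_self i s)).add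
      (ih fun j hj => h j (Finset.mem_insert_of_mem hj))

lemma exists_continuous_sesqForm (h : IsAffineSesq B) :
    ∃ A : (Fin Q → ℝ) → V₁ →ₗ[ℂ] V₂ →ₗ⋆[ℂ] ℂ,
      (∀ y v w, A y v w = B y v w) ∧ ∀ v w, Continuous fun y => A y v w := by
  obtain ⟨A₀, A, hA⟩ := h
  refine ⟨fun y => A₀ + ∑ q, (y q : ℂ) • A q, fun y v w => ?_, fun v w => ?_⟩
  · simp [hA, LinearMap.sum_apply]
  · simp only [LinearMap.add_apply, LinearMap.sum_apply, LinearMap.smul_apply]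
    fun_prop

lemma exists_sesqForm (h : IsAffineSesq B) (y : Fin Q → ℝ) :
    ∃ A : V₁ →ₗ[ℂ] V₂ →ₗ⋆[ℂ] ℂ, ∀ v w, A v w = B y v w := by
  obtain ⟨A, hA, -⟩ := h.exists_continuous_sesqForm
  exact ⟨A y, hA y⟩

end IsAffineSesq

variable {X : Type*} [TopologicalSpace X] [T2Space X] [MeasurableSpace X]
  [OpensMeasurableSpace X] {ν : Measure X} {S : Set X}

lemma integrableOn_mul_mul_conj (hS : IsCompact S) {c P R : X → ℂ} (hc : IntegrableOn c S ν)
    (hP : ContinuousOn P S) (hR : ContinuousOn R S) :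
    IntegrableOn (fun x => c x * P x * conj (R x)) S ν := by
  have h : ContinuousOn (fun x => P x * conj (R x)) S :=
    hP.mul (Complex.continuous_conj.comp_continuousOn hR)
  simpa only [mul_assoc] using hc.mul_continuousOn h hS

lemma exists_sesqForm_integral (hS : IsCompact S) {c : X → ℂ} (hc : IntegrableOn c S ν)
    {P : V₁ →ₗ[ℂ] X → ℂ} {R : V₂ →ₗ[ℂ] X → ℂ} (hP : ∀ v, ContinuousOn (P v) S)
    (hR : ∀ w, ContinuousOn (R w) S) :
    ∃ A : V₁ →ₗ[ℂ] V₂ →ₗ⋆[ℂ] ℂ,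
      ∀ v w, A v w = ∫ x in S, c x * P v x * conj (R w x) ∂ν := by
  have hi v w := integrableOn_mul_mul_conj hS hc (hP v) (hR w)
  refine ⟨LinearMap.mk₂'ₛₗ (RingHom.id ℂ) (starRingEnd ℂ)
    (fun v w => ∫ x in S, c x * P v x * conj (R w x) ∂ν) ?_ ?_ ?_ ?_, fun v w => rfl⟩
  · intro v v' w
    rw [← integral_add (hi v w) (hi v' w)]
    simp only [map_add, Pi.add_apply, mul_add, add_mul]
  · intro a v w
    rw [smul_eq_mul, ← integral_const_mul]
    simp only [map_smul, Pi.smul_apply, smul_eq_mul, RingHom.id_apply, mul_assoc, mul_left_comm]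
  · intro v w w'
    rw [← integral_add (hi v w) (hi v w')]
    simp only [map_add, Pi.add_apply, mul_add]
  · intro a v w
    rw [smul_eq_mul, ← integral_const_mul]
    simp only [map_smul, Pi.smul_apply, smul_eq_mul, map_mul, mul_left_comm]

lemma isAffineSesq_integral (hS : IsCompact S) {c₀ : X → ℂ} {c : Fin Q → X → ℂ}
    (hc₀ : IntegrableOn c₀ S ν) (hc : ∀ q, IntegrableOn (c q) S ν) {P : V₁ →ₗ[ℂ] X → ℂ}
    {R : V₂ →ₗ[ℂ] X → ℂ} (hP : ∀ v, ContinuousOn (P v) S) (hR : ∀ w, ContinuousOn (R w) S) :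
    IsAffineSesq fun (y : Fin Q → ℝ) v w =>
      ∫ x in S, (c₀ x + ∑ q, c q x * y q) * P v x * conj (R w x) ∂ν := by
  obtain ⟨A₀, hA₀⟩ := exists_sesqForm_integral hS hc₀ hP hR
  choose A hA using fun q => exists_sesqForm_integral hS (hc q) hP hR
  refine ⟨A₀, A, fun y v w => ?_⟩
  have hi₀ := integrableOn_mul_mul_conj hS hc₀ (hP v) (hR w)
  have hi q := (integrableOn_mul_mul_conj hS (hc q) (hP v) (hR w)).const_mul (y q : ℂ)
  simp only [hA₀, hA, ← integral_const_mul]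
  rw [← integral_finsetSum _ fun q _ => hi q,
    ← integral_add hi₀ (integrable_finsetSum _ fun q _ => hi q)]
  refine integral_congr_ae (.of_forall fun x => ?_)
  simp only [add_mul, Finset.sum_mul]
  congr! 2 with q
  ring

lemma isAffineSesq_integral_sum {ι : Type*} [Fintype ι] (hS : IsCompact S) {c₀ : X → ℂ}
    {c : Fin Q → X → ℂ} (hc₀ : IntegrableOn c₀ S ν) (hc : ∀ q, IntegrableOn (c q) S ν)
    {P : ι → V₁ →ₗ[ℂ] X → ℂ} {R : ι → V₂ →ₗ[ℂ] X → ℂ} (hP : ∀ i v, ContinuousOn (P i v) S)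
    (hR : ∀ i w, ContinuousOn (R i w) S) :
    IsAffineSesq fun (y : Fin Q → ℝ) v w =>
      ∫ x in S, ∑ i, (c₀ x + ∑ q, c q x * y q) * P i v x * conj (R i w x) ∂ν := by
  convert IsAffineSesq.sum Finset.univ fun i _ =>
    isAffineSesq_integral hS hc₀ hc (hP i) (hR i) using 1
  funext y v w
  exact integral_finsetSum _ fun i _ => integrableOn_mul_mul_conj hS
    (hc₀.add (integrable_finsetSum _ fun q _ => (hc q).mul_const _)) (hP i v) (hR i w)

end AffineSesq

/-! ## Integrability on elements and faces -/

lemma euclideanHausdorffMeasure_finrank_vectorSpan_lt_top {E : Type*} [NormedAddCommGroup E]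
    [InnerProductSpace ℝ E] [FiniteDimensional ℝ E] [MeasurableSpace E] [BorelSpace E] {K : Set E}
    (hK : IsCompact K) : μHE[Module.finrank ℝ (vectorSpan ℝ K)] K < ⊤ := by
  obtain rfl | ⟨x₀, hx₀⟩ := K.eq_empty_or_nonempty
  · simp
  let ι : vectorSpan ℝ K → E := fun w => w + x₀
  have isometry_ι : Isometry ι := (IsometryEquiv.addRight x₀).isometry.comp isometry_subtype_coe
  have subset_image : K ⊆ ι '' (ι ⁻¹' K) := fun x hx =>
    ⟨⟨x - x₀, vsub_mem_vectorSpan ℝ hx hx₀⟩, by simpa [ι] using hx, by simp [ι]⟩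
  refine (measure_mono subset_image).trans_lt ?_
  rw [isometry_ι.euclideanHausdorffMeasure_image]
  exact (isometry_ι.isClosedEmbedding.isCompact_preimage hK).measure_lt_top

lemma euclideanHausdorffMeasure_convexHull_lt_top {E : Type*} [NormedAddCommGroup E]
    [InnerProductSpace ℝ E] [FiniteDimensional ℝ E] [MeasurableSpace E] [BorelSpace E]
    {S : Finset E} (hS : AffineIndependent ℝ ((↑) : S → E)) {n : ℕ} (hn : S.card = n + 1) :
    μHE[n] (convexHull ℝ (S : Set E)) < ⊤ := by
  have hspan :
      vectorSpan ℝ (convexHull ℝ (S : Set E)) = vectorSpan ℝ (Set.range ((↑) : S → E)) := by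
    rw [← direction_affineSpan, affineSpan_convexHull, direction_affineSpan, Subtype.range_coe]
  have hfinrank : Module.finrank ℝ (vectorSpan ℝ (convexHull ℝ (S : Set E))) = n := by
    rw [hspan]
    exact hS.finrank_vectorSpan (by rw [Fintype.card_coe, hn])
  exact hfinrank ▸
    euclideanHausdorffMeasure_finrank_vectorSpan_lt_top (S.finite_toSet.isCompact_convexHull ℝ)

lemma integrableOn_ofReal_of_bounded {X : Type*} [MeasurableSpace X] {ν : Measure X} {S : Set X}
    (hS : MeasurableSet S) (hν : ν S < ⊤) {c : X → ℝ} (hc : Measurable c) {C : ℝ}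
    (hC : ∀ x ∈ S, |c x| ≤ C) : IntegrableOn (fun x => (c x : ℂ)) S ν :=
  (IntegrableOn.of_bound hν hc.aestronglyMeasurable C
    ((ae_restrict_iff' hS).2 (ae_of_all _ hC))).ofReal

variable {d p : ℕ} {𝒯 : Mesh d}

lemma Mesh.Face.isCompact_hull (F : 𝒯.Face) : IsCompact F.hull :=
  F.1.finite_toSet.isCompact_convexHull ℝ

lemma Mesh.Face.measure_hull_lt_top (hd : 0 < d) (F : 𝒯.Face) : μHE[d - 1] F.hull < ⊤ :=
  euclideanHausdorffMeasure_convexHull_lt_top (𝒯.complex.indep F.2.1) (by rw [F.2.2]; omega)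

lemma Mesh.Face.integrableOn (hd : 0 < d) (F : 𝒯.Face) {g : EuclideanSpace ℝ (Fin d) → ℂ}
    (hg : ContinuousOn g F.hull) : IntegrableOn g F.hull μHE[d - 1] := by
  simpa using (integrableOn_const (C := (1 : ℂ))
    (F.measure_hull_lt_top hd).ne).mul_continuousOn hg F.isCompact_hull

lemma Mesh.Elem.hull_subset_of_mem_faces {T : 𝒯.Elem} {F : 𝒯.Face} (hF : F ∈ T.faces) :
    F.hull ⊆ T.hull :=
  convexHull_mono (by exact_mod_cast (Finset.mem_filter.1 hF).2)

lemma integrableOn_ofReal_elem {c : EuclideanSpace ℝ (Fin d) → ℝ} (hc : Measurable c) {C : ℝ}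
    {T : 𝒯.Elem} (hC : ∀ x ∈ T.hull, |c x| ≤ C) : IntegrableOn (fun x => (c x : ℂ)) T.hull :=
  integrableOn_ofReal_of_bounded (hull_compact T).measurableSet (hull_compact T).measure_lt_top hc
    hC

lemma integrableOn_ofReal_face (hd : 0 < d) {c : EuclideanSpace ℝ (Fin d) → ℝ} (hc : Measurable c)
    {C : ℝ} {T : 𝒯.Elem} (hC : ∀ x ∈ T.hull, |c x| ≤ C) {F : 𝒯.Face} (hF : F ∈ T.faces) :
    IntegrableOn (fun x => (c x : ℂ)) F.hull μHE[d - 1] :=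
  integrableOn_ofReal_of_bounded F.isCompact_hull.measurableSet (F.measure_hull_lt_top hd) hc
    fun x hx => hC x (Mesh.Elem.hull_subset_of_mem_faces hF hx)

/-! ## Sesquilinearity of the HDG forms -/

instance : FiniteDimensional ℂ (Space 𝒯 p) := by
  have (F : 𝒯.Face) : FiniteDimensional ℂ (FacePoly p F) := by
    unfold FacePoly
    infer_instance
  infer_instance

/-- `w ↦ w|_T`, as a linear map. -/
noncomputable def wVal (T : 𝒯.Elem) : WSpace 𝒯 p →ₗ[ℂ] EuclideanSpace ℝ (Fin d) → ℂ where
  toFun w := WSpace.val w T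
  map_add' v w := by funext x; simp [WSpace.val]
  map_smul' c w := by funext x; simp [WSpace.val]

/-- `w ↦ ∂ᵢ w|_T`, as a linear map. -/
noncomputable def wGrad (T : 𝒯.Elem) (i : Fin d) :
    WSpace 𝒯 p →ₗ[ℂ] EuclideanSpace ℝ (Fin d) → ℂ where
  toFun w x := WSpace.grad w T x i
  map_add' v w := by funext x; simp [WSpace.grad]
  map_smul' c w := by funext x; simp [WSpace.grad]

/-- `μ ↦ μ|_F`, as a linear map. -/
noncomputable def mVal (F : 𝒯.Face) : MSpace 𝒯 p →ₗ[ℂ] EuclideanSpace ℝ (Fin d) → ℂ where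
  toFun μ := MSpace.val μ F
  map_add' v w := by funext x; simp [MSpace.val]
  map_smul' c w := by funext x; simp [MSpace.val]

/-- `r ↦ rᵢ|_T`, as a linear map. -/
noncomputable def vVal (T : 𝒯.Elem) (i : Fin d) :
    VSpace 𝒯 p →ₗ[ℂ] EuclideanSpace ℝ (Fin d) → ℂ where
  toFun r x := VSpace.val r T x i
  map_add' v w := by funext x; simp [VSpace.val]
  map_smul' c w := by funext x; simp [VSpace.val]

/-- `r ↦ ∇·r|_T`, as a linear map. -/
noncomputable def vDiv (T : 𝒯.Elem) : VSpace 𝒯 p →ₗ[ℂ] EuclideanSpace ℝ (Fin d) → ℂ where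
  toFun r := VSpace.div r T
  map_add' v w := by funext x; simp [VSpace.div, Finset.sum_add_distrib]
  map_smul' c w := by funext x; simp [VSpace.div, Finset.mul_sum]

/-- `r ↦ r·n` on the face `F` of `T`, as a linear map. -/
noncomputable def vFlux (T : 𝒯.Elem) (F : 𝒯.Face) :
    VSpace 𝒯 p →ₗ[ℂ] EuclideanSpace ℝ (Fin d) → ℂ where
  toFun r := VSpace.flux r T F
  map_add' v w := by
    funext x; simp [VSpace.flux, VSpace.val, Finset.sum_add_distrib, add_mul]
  map_smul' c w := by
    funext x; simp [VSpace.flux, VSpace.val, Finset.mul_sum, mul_assoc]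

lemma continuous_wVal (T : 𝒯.Elem) (w : WSpace 𝒯 p) : Continuous (wVal T w) :=
  evalAt_continuous _

lemma continuous_wGrad (T : 𝒯.Elem) (i : Fin d) (w : WSpace 𝒯 p) : Continuous (wGrad T i w) :=
  evalAt_continuous _

lemma continuous_vVal (T : 𝒯.Elem) (i : Fin d) (r : VSpace 𝒯 p) : Continuous (vVal T i r) :=
  evalAt_continuous _

lemma continuous_vDiv (T : 𝒯.Elem) (r : VSpace 𝒯 p) : Continuous (vDiv T r) :=
  show Continuous fun x => VSpace.div r T x from
    continuous_finsetSum _ fun _ _ => evalAt_continuous _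

lemma continuous_vFlux (T : 𝒯.Elem) (F : 𝒯.Face) (r : VSpace 𝒯 p) : Continuous (vFlux T F r) :=
  show Continuous fun x => VSpace.flux r T F x from
    continuous_finsetSum _ fun i _ => (val_cont r T i).mul continuous_const

lemma continuousOn_mVal (F : 𝒯.Face) (μ : MSpace 𝒯 p) : ContinuousOn (mVal F μ) F.hull := by
  obtain ⟨q, -, hq⟩ := (μ F).2
  refine (evalAt_continuous q).continuousOn.congr fun x hx => ?_
  change (μ F : EuclideanSpace ℝ (Fin d) → ℂ) x = _
  rw [← hq]
  exact Set.indicator_of_mem hx fun x => evalAt x q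

section

variable {Q : ℕ} {V₁ V₂ : Type*} [AddCommGroup V₁] [Module ℂ V₁] [AddCommGroup V₂] [Module ℂ V₂]

lemma isAffineSesq_intElems {c₀ : 𝒯.Elem → EuclideanSpace ℝ (Fin d) → ℂ}
    {c : Fin Q → 𝒯.Elem → EuclideanSpace ℝ (Fin d) → ℂ}
    (hc₀ : ∀ T, IntegrableOn (c₀ T) T.hull) (hc : ∀ q T, IntegrableOn (c q T) T.hull)
    {P : 𝒯.Elem → V₁ →ₗ[ℂ] EuclideanSpace ℝ (Fin d) → ℂ}
    {R : 𝒯.Elem → V₂ →ₗ[ℂ] EuclideanSpace ℝ (Fin d) → ℂ}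
    (hP : ∀ T v, ContinuousOn (P T v) T.hull) (hR : ∀ T w, ContinuousOn (R T w) T.hull) :
    IsAffineSesq fun (y : Fin Q → ℝ) v w => intElems fun T x =>
      (c₀ T x + ∑ q, c q T x * y q) * P T v x * conj (R T w x) :=
  .sum _ fun T _ =>
    isAffineSesq_integral (hull_compact T) (hc₀ T) (fun q => hc q T) (hP T) (hR T)

lemma isAffineSesq_intElems_sum {ι : Type*} [Fintype ι]
    {c₀ : 𝒯.Elem → EuclideanSpace ℝ (Fin d) → ℂ}
    {c : Fin Q → 𝒯.Elem → EuclideanSpace ℝ (Fin d) → ℂ}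
    (hc₀ : ∀ T, IntegrableOn (c₀ T) T.hull) (hc : ∀ q T, IntegrableOn (c q T) T.hull)
    {P : 𝒯.Elem → ι → V₁ →ₗ[ℂ] EuclideanSpace ℝ (Fin d) → ℂ}
    {R : 𝒯.Elem → ι → V₂ →ₗ[ℂ] EuclideanSpace ℝ (Fin d) → ℂ}
    (hP : ∀ T i v, ContinuousOn (P T i v) T.hull) (hR : ∀ T i w, ContinuousOn (R T i w) T.hull) :
    IsAffineSesq fun (y : Fin Q → ℝ) v w => intElems fun T x =>
      ∑ i, (c₀ T x + ∑ q, c q T x * y q) * P T i v x * conj (R T i w x) :=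
  .sum _ fun T _ =>
    isAffineSesq_integral_sum (hull_compact T) (hc₀ T) (fun q => hc q T) (hP T) (hR T)

lemma isAffineSesq_intSkeleton {c₀ : 𝒯.Elem → EuclideanSpace ℝ (Fin d) → ℂ}
    {c : Fin Q → 𝒯.Elem → EuclideanSpace ℝ (Fin d) → ℂ}
    (hc₀ : ∀ T, ∀ F ∈ T.faces, IntegrableOn (c₀ T) F.hull μHE[d - 1])
    (hc : ∀ q T, ∀ F ∈ T.faces, IntegrableOn (c q T) F.hull μHE[d - 1])
    {P : 𝒯.Elem → 𝒯.Face → V₁ →ₗ[ℂ] EuclideanSpace ℝ (Fin d) → ℂ}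
    {R : 𝒯.Elem → 𝒯.Face → V₂ →ₗ[ℂ] EuclideanSpace ℝ (Fin d) → ℂ}
    (hP : ∀ T F v, ContinuousOn (P T F v) F.hull) (hR : ∀ T F w, ContinuousOn (R T F w) F.hull) :
    IsAffineSesq fun (y : Fin Q → ℝ) v w => intSkeleton fun T F x =>
      (c₀ T x + ∑ q, c q T x * y q) * P T F v x * conj (R T F w x) :=
  .sum _ fun T _ => .sum _ fun F hF =>
    isAffineSesq_integral F.isCompact_hull (hc₀ T F hF) (fun q => hc q T F hF) (hP T F) (hR T F)

lemma isAffineSesq_intBoundary {c₀ : EuclideanSpace ℝ (Fin d) → ℂ}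
    (hc₀ : ∀ F ∈ 𝒯.boundaryFaces, IntegrableOn c₀ F.hull μHE[d - 1])
    {P : 𝒯.Face → V₁ →ₗ[ℂ] EuclideanSpace ℝ (Fin d) → ℂ}
    {R : 𝒯.Face → V₂ →ₗ[ℂ] EuclideanSpace ℝ (Fin d) → ℂ}
    (hP : ∀ F v, ContinuousOn (P F v) F.hull) (hR : ∀ F w, ContinuousOn (R F w) F.hull) :
    IsAffineSesq fun (_ : Fin Q → ℝ) v w => intBoundary (𝒯 := 𝒯) fun F x =>
      c₀ x * P F v x * conj (R F w x) :=
  .sum _ fun F hF => by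
    simpa using isAffineSesq_integral (Q := Q) F.isCompact_hull (hc₀ F hF) (c := 0)
      (fun _ => integrableOn_zero) (hP F) (hR F)

end

section Riesz

variable {Q : ℕ} {V : Type*} [AddCommGroup V] [Module ℂ V]
  {B : (Fin Q → ℝ) → V → VSpace 𝒯 p → ℂ}

lemma IsAffineSesq.existsUnique_riesz (h : IsAffineSesq B) (y : Fin Q → ℝ) (v : V) :
    ∃! q : VSpace 𝒯 p, ∀ r, gram q r = B y v r := by
  obtain ⟨A, hA⟩ := h.exists_sesqForm y
  simp only [← hA]
  exact HDG.existsUnique_riesz (A v) (map_add (A v)) fun c r => by simp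

lemma IsAffineSesq.gram_riesz (h : IsAffineSesq B) (y : Fin Q → ℝ) (v : V) (r : VSpace 𝒯 p) :
    gram (riesz (B y v)) r = B y v r :=
  Classical.epsilon_spec (h.existsUnique_riesz y v).exists r

lemma IsAffineSesq.exists_linearMap_riesz (h : IsAffineSesq B) (y : Fin Q → ℝ) :
    ∃ L : V →ₗ[ℂ] VSpace 𝒯 p, ∀ v, L v = riesz (B y v) := by
  obtain ⟨A, hA⟩ := h.exists_sesqForm y
  have eq_riesz {v q} (hq : ∀ r, gram q r = B y v r) : riesz (B y v) = q :=
    (h.existsUnique_riesz y v).unique (h.gram_riesz y v) hq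
  refine ⟨{
    toFun v := riesz (B y v)
    map_add' v w := eq_riesz fun r => ?_
    map_smul' c v := eq_riesz fun r => ?_ }, fun v => rfl⟩
  · simp only [gram_add_left, h.gram_riesz, ← hA, map_add, LinearMap.add_apply]
  · simp only [RingHom.id_apply, gram_smul_left, h.gram_riesz, ← hA, map_smul,
      LinearMap.smul_apply, smul_eq_mul]

end Riesz

lemma isAffineSesq_liftW : IsAffineSesq fun (_ : Fin 0 → ℝ) (w : WSpace 𝒯 p) (r : VSpace 𝒯 p) =>
    -intElems fun T x => WSpace.val w T x * conj (VSpace.div r T x) := by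
  simpa using! (isAffineSesq_intElems (Q := 0) (c₀ := fun _ _ => 1) (c := 0)
    (fun T => intOn T continuous_const) (fun _ _ => integrableOn_zero)
    (P := wVal (𝒯 := 𝒯) (p := p)) (R := vDiv (p := p))
    (fun T v => (continuous_wVal T v).continuousOn)
    (fun T w => (continuous_vDiv T w).continuousOn)).neg

lemma isAffineSesq_liftM (hd : 0 < d) :
    IsAffineSesq fun (_ : Fin 0 → ℝ) (μ : MSpace 𝒯 p) (r : VSpace 𝒯 p) =>
      intSkeleton fun T F x => MSpace.val μ F x * conj (VSpace.flux r T F x) := by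
  simpa using! isAffineSesq_intSkeleton (Q := 0) (c₀ := fun _ _ => 1) (c := 0)
    (fun T F _ => F.integrableOn hd continuousOn_const) (fun _ _ _ _ => integrableOn_zero)
    (P := fun _ => mVal (𝒯 := 𝒯) (p := p)) (R := vFlux (p := p))
    (fun _ F μ => continuousOn_mVal F μ) (fun T F w => (continuous_vFlux T F w).continuousOn)

lemma gram_liftW (w : WSpace 𝒯 p) (r : VSpace 𝒯 p) : gram (liftW w) r
    = -intElems fun T x => WSpace.val w T x * conj (VSpace.div r T x) :=
  isAffineSesq_liftW.gram_riesz 0 w r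

lemma gram_liftM (hd : 0 < d) (μ : MSpace 𝒯 p) (r : VSpace 𝒯 p) : gram (liftM μ) r
    = intSkeleton fun T F x => MSpace.val μ F x * conj (VSpace.flux r T F x) :=
  (isAffineSesq_liftM hd).gram_riesz 0 μ r

lemma exists_linearMap_liftW_add_liftM (hd : 0 < d) :
    ∃ L : Space 𝒯 p →ₗ[ℂ] VSpace 𝒯 p, ∀ v, L v = liftW v.1 + liftM v.2 := by
  obtain ⟨LW, hLW⟩ := (isAffineSesq_liftW (𝒯 := 𝒯) (p := p)).exists_linearMap_riesz 0
  obtain ⟨LM, hLM⟩ := (isAffineSesq_liftM (𝒯 := 𝒯) (p := p) hd).exists_linearMap_riesz 0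
  exact ⟨LW ∘ₗ LinearMap.fst ℂ _ _ + LM ∘ₗ LinearMap.snd ℂ _ _, fun v => by simp [hLW, hLM]; rfl⟩

/-- The numerical flux `L(v, η)·n - τ (v - η)` on the face `F` of `T`, as a linear map in `(v, η)`;
in the HDG forms `L(v, η) = l(v) + m(η)`. -/
noncomputable def numFlux (L : Space 𝒯 p →ₗ[ℂ] VSpace 𝒯 p) (τ : ℝ) (T : 𝒯.Elem) (F : 𝒯.Face) :
    Space 𝒯 p →ₗ[ℂ] EuclideanSpace ℝ (Fin d) → ℂ :=
  vFlux T F ∘ₗ L - (τ : ℂ) • (wVal T ∘ₗ LinearMap.fst ℂ _ _ - mVal F ∘ₗ LinearMap.snd ℂ _ _)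

lemma continuousOn_numFlux (L : Space 𝒯 p →ₗ[ℂ] VSpace 𝒯 p) (τ : ℝ) (T : 𝒯.Elem) (F : 𝒯.Face)
    (v : Space 𝒯 p) : ContinuousOn (numFlux L τ T F v) F.hull :=
  (continuous_vFlux T F (L v)).continuousOn.sub (((continuous_wVal T v.1).continuousOn.sub
    (continuousOn_mVal F v.2)).const_smul (τ : ℂ))

lemma isAffineSesq_aForm {Q : ℕ} (hd : 0 < d) (τ : ℝ)
    {κ₀ : 𝒯.Elem → EuclideanSpace ℝ (Fin d) → ℝ}
    {ψ : Fin Q → 𝒯.Elem → EuclideanSpace ℝ (Fin d) → ℝ} {ϱ ν : EuclideanSpace ℝ (Fin d) → ℂ}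
    (hκ₀ : ∀ T, Measurable (κ₀ T)) (hψ : ∀ q T, Measurable (ψ q T))
    (bκ₀ : ∃ C, ∀ T, ∀ x ∈ T.hull, |κ₀ T x| ≤ C) (bψ : ∃ C, ∀ q T, ∀ x ∈ T.hull, |ψ q T x| ≤ C)
    (hϱ : ∀ T : 𝒯.Elem, IntegrableOn ϱ T.hull)
    (hν : ∀ F ∈ 𝒯.boundaryFaces, IntegrableOn ν F.hull μHE[d - 1]) :
    IsAffineSesq fun (y : Fin Q → ℝ) (v w : Space 𝒯 p) =>
      aForm τ (fun T x => κ₀ T x + ∑ q, ψ q T x * y q) ϱ ν v w := by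
  obtain ⟨L, hL⟩ := exists_linearMap_liftW_add_liftM (𝒯 := 𝒯) (p := p) hd
  obtain ⟨C₀, hC₀⟩ := bκ₀
  obtain ⟨C, hC⟩ := bψ
  let fst := LinearMap.fst ℂ (WSpace 𝒯 p) (MSpace 𝒯 p)
  let snd := LinearMap.snd ℂ (WSpace 𝒯 p) (MSpace 𝒯 p)
  have volume_term := isAffineSesq_intElems_sum (fun T => integrableOn_ofReal_elem (hκ₀ T) (hC₀ T))
    (fun q T => integrableOn_ofReal_elem (hψ q T) (hC q T))
    (P := fun T i => vVal T i ∘ₗ L) (R := fun T i => wGrad T i ∘ₗ fst)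
    (fun T i v => (continuous_vVal T i _).continuousOn)
    (fun T i w => (continuous_wGrad T i _).continuousOn)
  have flux_term {R : 𝒯.Elem → 𝒯.Face → Space 𝒯 p →ₗ[ℂ] EuclideanSpace ℝ (Fin d) → ℂ}
      (hR : ∀ T F w, ContinuousOn (R T F w) F.hull) :=
    isAffineSesq_intSkeleton (fun T F hF => integrableOn_ofReal_face hd (hκ₀ T) (hC₀ T) hF)
      (fun q T F hF => integrableOn_ofReal_face hd (hψ q T) (hC q T) hF)
      (P := numFlux L τ) (continuousOn_numFlux L τ) hR
  have flux_term_w := flux_term (R := fun T _ => wVal T ∘ₗ fst)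
    fun T F w => (continuous_wVal T _).continuousOn
  have flux_term_m := flux_term (R := fun _ F => mVal F ∘ₗ snd) fun _ F w => continuousOn_mVal F _
  have reaction_term := isAffineSesq_intElems (Q := Q) (c₀ := fun _ => ϱ) (c := 0)
    hϱ (fun _ _ => integrableOn_zero) (P := fun T => wVal T ∘ₗ fst) (R := fun T => wVal T ∘ₗ fst)
    (fun T v => (continuous_wVal T _).continuousOn) (fun T w => (continuous_wVal T _).continuousOn)
  have boundary_term := isAffineSesq_intBoundary (Q := Q) hν
    (P := fun F => mVal F ∘ₗ snd) (R := fun F => mVal F ∘ₗ snd)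
    (fun F v => continuousOn_mVal F _) (fun F w => continuousOn_mVal F _)
  have mul_numFlux (T F v) (k : ℂ) (x) : k * numFlux L τ T F v x
      = k * VSpace.flux (liftW v.1 + liftM v.2) T F x
        - k * (τ : ℂ) * (WSpace.val v.1 T x - MSpace.val v.2 F x) := by
    rw [← hL, mul_assoc, ← mul_sub]
    rfl
  convert (((volume_term.sub flux_term_w).add reaction_term).add flux_term_m).add boundary_term
    using 4 with y v w
  simp only [aForm, mul_numFlux, LinearMap.comp_apply, hL, Pi.zero_apply, zero_mul,
    Finset.sum_const_zero, add_zero, Complex.ofReal_add, Complex.ofReal_sum, Complex.ofReal_mul]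
  rfl

lemma exists_sesqForm_innerW (hd : 0 < d) (τ : ℝ) :
    ∃ B : Space 𝒯 p →ₗ[ℂ] Space 𝒯 p →ₗ⋆[ℂ] ℂ, ∀ v w, B v w = innerW τ v w := by
  simpa [innerW] using! (isAffineSesq_aForm (𝒯 := 𝒯) (p := p) (Q := 0) hd τ (κ₀ := fun _ _ => 1)
    (ψ := 0) (ϱ := fun _ => 1) (ν := fun _ => 1) (fun _ => measurable_const)
    (fun _ _ => measurable_const) ⟨1, fun _ _ _ => by simp⟩ ⟨0, fun q => q.elim0⟩
    (fun T => intOn T continuous_const)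
    fun F _ => F.integrableOn hd continuousOn_const).exists_sesqForm 0

lemma Problem.exists_continuous_sesqForm_a {Q : ℕ} (D : Problem 𝒯 p Q) (hd : 0 < d) :
    ∃ A : (Fin Q → ℝ) → Space 𝒯 p →ₗ[ℂ] Space 𝒯 p →ₗ⋆[ℂ] ℂ,
      (∀ y v w, A y v w = D.a y v w) ∧ ∀ v w, Continuous fun y => A y v w :=
  (isAffineSesq_aForm hd D.τ D.measurable_κbar D.measurable_ψ D.bounded_κbar D.bounded_ψ
    D.integrable_ϱ D.integrable_ν).exists_continuous_sesqForm

/-! ## Integration over cones -/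

section Cone

open Module

variable {E : Type*} [NormedAddCommGroup E] [InnerProductSpace ℝ E]

/-- `T` is the solid cone with apex `b` over the base `S`, where `S` lies in the hyperplane through
`b + u` orthogonal to `u`. -/
structure IsSolidCone (b u : E) (S T : Set E) : Prop where
  ne_zero : u ≠ 0
  inner_sub_eq : ∀ y ∈ S, inner ℝ (y - b) u = ‖u‖ ^ 2
  mem_iff : ∀ z, z ∈ T ↔ ∃ x ∈ Set.Icc (0 : ℝ) 1, ∃ y ∈ S, AffineMap.homothety b x y = z

lemma continuous_uncurry_homothety (b : E) :
    Continuous fun z : ℝ × E => AffineMap.homothety b z.1 z.2 := by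
  simp only [AffineMap.homothety_apply, vsub_eq_sub, vadd_eq_add]
  fun_prop

/-- The affine function that vanishes at `b` and equals `1` on the hyperplane through `b + u`
orthogonal to `u`. -/
noncomputable def coneHeight (b u z : E) : ℝ := inner ℝ (z - b) u / ‖u‖ ^ 2

lemma continuous_coneHeight (b u : E) : Continuous (coneHeight b u) := by
  unfold coneHeight
  fun_prop

/-- The union of the lines through `b` and a point of `V` on the hyperplane through `b + u`
orthogonal to `u`, with `b` removed: the central projection from `b` pulls `V` back to it. -/
def puncturedCone (b u : E) (V : Set E) : Set E :=
  {z | coneHeight b u z ≠ 0 ∧ AffineMap.homothety b (coneHeight b u z)⁻¹ z ∈ V}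

lemma isOpen_puncturedCone (b u : E) {V : Set E} (hV : IsOpen V) :
    IsOpen (puncturedCone b u V) := by
  have hproj : ContinuousOn (fun z => AffineMap.homothety b (coneHeight b u z)⁻¹ z)
      {z | coneHeight b u z ≠ 0} :=
    (continuous_uncurry_homothety b).comp_continuousOn
      (((continuous_coneHeight b u).continuousOn.inv₀ fun _ hz => hz).prodMk continuousOn_id)
  exact hproj.isOpen_inter_preimage (isOpen_ne.preimage (continuous_coneHeight b u)) hV

lemma mem_mk'_orthogonal_iff_coneHeight_eq {u : E} (hu : u ≠ 0) (b z : E) (x : ℝ) :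
    z ∈ AffineSubspace.mk' (x • u +ᵥ b) (Submodule.span ℝ {u})ᗮ ↔ coneHeight b u z = x := by
  have hsub : z -ᵥ (x • u +ᵥ b) = (z - b) - x • u := by
    simp only [vsub_eq_sub, vadd_eq_add]
    abel
  rw [AffineSubspace.mem_mk', Submodule.mem_orthogonal_singleton_iff_inner_left, hsub,
    inner_sub_left, real_inner_smul_left, real_inner_self_eq_norm_sq, sub_eq_zero, coneHeight,
    div_eq_iff (by simpa using hu)]

namespace IsSolidCone

variable {b u : E} {S T : Set E}

lemma coneHeight_homothety (h : IsSolidCone b u S T) (x : ℝ) {y : E} (hy : y ∈ S) :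
    coneHeight b u (AffineMap.homothety b x y) = x := by
  have hu : ‖u‖ ^ 2 ≠ 0 := by simpa using h.ne_zero
  simp only [coneHeight, AffineMap.homothety_apply, vsub_eq_sub, vadd_eq_add,
    add_sub_cancel_right, real_inner_smul_left, h.inner_sub_eq y hy]
  exact mul_div_cancel_right₀ x hu

lemma homothety_mem_puncturedCone_iff (h : IsSolidCone b u S T) {x : ℝ} (hx : x ≠ 0) {y : E}
    (hy : y ∈ S) {V : Set E} : AffineMap.homothety b x y ∈ puncturedCone b u V ↔ y ∈ V := by
  simp only [puncturedCone, Set.mem_ofPred_eq, h.coneHeight_homothety x hy,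
    ← AffineMap.homothety_mul_apply, inv_mul_cancel₀ hx, AffineMap.homothety_one,
    AffineMap.id_apply, ne_eq, hx, not_false_eq_true, true_and]

lemma base_subset (h : IsSolidCone b u S T) : S ⊆ T := fun y hy =>
  (h.mem_iff y).2 ⟨1, by simp, y, hy, by rw [AffineMap.homothety_one, AffineMap.id_apply]⟩

lemma inter_slice_eq_image (h : IsSolidCone b u S T) (A : Set E) {x : ℝ}
    (hx : x ∈ Set.Ioc (0 : ℝ) 1) :
    T ∩ A ∩ {z | coneHeight b u z = x}
      = AffineMap.homothety b x '' (S ∩ AffineMap.homothety b x ⁻¹' A) := by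
  ext z
  constructor
  · rintro ⟨⟨hzT, hzA⟩, hz⟩
    obtain ⟨t, -, y, hy, rfl⟩ := (h.mem_iff z).1 hzT
    obtain rfl : t = x := (h.coneHeight_homothety t hy).symm.trans hz
    exact ⟨y, ⟨hy, hzA⟩, rfl⟩
  · rintro ⟨y, ⟨hy, hyA⟩, rfl⟩
    exact ⟨⟨(h.mem_iff _).2 ⟨x, ⟨hx.1.le, hx.2⟩, y, hy, rfl⟩, hyA⟩, h.coneHeight_homothety x hy⟩

lemma coneHeight_mem_Icc (h : IsSolidCone b u S T) {z : E} (hz : z ∈ T) :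
    coneHeight b u z ∈ Set.Icc (0 : ℝ) 1 := by
  obtain ⟨t, ht, y, hy, rfl⟩ := (h.mem_iff z).1 hz
  rwa [h.coneHeight_homothety t hy]

variable [MeasurableSpace E] [BorelSpace E]

lemma euclideanHausdorffMeasure_inter_slice (h : IsSolidCone b u S T) (A : Set E) {x : ℝ}
    (hx : x ≠ 0) (n : ℕ) :
    μHE[n] (T ∩ A ∩ {z | coneHeight b u z = x})
      = (Set.Ioc (0 : ℝ) 1).indicator (fun x => ENNReal.ofReal x ^ n *
          μHE[n] (S ∩ AffineMap.homothety b x ⁻¹' A)) x := by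
  by_cases hx1 : x ∈ Set.Ioc (0 : ℝ) 1
  · rw [Set.indicator_of_mem hx1, h.inter_slice_eq_image A hx1,
      euclideanHausdorffMeasure_homothety_image _ _ hx, ENNReal.smul_def, smul_eq_mul,
      ENNReal.coe_pow, ENNReal.ofReal, Real.nnnorm_of_nonneg hx1.1.le,
      Real.toNNReal_of_nonneg hx1.1.le]
  · have hempty : T ∩ A ∩ {z | coneHeight b u z = x} = ∅ := by
      refine Set.eq_empty_of_forall_notMem ?_
      rintro z ⟨⟨hzT, -⟩, rfl⟩
      have hz := h.coneHeight_mem_Icc hzT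
      exact hx1 ⟨hz.1.lt_of_ne hx.symm, hz.2⟩
    rw [Set.indicator_of_notMem hx1, hempty, measure_empty]

variable [FiniteDimensional ℝ E]

lemma volume_inter (h : IsSolidCone b u S T) (hT : MeasurableSet T) {A : Set E}
    (hA : MeasurableSet A) :
    volume (T ∩ A) = ∫⁻ x in Set.Ioc (0 : ℝ) 1, ‖u‖ₑ * ENNReal.ofReal x ^ (finrank ℝ E - 1) *
      μHE[finrank ℝ E - 1] (S ∩ AffineMap.homothety b x ⁻¹' A) := by
  have hslices :=
    EuclideanGeometry.euclideanHausdorffMeasure_eq_lintegral b h.ne_zero (hT.inter hA)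
  rw [InnerProductSpace.euclideanHausdorffMeasure_eq_volume] at hslices
  rw [hslices]
  simp only [mul_assoc]
  rw [lintegral_const_mul' _ _ enorm_ne_top, ← lintegral_indicator measurableSet_Ioc]
  congr 1
  refine lintegral_congr_ae ?_
  filter_upwards [Measure.ae_ne volume (0 : ℝ)] with x hx
  rw [← h.euclideanHausdorffMeasure_inter_slice A hx]
  congr 2
  ext z
  exact mem_mk'_orthogonal_iff_coneHeight_eq h.ne_zero b z x

lemma volume_restrict_eq_map_homothety (h : IsSolidCone b u S T) (hT : MeasurableSet T)
    (hS : μHE[finrank ℝ E - 1] S < ⊤) :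
    volume.restrict T = Measure.map (fun z : ℝ × E => AffineMap.homothety b z.1 z.2)
      (((volume.restrict (Set.Ioc (0 : ℝ) 1)).withDensity
        fun x => ‖u‖ₑ * ENNReal.ofReal x ^ (finrank ℝ E - 1)).prod
          (μHE[finrank ℝ E - 1].restrict S)) := by
  have : IsFiniteMeasure ((μHE[finrank ℝ E - 1] : Measure E).restrict S) :=
    ⟨by rwa [Measure.restrict_apply_univ]⟩
  have hc := (continuous_uncurry_homothety b).measurable
  ext A hA
  rw [Measure.restrict_apply hA, Set.inter_comm, h.volume_inter hT hA,
    Measure.map_apply hc hA, Measure.prod_apply (hc hA),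
    lintegral_withDensity_eq_lintegral_mul _ (by fun_prop) (measurable_measure_prodMk_left (hc hA))]
  refine lintegral_congr fun x => ?_
  rw [Pi.mul_apply, Measure.restrict_apply (measurable_prodMk_left (hc hA)), Set.inter_comm]
  rfl

lemma setIntegral_eq (h : IsSolidCone b u S T) (hT : IsCompact T)
    (hS : μHE[finrank ℝ E - 1] S < ⊤) {F : Type*} [NormedAddCommGroup F] [NormedSpace ℝ F]
    {g : E → F} (hg : Continuous g) :
    ∫ z in T, g z = ‖u‖ • ∫ y in S, (∫ x in (0 : ℝ)..1,
      x ^ (finrank ℝ E - 1) • g (AffineMap.homothety b x y)) ∂μHE[finrank ℝ E - 1] := by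
  have : IsFiniteMeasure ((μHE[finrank ℝ E - 1] : Measure E).restrict S) :=
    ⟨by rwa [Measure.restrict_apply_univ]⟩
  have hc := continuous_uncurry_homothety b
  have hint : Integrable g (volume.restrict T) := hg.continuousOn.integrableOn_compact hT
  rw [h.volume_restrict_eq_map_homothety hT.measurableSet hS] at hint ⊢
  rw [integral_map hc.measurable.aemeasurable hg.aestronglyMeasurable, integral_prod_symm,
    ← integral_smul]
  · refine integral_congr_ae (ae_of_all _ fun y => ?_)
    simp only
    rw [integral_withDensity_eq_integral_toReal_smul (by fun_prop)
      (ae_of_all _ fun x => ENNReal.mul_lt_top enorm_lt_top (by finiteness)),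
      intervalIntegral.integral_of_le zero_le_one, ← integral_smul]
    refine setIntegral_congr_fun measurableSet_Ioc fun x hx => ?_
    simp only [ENNReal.toReal_mul, ENNReal.toReal_pow, toReal_enorm,
      ENNReal.toReal_ofReal hx.1.le, mul_smul]
  · exact (integrable_map_measure hg.aestronglyMeasurable hc.measurable.aemeasurable).1 hint

lemma euclideanHausdorffMeasure_base_inter_ne_zero (h : IsSolidCone b u S T) (hT : MeasurableSet T)
    (hTi : T ⊆ closure (interior T)) {V : Set E} (hV : IsOpen V) (hSV : (S ∩ V).Nonempty) :
    μHE[finrank ℝ E - 1] (S ∩ V) ≠ 0 := by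
  intro hnull
  obtain ⟨y, hyS, hyV⟩ := hSV
  have hopen : IsOpen (puncturedCone b u V) := isOpen_puncturedCone b u hV
  have hy : y ∈ puncturedCone b u V := by
    have := (h.homothety_mem_puncturedCone_iff one_ne_zero hyS).2 hyV
    rwa [AffineMap.homothety_one, AffineMap.id_apply] at this
  have hpos := (hopen.inter isOpen_interior).measure_pos volume
    (mem_closure_iff.1 (hTi (h.base_subset hyS)) _ hopen hy)
  have hzero : volume (T ∩ puncturedCone b u V) = 0 := by
    rw [h.volume_inter hT hopen.measurableSet]
    refine (setLIntegral_congr_fun (g := fun _ => 0) measurableSet_Ioc fun x hx => ?_).trans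
      lintegral_zero
    have hslice : S ∩ AffineMap.homothety b x ⁻¹' puncturedCone b u V ⊆ S ∩ V := fun y hy =>
      ⟨hy.1, (h.homothety_mem_puncturedCone_iff hx.1.ne' hy.1).1 hy.2⟩
    simp only [measure_mono_null hslice hnull, mul_zero]
  have hsub : puncturedCone b u V ∩ interior T ⊆ T ∩ puncturedCone b u V := fun z hz =>
    ⟨interior_subset hz.2, hz.1⟩
  exact hpos.ne' (measure_mono_null hsub hzero)

end IsSolidCone

end Cone

/-! ## The divergence theorem on simplices -/

section Simplex

open Module

variable {E : Type*} [NormedAddCommGroup E] [InnerProductSpace ℝ E]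

section Ray

variable {F : Type*} [NormedAddCommGroup F] [NormedSpace ℝ F] {f : E → F}

lemma hasDerivAt_pow_smul_homothety (hf : Differentiable ℝ f) (b y : E) (n : ℕ) (x : ℝ) :
    HasDerivAt (fun x : ℝ => x ^ (n + 1) • f (AffineMap.homothety b x y))
      (x ^ n • ((n + 1 : ℝ) • f (AffineMap.homothety b x y)
        + fderiv ℝ f (AffineMap.homothety b x y) (AffineMap.homothety b x y - b))) x := by
  have hline : HasDerivAt (fun x : ℝ => AffineMap.homothety b x y) (y - b) x := by
    simpa [AffineMap.homothety_apply] using ((hasDerivAt_id x).smul_const (y - b)).add_const b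
  have hsub : AffineMap.homothety b x y - b = x • (y - b) := by
    simp [AffineMap.homothety_apply]
  refine ((hasDerivAt_pow (n + 1) x).smul
    ((hf _).hasFDerivAt.comp_hasDerivAt x hline)).congr_deriv ?_
  rw [hsub, map_smul, smul_add, smul_smul, smul_smul, ← pow_succ, add_comm, Nat.add_sub_cancel,
    mul_comm (x ^ n)]
  push_cast
  rfl

lemma continuous_smul_add_fderiv_sub (hf : ContDiff ℝ 1 f) (b : E) (r : ℝ) :
    Continuous fun z => r • f z + fderiv ℝ f z (z - b) :=
  (hf.continuous.const_smul r).add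
    ((hf.continuous_fderiv one_ne_zero).clm_apply (by fun_prop))

lemma integral_homothety_radial [CompleteSpace F] (hf : ContDiff ℝ 1 f) (b y : E) {n : ℕ}
    (hn : 0 < n) :
    ∫ x in (0 : ℝ)..1, x ^ (n - 1) • ((n : ℝ) • f (AffineMap.homothety b x y)
      + fderiv ℝ f (AffineMap.homothety b x y) (AffineMap.homothety b x y - b)) = f y := by
  obtain ⟨n, rfl⟩ : ∃ m, n = m + 1 := ⟨n - 1, by omega⟩
  have hline : Continuous fun x : ℝ => AffineMap.homothety b x y :=
    (continuous_uncurry_homothety b).comp (by fun_prop : Continuous fun x : ℝ => (x, y))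
  have hcont : Continuous fun x : ℝ => x ^ n • ((n + 1 : ℝ) • f (AffineMap.homothety b x y)
      + fderiv ℝ f (AffineMap.homothety b x y) (AffineMap.homothety b x y - b)) :=
    (continuous_pow n).smul ((continuous_smul_add_fderiv_sub hf b (n + 1)).comp hline)
  have hftc := intervalIntegral.integral_eq_sub_of_hasDerivAt
    (fun x _ => hasDerivAt_pow_smul_homothety (hf.differentiable one_ne_zero) b y n x)
    (hcont.intervalIntegrable 0 1)
  rw [one_pow, one_smul, AffineMap.homothety_one, AffineMap.id_apply, zero_pow n.succ_ne_zero,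
    zero_smul, sub_zero] at hftc
  simpa only [Nat.add_sub_cancel, Nat.cast_add_one] using hftc

end Ray

variable [DecidableEq E]

lemma mem_convexHull_iff_homothety {T : Finset E} {b : E} (hb : b ∈ T) (hne : (T.erase b).Nonempty)
    (z : E) :
    z ∈ convexHull ℝ (T : Set E) ↔ ∃ x ∈ Set.Icc (0 : ℝ) 1,
      ∃ y ∈ convexHull ℝ (T.erase b : Set E), AffineMap.homothety b x y = z := by
  have hT : (T : Set E) = insert b (T.erase b : Set E) := by
    rw [← Finset.coe_insert, Finset.insert_erase hb]
  rw [hT, convexHull_insert (by exact_mod_cast hne), mem_convexJoin]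
  simp only [Set.mem_singleton_iff, exists_eq_left, segment_eq_image_lineMap, Set.mem_image,
    AffineMap.homothety_eq_lineMap]
  exact ⟨fun ⟨y, hy, x, hx, h⟩ => ⟨x, hx, y, hy, h⟩, fun ⟨x, hx, y, hy, h⟩ => ⟨y, hy, x, hx, h⟩⟩

variable [FiniteDimensional ℝ E]

/-- The vector from `b` to its orthogonal projection on the face of the simplex `T` that is
opposite to `b`. -/
noncomputable def altitude (T : Finset E) (b : E) : E :=
  (vectorSpan ℝ (T.erase b : Set E))ᗮ.starProjection ((T.erase b).centroid ℝ id - b)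

/-- The unit normal of the face of the simplex `T` opposite to `b`, pointing away from `b`. -/
noncomputable def outerNormal (T : Finset E) (b : E) : E := ‖altitude T b‖⁻¹ • altitude T b

variable {T : Finset E} {b : E}

lemma inner_sub_altitude (hT : (T.erase b).Nonempty) {y : E}
    (hy : y ∈ affineSpan ℝ (T.erase b : Set E)) :
    inner ℝ (y - b) (altitude T b) = ‖altitude T b‖ ^ 2 := by
  set W := vectorSpan ℝ (T.erase b : Set E)
  set c := (T.erase b).centroid ℝ id
  have hc : c ∈ affineSpan ℝ (T.erase b : Set E) :=
    convexHull_subset_affineSpan _ (Finset.centroid_mem_convexHull _ hT)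
  have hyc : y - c ∈ W := by
    have := AffineSubspace.vsub_mem_direction hy hc
    rwa [direction_affineSpan] at this
  have haltitude : altitude T b ∈ Wᗮ := Submodule.starProjection_apply_mem _ _
  rw [← sub_add_sub_cancel y c b, inner_add_left,
    Submodule.inner_right_of_mem_orthogonal hyc haltitude, zero_add,
    ← real_inner_self_eq_norm_sq, ← Submodule.starProjection_eq_self_iff.2 haltitude,
    ← Submodule.inner_starProjection_left_eq_right, Submodule.starProjection_eq_self_iff.2
      haltitude]
  rfl

lemma altitude_ne_zero (hT : AffineIndependent ℝ ((↑) : T → E)) (hb : b ∈ T)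
    (hne : (T.erase b).Nonempty) : altitude T b ≠ 0 := by
  intro h0
  set W := vectorSpan ℝ (T.erase b : Set E)
  set c := (T.erase b).centroid ℝ id
  have hc : c ∈ affineSpan ℝ (T.erase b : Set E) :=
    convexHull_subset_affineSpan _ (Finset.centroid_mem_convexHull _ hne)
  have hcb : c - b ∈ W := by
    rw [← Submodule.starProjection_add_starProjection_orthogonal (K := W) (c - b),
      show Wᗮ.starProjection (c - b) = 0 from h0, add_zero]
    exact Submodule.starProjection_apply_mem _ _
  have hb_mem : b ∈ affineSpan ℝ (T.erase b : Set E) := by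
    have := AffineSubspace.vadd_mem_of_mem_direction
      (by rw [direction_affineSpan]; exact W.neg_mem hcb) hc
    simpa using this
  refine hT.notMem_affineSpan_sdiff ⟨b, hb⟩ Set.univ ?_
  convert hb_mem using 2
  ext z
  simp [and_comm]

lemma isSolidCone_altitude (hT : AffineIndependent ℝ ((↑) : T → E)) (hb : b ∈ T)
    (hne : (T.erase b).Nonempty) :
    IsSolidCone b (altitude T b) (convexHull ℝ (T.erase b : Set E)) (convexHull ℝ (T : Set E)) where
  ne_zero := altitude_ne_zero hT hb hne
  inner_sub_eq _ hy := inner_sub_altitude hne (convexHull_subset_affineSpan _ hy)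
  mem_iff := mem_convexHull_iff_homothety hb hne

lemma inner_sub_outerNormal {a : E} (ha : a ∈ T) :
    inner ℝ (a - b) (outerNormal T b) = if b = a then 0 else ‖altitude T b‖ := by
  rcases eq_or_ne b a with rfl | hab
  · rw [sub_self, inner_zero_left, if_pos rfl]
  · have ha' : a ∈ T.erase b := Finset.mem_erase.2 ⟨hab.symm, ha⟩
    rw [if_neg hab, outerNormal, real_inner_smul_right,
      inner_sub_altitude ⟨a, ha'⟩ (subset_affineSpan ℝ _ ha'), pow_two, ← mul_assoc]
    exact inv_mul_mul_self _

variable [MeasurableSpace E] [BorelSpace E] {F : Type*} [NormedAddCommGroup F] [NormedSpace ℝ F]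
  [CompleteSpace F] {f : E → F}

/-- The divergence theorem for the radial field `f z • (z - b)`, whose flux through the faces
containing `b` vanishes. -/
lemma setIntegral_radial_simplex (hE : 0 < finrank ℝ E)
    (hT : AffineIndependent ℝ ((↑) : T → E)) (hcard : T.card = finrank ℝ E + 1) (hb : b ∈ T)
    (hf : ContDiff ℝ 1 f) :
    ∫ z in convexHull ℝ (T : Set E), ((finrank ℝ E : ℝ) • f z + fderiv ℝ f z (z - b))
      = ‖altitude T b‖ • ∫ y in convexHull ℝ (T.erase b : Set E), f y ∂μHE[finrank ℝ E - 1] := by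
  have hcard' : (T.erase b).card = finrank ℝ E := by
    rw [Finset.card_erase_of_mem hb, hcard, Nat.add_sub_cancel]
  have hfinite : μHE[finrank ℝ E - 1] (convexHull ℝ (T.erase b : Set E)) < ⊤ :=
    euclideanHausdorffMeasure_convexHull_lt_top (hT.mono (Finset.erase_subset b T))
      (by rw [hcard']; omega)
  rw [(isSolidCone_altitude hT hb (Finset.card_pos.1 (by rwa [hcard']))).setIntegral_eq
    (T.finite_toSet.isCompact_convexHull ℝ) hfinite (continuous_smul_add_fderiv_sub hf b _)]
  simp only [integral_homothety_radial hf b _ hE]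

lemma setIntegral_fderiv_edge (hE : 0 < finrank ℝ E)
    (hT : AffineIndependent ℝ ((↑) : T → E)) (hcard : T.card = finrank ℝ E + 1) {a : E}
    (ha : a ∈ T) (hb : b ∈ T) (hf : ContDiff ℝ 1 f) :
    ∫ z in convexHull ℝ (T : Set E), fderiv ℝ f z (a - b)
      = ‖altitude T b‖ • (∫ y in convexHull ℝ (T.erase b : Set E), f y ∂μHE[finrank ℝ E - 1])
        - ‖altitude T a‖ • ∫ y in convexHull ℝ (T.erase a : Set E), f y ∂μHE[finrank ℝ E - 1] := by
  have hint (c : E) : IntegrableOn (fun z => (finrank ℝ E : ℝ) • f z + fderiv ℝ f z (z - c))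
      (convexHull ℝ (T : Set E)) :=
    (continuous_smul_add_fderiv_sub hf c _).continuousOn.integrableOn_compact
      (T.finite_toSet.isCompact_convexHull ℝ)
  rw [← setIntegral_radial_simplex hE hT hcard hb hf,
    ← setIntegral_radial_simplex hE hT hcard ha hf, ← integral_sub (hint b) (hint a)]
  congr 1
  funext z
  rw [add_sub_add_left_eq_sub, ← map_sub, sub_sub_sub_cancel_left]

theorem setIntegral_fderiv_simplex (hE : 0 < finrank ℝ E)
    (hT : AffineIndependent ℝ ((↑) : T → E)) (hcard : T.card = finrank ℝ E + 1)
    (hf : ContDiff ℝ 1 f) (e : E) :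
    ∫ z in convexHull ℝ (T : Set E), fderiv ℝ f z e
      = ∑ b ∈ T, inner ℝ e (outerNormal T b) •
          ∫ y in convexHull ℝ (T.erase b : Set E), f y ∂μHE[finrank ℝ E - 1] := by
  set I : E → F := fun b =>
    ∫ y in convexHull ℝ (T.erase b : Set E), f y ∂μHE[finrank ℝ E - 1]
  have hint : IntegrableOn (fderiv ℝ f) (convexHull ℝ (T : Set E)) :=
    (hf.continuous_fderiv one_ne_zero).continuousOn.integrableOn_compact
      (T.finite_toSet.isCompact_convexHull ℝ)
  have hspan : Submodule.span ℝ ((T : Set E) -ᵥ (T : Set E)) = ⊤ := by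
    have := hT.vectorSpan_eq_top_of_card_eq_finrank_add_one (by rwa [Fintype.card_coe])
    rwa [Subtype.range_coe] at this
  suffices h : (∫ z in convexHull ℝ (T : Set E), fderiv ℝ f z : E →L[ℝ] F).toLinearMap
      = ∑ b ∈ T, ((innerSL ℝ (outerNormal T b)).smulRight (I b)).toLinearMap by
    have he := DFunLike.congr_fun h e
    simpa only [ContinuousLinearMap.coe_coe, ContinuousLinearMap.integral_apply hint,
      LinearMap.sum_apply, ContinuousLinearMap.smulRight_apply, innerSL_apply_apply,
      real_inner_comm] using he
  refine LinearMap.ext_on hspan ?_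
  rintro _ ⟨a, ha, b, hb, rfl⟩
  simp only [vsub_eq_sub, ContinuousLinearMap.coe_coe, ContinuousLinearMap.integral_apply hint,
    setIntegral_fderiv_edge hE hT hcard ha hb hf, LinearMap.sum_apply,
    ContinuousLinearMap.smulRight_apply, innerSL_apply_apply]
  have hterm (c : E) : inner ℝ (outerNormal T c) (a - b) • I c
      = (if c = b then ‖altitude T c‖ • I c else 0)
        - (if c = a then ‖altitude T c‖ • I c else 0) := by
    rw [real_inner_comm, ← sub_sub_sub_cancel_right a b c, inner_sub_left,
      inner_sub_outerNormal ha, inner_sub_outerNormal hb]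
    split_ifs <;> simp
  simp only [hterm, Finset.sum_sub_distrib, Finset.sum_ite_eq',
    if_pos (Finset.mem_coe.1 ha), if_pos (Finset.mem_coe.1 hb), I]

end Simplex

/-! ## Integration by parts on the triangulation -/

lemma centroid_eq_smul_sum {E : Type*} [AddCommGroup E] [Module ℝ E] {S : Finset E}
    (hS : S.Nonempty) : S.centroid ℝ id = (S.card : ℝ)⁻¹ • ∑ x ∈ S, x := by
  rw [Finset.centroid_def, Finset.affineCombination_eq_linear_combination _ _ _
    (S.sum_centroidWeights_eq_one_of_nonempty ℝ hS), Finset.smul_sum]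
  rfl

lemma centroid_erase_sub_centroid {E : Type*} [AddCommGroup E] [Module ℝ E] [DecidableEq E]
    {T : Finset E} {b : E} (hb : b ∈ T) (hne : (T.erase b).Nonempty) :
    (T.erase b).centroid ℝ id - T.centroid ℝ id
      = (T.card : ℝ)⁻¹ • ((T.erase b).centroid ℝ id - b) := by
  set c := (T.erase b).centroid ℝ id
  have hT0 : (T.card : ℝ) ≠ 0 := by exact_mod_cast (Finset.card_pos.2 ⟨b, hb⟩).ne'
  have hcard : ((T.erase b).card : ℝ) = T.card - 1 := by
    rw [Finset.card_erase_of_mem hb, Nat.cast_pred (Finset.card_pos.2 ⟨b, hb⟩)]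
  have hsum : ∑ x ∈ T, x = b + ((T.card : ℝ) - 1) • c := by
    rw [← Finset.add_sum_erase _ _ hb, ← hcard, show c = _ from centroid_eq_smul_sum hne,
      smul_inv_smul₀ (by exact_mod_cast (Finset.card_pos.2 hne).ne')]
  rw [centroid_eq_smul_sum ⟨b, hb⟩, hsum]
  match_scalars <;> field_simp
  ring

lemma Mesh.Elem.affineIndependent (T : 𝒯.Elem) :
    AffineIndependent ℝ ((↑) : T.1 → EuclideanSpace ℝ (Fin d)) :=
  𝒯.complex.indep T.2.1

lemma Mesh.Elem.card_erase (T : 𝒯.Elem) {b : EuclideanSpace ℝ (Fin d)} (hb : b ∈ T.1) :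
    (T.1.erase b).card = d := by
  rw [Finset.card_erase_of_mem hb, T.2.2, Nat.add_sub_cancel]

lemma Mesh.Elem.erase_nonempty (hd : 0 < d) (T : 𝒯.Elem) {b : EuclideanSpace ℝ (Fin d)}
    (hb : b ∈ T.1) : (T.1.erase b).Nonempty :=
  Finset.card_pos.1 (by rwa [T.card_erase hb])

/-- The face of `T` opposite to the vertex `b`; every face of `T` is of this form. -/
noncomputable def Mesh.Elem.opposite (hd : 0 < d) (T : 𝒯.Elem) (b : EuclideanSpace ℝ (Fin d))
    (hb : b ∈ T.1) : 𝒯.Face :=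
  ⟨T.1.erase b, 𝒯.complex.down_closed T.2.1 (Finset.erase_subset _ _) (T.erase_nonempty hd hb),
    T.card_erase hb⟩

lemma Mesh.Elem.exists_opposite_eq (hd : 0 < d) {T : 𝒯.Elem} {F : 𝒯.Face} (hF : F ∈ T.faces) :
    ∃ b, ∃ hb : b ∈ T.1, T.opposite hd b hb = F := by
  obtain ⟨b, hb, hinsert⟩ := Finset.exists_eq_insert_iff.2
    ⟨(Finset.mem_filter.1 hF).2, F.2.2.symm ▸ T.2.2.symm⟩
  refine ⟨b, hinsert ▸ Finset.mem_insert_self _ _, Subtype.ext ?_⟩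
  change T.1.erase b = F.1
  rw [← hinsert, Finset.erase_insert hb]

lemma Mesh.Elem.sum_faces (hd : 0 < d) (T : 𝒯.Elem) (g : 𝒯.Face → ℂ) :
    ∑ F ∈ T.faces, g F = ∑ b ∈ T.1.attach, g (T.opposite hd b.1 b.2) := by
  refine (Finset.sum_bij (fun b _ => T.opposite hd b.1 b.2)
    (fun b _ => Finset.mem_filter.2 ⟨Finset.mem_univ _, Finset.erase_subset _ _⟩)
    (fun a _ b _ hab => ?_) (fun F hF => ?_) fun b _ => rfl).symm
  · exact Subtype.ext (Finset.erase_injOn T.1 a.2 b.2 (congrArg Subtype.val hab))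
  · obtain ⟨b, hb, h⟩ := exists_opposite_eq hd hF
    exact ⟨⟨b, hb⟩, Finset.mem_attach _ _, h⟩

lemma Mesh.normal_opposite (hd : 0 < d) (T : 𝒯.Elem) {b : EuclideanSpace ℝ (Fin d)}
    (hb : b ∈ T.1) : Mesh.normal T (T.opposite hd b hb) = outerNormal T.1 b := by
  have hpos : (0 : ℝ) < (T.1.card : ℝ)⁻¹ :=
    inv_pos.2 (by exact_mod_cast Finset.card_pos.2 ⟨b, hb⟩)
  have hproj : (vectorSpan ℝ (T.1.erase b : Set (EuclideanSpace ℝ (Fin d))))ᗮ.starProjection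
      ((T.1.erase b).centroid ℝ id - T.1.centroid ℝ id) = (T.1.card : ℝ)⁻¹ • altitude T.1 b := by
    rw [centroid_erase_sub_centroid hb (T.erase_nonempty hd hb), map_smul]
    rfl
  calc Mesh.normal T (T.opposite hd b hb)
      = ‖(T.1.card : ℝ)⁻¹ • altitude T.1 b‖⁻¹ • (T.1.card : ℝ)⁻¹ • altitude T.1 b :=
        congrArg (fun v => ‖v‖⁻¹ • v) hproj
    _ = outerNormal T.1 b := by
      rw [norm_smul, Real.norm_of_nonneg hpos.le, smul_smul, mul_inv, mul_right_comm,
        inv_mul_cancel₀ hpos.ne', one_mul, outerNormal]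

lemma evalAt_mul (x : EuclideanSpace ℝ (Fin d)) (q r : MvPolynomial (Fin d) ℂ) :
    evalAt x (q * r) = evalAt x q * evalAt x r :=
  map_mul (MvPolynomial.aeval fun i => ((x i : ℝ) : ℂ)) q r

lemma evalAt_map_conj (x : EuclideanSpace ℝ (Fin d)) (q : MvPolynomial (Fin d) ℂ) :
    evalAt x (MvPolynomial.map (starRingEnd ℂ) q) = conj (evalAt x q) := by
  induction q using MvPolynomial.induction_on with
  | C a => simp [evalAt]
  | add q r hq hr => simp only [map_add, hq, hr]
  | mul_X q j hq =>
    rw [map_mul, evalAt_mul, evalAt_mul, hq, map_mul]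
    simp [evalAt]

lemma evalAt_X (x : EuclideanSpace ℝ (Fin d)) (j : Fin d) :
    evalAt x (MvPolynomial.X j) = (Complex.ofRealCLM ∘L EuclideanSpace.proj (𝕜 := ℝ) j) x := by
  simp [evalAt]

lemma contDiff_evalAt (q : MvPolynomial (Fin d) ℂ) :
    ContDiff ℝ 1 fun x : EuclideanSpace ℝ (Fin d) => evalAt x q := by
  induction q using MvPolynomial.induction_on with
  | C a => simpa [evalAt] using contDiff_const
  | add q r hq hr => simpa only [map_add] using hq.add hr
  | mul_X q j hq =>
    simp only [evalAt_mul, evalAt_X]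
    fun_prop

lemma fderiv_evalAt_single (q : MvPolynomial (Fin d) ℂ) (x : EuclideanSpace ℝ (Fin d)) (i : Fin d) :
    fderiv ℝ (fun x => evalAt x q) x (EuclideanSpace.single i 1)
      = evalAt x (MvPolynomial.pderiv i q) := by
  have hdiff (q : MvPolynomial (Fin d) ℂ) :
      DifferentiableAt ℝ (fun x : EuclideanSpace ℝ (Fin d) => evalAt x q) x :=
    (contDiff_evalAt q).differentiable one_ne_zero x
  induction q using MvPolynomial.induction_on with
  | C a => simp [evalAt]
  | add q r hq hr =>
    simp only [map_add, fderiv_fun_add (hdiff q) (hdiff r), _root_.add_apply, hq, hr]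
  | mul_X q j hq =>
    have hX : fderiv ℝ (fun x : EuclideanSpace ℝ (Fin d) => evalAt x (MvPolynomial.X j)) x
        (EuclideanSpace.single i 1) = evalAt x (MvPolynomial.pderiv i (MvPolynomial.X j)) := by
      simp only [evalAt_X, ContinuousLinearMap.fderiv, MvPolynomial.pderiv_X]
      obtain rfl | hij := eq_or_ne j i
      · simp [evalAt]
      · simp [evalAt, hij]
    simp only [evalAt_mul, fderiv_fun_mul (hdiff q) (hdiff (MvPolynomial.X j)),
      MvPolynomial.pderiv_mul, map_add, _root_.add_apply,
      _root_.smul_apply, hq, hX, smul_eq_mul]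
    ring

theorem setIntegral_pderiv_elem (hd : 0 < d) (T : 𝒯.Elem) (q : MvPolynomial (Fin d) ℂ)
    (i : Fin d) :
    ∫ x in T.hull, evalAt x (MvPolynomial.pderiv i q)
      = ∑ F ∈ T.faces, ∫ x in F.hull, evalAt x q * ((Mesh.normal T F i : ℝ) : ℂ) ∂μHE[d - 1] := by
  have divergence := setIntegral_fderiv_simplex (by rwa [finrank_euclideanSpace_fin])
    T.affineIndependent (by rw [finrank_euclideanSpace_fin, T.2.2]) (contDiff_evalAt q)
    (EuclideanSpace.single i 1)
  simp only [fderiv_evalAt_single, finrank_euclideanSpace_fin,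
    EuclideanSpace.inner_single_left, map_one, one_mul] at divergence
  rw [T.sum_faces hd, Mesh.Elem.hull, divergence, ← Finset.sum_attach]
  refine Finset.sum_congr rfl fun b _ => ?_
  rw [integral_mul_const, Mesh.normal_opposite hd T b.2, mul_comm, ← Complex.real_smul]
  rfl

/-- The product `rᵢ w̄` on the element `T`, as a polynomial. -/
noncomputable def mulConjPoly (r : VSpace 𝒯 p) (w : WSpace 𝒯 p) (T : 𝒯.Elem) (i : Fin d) :
    MvPolynomial (Fin d) ℂ :=
  (r T i : MvPolynomial (Fin d) ℂ) * MvPolynomial.map (starRingEnd ℂ) (w T)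

lemma evalAt_mulConjPoly (r : VSpace 𝒯 p) (w : WSpace 𝒯 p) (T : 𝒯.Elem) (i : Fin d)
    (x : EuclideanSpace ℝ (Fin d)) :
    evalAt x (mulConjPoly r w T i) = VSpace.val r T x i * conj (WSpace.val w T x) := by
  rw [mulConjPoly, evalAt_mul, evalAt_map_conj]
  rfl

lemma sum_evalAt_pderiv_mulConjPoly (r : VSpace 𝒯 p) (w : WSpace 𝒯 p) (T : 𝒯.Elem)
    (x : EuclideanSpace ℝ (Fin d)) :
    ∑ i, evalAt x (MvPolynomial.pderiv i (mulConjPoly r w T i))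
      = (∑ i, VSpace.val r T x i * conj (WSpace.grad w T x i))
        + VSpace.div r T x * conj (WSpace.val w T x) := by
  rw [VSpace.div, Finset.sum_mul, ← Finset.sum_add_distrib]
  refine Finset.sum_congr rfl fun i _ => ?_
  rw [mulConjPoly, MvPolynomial.pderiv_mul, MvPolynomial.pderiv_map, map_add, evalAt_mul,
    evalAt_mul, evalAt_map_conj, evalAt_map_conj, add_comm]
  rfl

lemma integration_by_parts_elem (hd : 0 < d) (r : VSpace 𝒯 p) (w : WSpace 𝒯 p) (T : 𝒯.Elem) :
    (∫ x in T.hull, ∑ i, VSpace.val r T x i * conj (WSpace.grad w T x i))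
      + ∫ x in T.hull, VSpace.div r T x * conj (WSpace.val w T x)
      = ∑ F ∈ T.faces, ∫ x in F.hull,
        VSpace.flux r T F x * conj (WSpace.val w T x) ∂μHE[d - 1] := by
  have hr (i) : Continuous fun x => VSpace.val r T x i := continuous_vVal T i r
  have hw : Continuous fun x => WSpace.val w T x := continuous_wVal T w
  have hg (i) : Continuous fun x => WSpace.grad w T x i := continuous_wGrad T i w
  have hdiv : Continuous fun x => VSpace.div r T x := continuous_vDiv T r
  rw [← integral_add (intOn T (by fun_prop)) (intOn T (by fun_prop))]
  simp only [← sum_evalAt_pderiv_mulConjPoly]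
  rw [integral_finsetSum _ fun i _ => intOn T (evalAt_continuous _)]
  simp only [setIntegral_pderiv_elem hd]
  rw [Finset.sum_comm]
  refine Finset.sum_congr rfl fun F _ => ?_
  have hint (i) (_ : i ∈ Finset.univ) : IntegrableOn (fun x => evalAt x (mulConjPoly r w T i)
      * ((Mesh.normal T F i : ℝ) : ℂ)) F.hull μHE[d - 1] :=
    F.integrableOn hd ((evalAt_continuous _).mul continuous_const).continuousOn
  rw [← integral_finsetSum _ hint]
  simp only [evalAt_mulConjPoly, VSpace.flux, Finset.sum_mul, mul_right_comm]

theorem integration_by_parts (hd : 0 < d) (r : VSpace 𝒯 p) (w : WSpace 𝒯 p) :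
    intElems (fun T x => ∑ i, VSpace.val r T x i * conj (WSpace.grad w T x i))
      + intElems (fun T x => VSpace.div r T x * conj (WSpace.val w T x))
      = intSkeleton fun T F x => VSpace.flux r T F x * conj (WSpace.val w T x) := by
  rw [intElems, intElems, intSkeleton, ← Finset.sum_add_distrib]
  exact Finset.sum_congr rfl fun T _ => integration_by_parts_elem hd r w T

/-! ## Positive definiteness of the HDG inner product -/

lemma conj_intElems (φ : 𝒯.Elem → EuclideanSpace ℝ (Fin d) → ℂ) :
    conj (intElems φ) = intElems fun T x => conj (φ T x) := by
  simp only [intElems, map_sum, integral_conj]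

lemma conj_intSkeleton (φ : 𝒯.Elem → 𝒯.Face → EuclideanSpace ℝ (Fin d) → ℂ) :
    conj (intSkeleton φ) = intSkeleton fun T F x => conj (φ T F x) := by
  simp only [intSkeleton, map_sum, integral_conj]

lemma intElems_mul_conj_self (φ : 𝒯.Elem → EuclideanSpace ℝ (Fin d) → ℂ) :
    intElems (fun T x => φ T x * conj (φ T x))
      = ((∑ T : 𝒯.Elem, ∫ x in T.hull, ‖φ T x‖ ^ 2 : ℝ) : ℂ) := by
  simp only [intElems, Complex.mul_conj', Complex.ofReal_sum, ← integral_complex_ofReal,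
    Complex.ofReal_pow]

lemma intSkeleton_mul_conj_self (φ : 𝒯.Elem → 𝒯.Face → EuclideanSpace ℝ (Fin d) → ℂ) :
    intSkeleton (fun T F x => φ T F x * conj (φ T F x))
      = ((∑ T : 𝒯.Elem, ∑ F ∈ T.faces, ∫ x in F.hull, ‖φ T F x‖ ^ 2 ∂μHE[d - 1] : ℝ) : ℂ) := by
  simp only [intSkeleton, Complex.mul_conj', Complex.ofReal_sum, ← integral_complex_ofReal,
    Complex.ofReal_pow]

lemma intBoundary_mul_conj_self (φ : 𝒯.Face → EuclideanSpace ℝ (Fin d) → ℂ) :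
    intBoundary (fun F x => φ F x * conj (φ F x))
      = ((∑ F ∈ 𝒯.boundaryFaces, ∫ x in F.hull, ‖φ F x‖ ^ 2 ∂μHE[d - 1] : ℝ) : ℂ) := by
  simp only [intBoundary, Complex.mul_conj', Complex.ofReal_sum, ← integral_complex_ofReal,
    Complex.ofReal_pow]

lemma re_gram_self_nonneg (q : VSpace 𝒯 p) : 0 ≤ (gram q q).re := by
  have gram_self : gram q q =
      ((∑ T : 𝒯.Elem, ∫ x in T.hull, ∑ i, ‖VSpace.val q T x i‖ ^ 2 : ℝ) : ℂ) := by
    simp only [gram, intElems, Complex.mul_conj', Complex.ofReal_sum, ← integral_complex_ofReal,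
      Complex.ofReal_pow]
  rw [gram_self, Complex.ofReal_re]
  positivity

section

variable {φ ψ : 𝒯.Elem → 𝒯.Face → EuclideanSpace ℝ (Fin d) → ℂ}

lemma intSkeleton_add (hd : 0 < d) (hφ : ∀ T F, ContinuousOn (φ T F) F.hull)
    (hψ : ∀ T F, ContinuousOn (ψ T F) F.hull) :
    intSkeleton (fun T F x => φ T F x + ψ T F x) = intSkeleton φ + intSkeleton ψ := by
  simp only [intSkeleton, ← Finset.sum_add_distrib]
  exact Finset.sum_congr rfl fun T _ => Finset.sum_congr rfl fun F _ =>
    integral_add (F.integrableOn hd (hφ T F)) (F.integrableOn hd (hψ T F))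

lemma intSkeleton_sub (hd : 0 < d) (hφ : ∀ T F, ContinuousOn (φ T F) F.hull)
    (hψ : ∀ T F, ContinuousOn (ψ T F) F.hull) :
    intSkeleton (fun T F x => φ T F x - ψ T F x) = intSkeleton φ - intSkeleton ψ := by
  simp only [intSkeleton, ← Finset.sum_sub_distrib]
  exact Finset.sum_congr rfl fun T _ => Finset.sum_congr rfl fun F _ =>
    integral_sub (F.integrableOn hd (hφ T F)) (F.integrableOn hd (hψ T F))

lemma intSkeleton_const_mul (c : ℂ) :
    intSkeleton (fun T F x => c * φ T F x) = c * intSkeleton φ := by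
  simp only [intSkeleton, Finset.mul_sum, integral_const_mul]

end

lemma gram_lift_right (hd : 0 < d) (r : VSpace 𝒯 p) (w : Space 𝒯 p) :
    gram r (liftW w.1 + liftM w.2)
      = intElems (fun T x => ∑ i, VSpace.val r T x i * conj (WSpace.grad w.1 T x i))
        - intSkeleton (fun T F x => VSpace.flux r T F x * conj (WSpace.val w.1 T x))
        + intSkeleton (fun T F x => VSpace.flux r T F x * conj (MSpace.val w.2 F x)) := by
  rw [← gram_conj, gram_add_left, gram_liftW, gram_liftM hd, map_add, map_neg, conj_intElems,
    conj_intSkeleton, ← integration_by_parts hd]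
  simp only [map_mul, Complex.conj_conj, mul_comm]
  ring

lemma intSkeleton_stabilized_flux (hd : 0 < d) (τ : ℝ) (q : VSpace 𝒯 p) (w : Space 𝒯 p) :
    intSkeleton (𝒯 := 𝒯) (fun T F x => (VSpace.flux q T F x
          - (τ : ℂ) * (WSpace.val w.1 T x - MSpace.val w.2 F x)) * conj (MSpace.val w.2 F x))
      - intSkeleton (𝒯 := 𝒯) (fun T F x => (VSpace.flux q T F x
          - (τ : ℂ) * (WSpace.val w.1 T x - MSpace.val w.2 F x)) * conj (WSpace.val w.1 T x))
      = intSkeleton (𝒯 := 𝒯) (fun T F x => VSpace.flux q T F x * conj (MSpace.val w.2 F x))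
        - intSkeleton (𝒯 := 𝒯) (fun T F x => VSpace.flux q T F x * conj (WSpace.val w.1 T x))
        + τ * intSkeleton (𝒯 := 𝒯) (fun T F x => (WSpace.val w.1 T x - MSpace.val w.2 F x)
          * conj (WSpace.val w.1 T x - MSpace.val w.2 F x)) := by
  have hq (T : 𝒯.Elem) (F) : ContinuousOn (fun x => VSpace.flux q T F x) F.hull :=
    (continuous_vFlux T F q).continuousOn
  have hw (T : 𝒯.Elem) (F : 𝒯.Face) : ContinuousOn (fun x => WSpace.val w.1 T x) F.hull :=
    (continuous_wVal T w.1).continuousOn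
  have hm (F : 𝒯.Face) : ContinuousOn (fun x => MSpace.val w.2 F x) F.hull :=
    continuousOn_mVal F w.2
  rw [← intSkeleton_sub hd (fun T F => by fun_prop) (fun T F => by fun_prop),
    ← intSkeleton_sub hd (fun T F => by fun_prop) (fun T F => by fun_prop),
    ← intSkeleton_const_mul,
    ← intSkeleton_add hd (fun T F => by fun_prop) (fun T F => by fun_prop)]
  congr! 4
  simp only [map_sub]
  ring

lemma innerW_self_eq (hd : 0 < d) (τ : ℝ) (w : Space 𝒯 p) :
    innerW τ w w = gram (liftW w.1 + liftM w.2) (liftW w.1 + liftM w.2)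
      + τ * intSkeleton (𝒯 := 𝒯) (fun T F x => (WSpace.val w.1 T x - MSpace.val w.2 F x)
          * conj (WSpace.val w.1 T x - MSpace.val w.2 F x))
      + intElems (fun T x => WSpace.val w.1 T x * conj (WSpace.val w.1 T x))
      + intBoundary (𝒯 := 𝒯) (fun F x => MSpace.val w.2 F x * conj (MSpace.val w.2 F x)) := by
  rw [gram_lift_right hd]
  simp only [innerW, aForm, one_mul, Complex.ofReal_one]
  linear_combination intSkeleton_stabilized_flux hd τ (liftW w.1 + liftM w.2) w

lemma re_innerW_self (hd : 0 < d) (τ : ℝ) (w : Space 𝒯 p) :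
    (innerW τ w w).re = (gram (liftW w.1 + liftM w.2) (liftW w.1 + liftM w.2)).re
      + τ * (∑ T : 𝒯.Elem, ∑ F ∈ T.faces, ∫ x in F.hull,
          ‖WSpace.val w.1 T x - MSpace.val w.2 F x‖ ^ 2 ∂μHE[d - 1])
      + (∑ T : 𝒯.Elem, ∫ x in T.hull, ‖WSpace.val w.1 T x‖ ^ 2)
      + ∑ F ∈ 𝒯.boundaryFaces, ∫ x in F.hull, ‖MSpace.val w.2 F x‖ ^ 2 ∂μHE[d - 1] := by
  rw [innerW_self_eq hd, intSkeleton_mul_conj_self, intElems_mul_conj_self,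
    intBoundary_mul_conj_self, ← Complex.ofReal_mul]
  simp only [Complex.add_re, Complex.ofReal_re]

lemma WSpace.eq_zero_of_intElems_eq_zero (hd : 0 < d) {w : WSpace 𝒯 p}
    (h : intElems (fun T x => WSpace.val w T x * conj (WSpace.val w T x)) = 0) : w = 0 := by
  let q : VSpace 𝒯 p := fun T _ => w T
  have gram_q : gram q q
      = d * intElems fun T x => WSpace.val w T x * conj (WSpace.val w T x) := by
    simp only [gram, intElems, Finset.mul_sum, ← integral_const_mul, VSpace.val, WSpace.val, q,
      Finset.sum_const, Finset.card_univ, Fintype.card_fin, nsmul_eq_mul]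
  have hq : q = 0 := gram_def q (by rw [gram_q, h, mul_zero])
  exact funext fun T => congrFun (congrFun hq T) ⟨0, hd⟩

lemma Mesh.Elem.euclideanHausdorffMeasure_face_inter_ne_zero (hd : 0 < d) {T : 𝒯.Elem}
    {F : 𝒯.Face} (hF : F ∈ T.faces) {V : Set (EuclideanSpace ℝ (Fin d))} (hV : IsOpen V)
    (hFV : (F.hull ∩ V).Nonempty) : μHE[d - 1] (F.hull ∩ V) ≠ 0 := by
  obtain ⟨b, hb, rfl⟩ := T.exists_opposite_eq hd hF
  have hcone := isSolidCone_altitude T.affineIndependent hb (T.erase_nonempty hd hb)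
  have hclosure : T.hull ⊆ closure (interior T.hull) := by
    rw [Mesh.Elem.hull, (convex_convexHull ℝ _).closure_interior_eq_closure_of_nonempty_interior
      (hull_interior T)]
    exact subset_closure
  simpa only [finrank_euclideanSpace_fin] using!
    hcone.euclideanHausdorffMeasure_base_inter_ne_zero (hull_compact T).measurableSet hclosure hV
      hFV

lemma Mesh.Elem.eqOn_zero_of_setIntegral_face_eq_zero (hd : 0 < d) {T : 𝒯.Elem} {F : 𝒯.Face}
    (hF : F ∈ T.faces) {g : EuclideanSpace ℝ (Fin d) → ℂ} (hg : ContinuousOn g F.hull)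
    (h : ∫ x in F.hull, ‖g x‖ ^ 2 ∂μHE[d - 1] = 0) : Set.EqOn g 0 F.hull := by
  have hint : IntegrableOn (fun x => ‖g x‖ ^ 2) F.hull μHE[d - 1] := by
    simpa [IntegrableOn, pow_two] using (F.integrableOn hd (hg.mul hg)).norm
  have ae_eq_zero : ∀ᵐ y ∂(μHE[d - 1] : Measure (EuclideanSpace ℝ (Fin d))),
      y ∈ F.hull → ‖g y‖ ^ 2 = 0 :=
    (ae_restrict_iff' F.isCompact_hull.measurableSet).1
      ((setIntegral_eq_zero_iff_of_nonneg_ae (ae_of_all _ fun _ => sq_nonneg _) hint).1 h)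
  intro x hx
  by_contra hgx
  obtain ⟨V, hV, hVg⟩ := continuousOn_iff'.1 hg {0}ᶜ isOpen_compl_singleton
  have hFV : F.hull ∩ V = F.hull ∩ g ⁻¹' {0}ᶜ := by rw [Set.inter_comm, ← hVg, Set.inter_comm]
  refine T.euclideanHausdorffMeasure_face_inter_ne_zero hd hF hV
    ⟨x, hFV.symm ▸ ⟨hx, hgx⟩⟩ (measure_mono_null (fun y hy => ?_) ae_eq_zero)
  rw [hFV] at hy
  exact fun hgy => hy.2 (by simpa using hgy hy.1)

lemma Mesh.Face.exists_mem_faces (F : 𝒯.Face) : ∃ T : 𝒯.Elem, F ∈ T.faces := by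
  obtain ⟨t, ht, hFt, hcard⟩ := 𝒯.pure F.1 F.2.1
  exact ⟨⟨t, ht, hcard⟩, Finset.mem_filter.2 ⟨Finset.mem_univ _, hFt⟩⟩

lemma MSpace.eq_zero_of_forall_eqOn {μ : MSpace 𝒯 p}
    (h : ∀ F, Set.EqOn (MSpace.val μ F) 0 F.hull) : μ = 0 := by
  refine funext fun F => Subtype.ext (funext fun x => ?_)
  by_cases hx : x ∈ F.hull
  · exact h F hx
  · obtain ⟨q, -, hq⟩ := (μ F).2
    rw [← hq]
    exact Set.indicator_of_notMem hx fun x => evalAt x q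

lemma MSpace.eq_zero_of_skeleton_integral_eq_zero (hd : 0 < d) {μ : MSpace 𝒯 p}
    (h : ∑ T : 𝒯.Elem, ∑ F ∈ T.faces, ∫ x in F.hull, ‖MSpace.val μ F x‖ ^ 2 ∂μHE[d - 1] = 0) :
    μ = 0 := by
  refine eq_zero_of_forall_eqOn fun F => ?_
  obtain ⟨T, hF⟩ := F.exists_mem_faces
  have hT := (Finset.sum_eq_zero_iff_of_nonneg fun T _ => by positivity).1 h T (Finset.mem_univ T)
  have hTF := (Finset.sum_eq_zero_iff_of_nonneg fun F _ => by positivity).1 hT F hF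
  exact T.eqOn_zero_of_setIntegral_face_eq_zero hd hF (continuousOn_mVal F μ) hTF

theorem re_innerW_self_pos (hd : 0 < d) {τ : ℝ} (hτ : 0 < τ) {w : Space 𝒯 p} (hw : w ≠ 0) :
    0 < (innerW τ w w).re := by
  rw [re_innerW_self hd]
  set S := ∑ T : 𝒯.Elem, ∑ F ∈ T.faces, ∫ x in F.hull,
    ‖WSpace.val w.1 T x - MSpace.val w.2 F x‖ ^ 2 ∂μHE[d - 1] with hS
  set E := ∑ T : 𝒯.Elem, ∫ x in T.hull, ‖WSpace.val w.1 T x‖ ^ 2 with hE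
  have hgram := re_gram_self_nonneg (liftW w.1 + liftM w.2)
  have hboundary : 0 ≤ ∑ F ∈ 𝒯.boundaryFaces, ∫ x in F.hull,
      ‖MSpace.val w.2 F x‖ ^ 2 ∂μHE[d - 1] := by positivity
  have S_nonneg : 0 ≤ τ * S := by positivity
  have E_nonneg : 0 ≤ E := by positivity
  by_contra! hle
  have E_eq_zero : E = 0 := by linarith
  have S_eq_zero : S = 0 := (mul_eq_zero.1 (by linarith)).resolve_left hτ.ne'
  have fst_eq_zero : w.1 = 0 := WSpace.eq_zero_of_intElems_eq_zero hd <| by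
    rw [intElems_mul_conj_self, ← hE, E_eq_zero, Complex.ofReal_zero]
  refine hw (Prod.ext fst_eq_zero (MSpace.eq_zero_of_skeleton_integral_eq_zero hd ?_))
  simpa [hS, fst_eq_zero, WSpace.val] using S_eq_zero

/-! ## The output error bound -/

variable {Q : ℕ}

lemma normW_nonneg (τ : ℝ) (w : Space 𝒯 p) : 0 ≤ normW τ w := Real.sqrt_nonneg _

lemma normW_zero (hd : 0 < d) (τ : ℝ) : normW τ (0 : Space 𝒯 p) = 0 := by
  obtain ⟨B, hB⟩ := exists_sesqForm_innerW (𝒯 := 𝒯) (p := p) hd τ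
  rw [normW, ← hB, map_zero, Complex.zero_re, Real.sqrt_zero]

lemma normW_pos (hd : 0 < d) {τ : ℝ} (hτ : 0 < τ) {w : Space 𝒯 p} (hw : w ≠ 0) :
    0 < normW τ w :=
  Real.sqrt_pos.2 (re_innerW_self_pos hd hτ hw)

lemma exists_norm_le_mul_normW (hd : 0 < d) {τ : ℝ} (hτ : 0 < τ) (l : Space 𝒯 p →ₗ[ℂ] ℂ) :
    ∃ C, ∀ w, ‖l w‖ ≤ C * normW τ w := by
  obtain ⟨B, hB⟩ := exists_sesqForm_innerW (𝒯 := 𝒯) (p := p) hd τ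
  have hpos (w : Space 𝒯 p) (hw : w ≠ 0) : 0 < (B w w).re := by
    rw [hB]
    exact re_innerW_self_pos hd hτ hw
  obtain ⟨C, hC⟩ := exists_norm_le_mul_sqrt B hpos l
  exact ⟨C, fun w => by simpa only [hB, normW] using hC w⟩

lemma exists_norm_le_mul_normW_of_antilinear (hd : 0 < d) {τ : ℝ} (hτ : 0 < τ)
    (l : Space 𝒯 p →ₗ⋆[ℂ] ℂ) : ∃ C, ∀ w, ‖l w‖ ≤ C * normW τ w := by
  let conjL : Space 𝒯 p →ₗ[ℂ] ℂ :=
    { toFun := fun w => conj (l w)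
      map_add' := fun v w => by rw [map_add, map_add]
      map_smul' := fun c w => by simp }
  obtain ⟨C, hC⟩ := exists_norm_le_mul_normW hd hτ conjL
  exact ⟨C, fun w => (RCLike.norm_conj (l w)).symm.trans_le (hC w)⟩

namespace Problem

variable {D : Problem 𝒯 p Q} {y : Fin Q → ℝ}

lemma infSup_le {w : Space 𝒯 p} (hw : w ≠ 0) :
    D.infSup y ≤ ⨆ v : {v : Space 𝒯 p // v ≠ 0},
      ‖D.a y w v.1‖ / (normW D.τ w * normW D.τ v.1) := by
  refine ciInf_le ⟨0, ?_⟩ (⟨w, hw⟩ : {w : Space 𝒯 p // w ≠ 0})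
  rintro _ ⟨w, rfl⟩
  exact Real.iSup_nonneg fun v => div_nonneg (norm_nonneg _)
    (mul_nonneg (normW_nonneg _ _) (normW_nonneg _ _))

lemma exists_a_ne_zero_of_infSup_pos (h : 0 < D.infSup y) {w : Space 𝒯 p} (hw : w ≠ 0) :
    ∃ v, D.a y w v ≠ 0 := by
  by_contra! a_eq_zero
  refine (h.trans_le (infSup_le hw)).not_ge (Real.iSup_nonpos fun v => ?_)
  rw [a_eq_zero, norm_zero, zero_div]

lemma dualNorm_nonneg (r : Space 𝒯 p → ℂ) : 0 ≤ D.dualNorm r :=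
  Real.iSup_nonneg fun _ => div_nonneg (norm_nonneg _) (normW_nonneg _ _)

lemma norm_le_dualNorm_mul_normW {r : Space 𝒯 p → ℂ} {C : ℝ}
    (hr : ∀ w, ‖r w‖ ≤ C * normW D.τ w) (w : Space 𝒯 p) :
    ‖r w‖ ≤ D.dualNorm r * normW D.τ w := by
  rcases (normW_nonneg D.τ w).eq_or_lt with h | h
  · simpa only [← h, mul_zero] using hr w
  · rw [← div_le_iff₀ h]
    refine le_ciSup (f := fun w => ‖r w‖ / normW D.τ w)
      ⟨max C 0, Set.forall_mem_range.2 fun v => ?_⟩ w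
    exact div_le_of_le_mul₀ (normW_nonneg _ _) (le_max_right _ _)
      ((hr v).trans (mul_le_mul_of_nonneg_right (le_max_left C 0) (normW_nonneg _ _)))

lemma infSup_mul_normW_le_dualNorm (hd : 0 < d) (w : Space 𝒯 p) :
    D.infSup y * normW D.τ w ≤ D.dualNorm (D.a y w) := by
  rcases eq_or_ne w 0 with rfl | hw
  · rw [normW_zero hd, mul_zero]
    exact dualNorm_nonneg _
  obtain ⟨A, hA, -⟩ := D.exists_continuous_sesqForm_a hd
  obtain ⟨C, hC⟩ := exists_norm_le_mul_normW_of_antilinear hd D.τ_pos (A y w)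
  simp only [hA] at hC
  have : Nonempty {v : Space 𝒯 p // v ≠ 0} := ⟨⟨w, hw⟩⟩
  rw [← le_div_iff₀ (normW_pos hd D.τ_pos hw)]
  refine (infSup_le hw).trans (ciSup_le fun v => ?_)
  rw [mul_comm, ← div_div]
  gcongr
  · exact normW_nonneg _ _
  · exact div_le_of_le_mul₀ (normW_nonneg _ _) (dualNorm_nonneg _)
      (norm_le_dualNorm_mul_normW hC v.1)

section OutputBound

variable {β : (Fin Q → ℝ) → ℝ} {uh uN φN : (Fin Q → ℝ) → Space 𝒯 p}

lemma a_sub_left (hd : 0 < d) (u v w : Space 𝒯 p) :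
    D.a y (u - v) w = D.a y u w - D.a y v w := by
  obtain ⟨A, hA, -⟩ := D.exists_continuous_sesqForm_a hd
  rw [← hA, ← hA, ← hA, map_sub, LinearMap.sub_apply]

lemma normW_sub_le_primalBound (hd : 0 < d) (hβ : 0 < β y) (hβh : β y ≤ D.infSup y)
    (huh : D.IsHDG y (uh y)) : normW D.τ (uh y - uN y) ≤ D.primalBound β uN y := by
  have residual_eq : (fun w => D.b w - D.a y (uN y) w) = D.a y (uh y - uN y) :=
    funext fun w => by rw [a_sub_left hd, huh w]
  rw [primalBound, residual_eq, le_div_iff₀' hβ]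
  exact (mul_le_mul_of_nonneg_right hβh (normW_nonneg _ _)).trans
    (infSup_mul_normW_le_dualNorm hd _)

lemma norm_dual_residual_le (hd : 0 < d) (hβ : 0 < β y) (w : Space 𝒯 p) :
    ‖-D.ℓ w - D.a y w (φN y)‖ ≤ β y * D.dualBound β φN y * normW D.τ w := by
  obtain ⟨A, hA, -⟩ := D.exists_continuous_sesqForm_a hd
  obtain ⟨C, hC⟩ := exists_norm_le_mul_normW hd D.τ_pos (-D.ℓ - (A y).flip (φN y))
  simp only [LinearMap.sub_apply, LinearMap.neg_apply, LinearMap.flip_apply, hA] at hC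
  rw [dualBound, mul_div_cancel₀ _ hβ.ne']
  exact norm_le_dualNorm_mul_normW (r := fun w => -D.ℓ w - D.a y w (φN y)) hC w

lemma hdgOutput_sub_rbOutput (hd : 0 < d) (huh : D.IsHDG y (uh y)) :
    D.hdgOutput uh y - D.rbOutput uN φN y
      = -(-D.ℓ (uh y - uN y) - D.a y (uh y - uN y) (φN y)).re := by
  rw [hdgOutput, rbOutput, a_sub_left hd, ← huh (φN y), map_sub, ← Complex.sub_re,
    ← Complex.neg_re]
  congr 1
  ring

theorem abs_hdgOutput_sub_rbOutput_le (hd : 0 < d) (hβ : 0 < β y) (hβh : β y ≤ D.infSup y)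
    (huh : D.IsHDG y (uh y)) :
    |D.hdgOutput uh y - D.rbOutput uN φN y| ≤ D.outputBound β uN φN y := by
  have dualBound_nonneg : 0 ≤ D.dualBound β φN y := div_nonneg (dualNorm_nonneg _) hβ.le
  calc |D.hdgOutput uh y - D.rbOutput uN φN y|
      ≤ ‖-D.ℓ (uh y - uN y) - D.a y (uh y - uN y) (φN y)‖ := by
        rw [hdgOutput_sub_rbOutput hd huh, abs_neg]
        exact Complex.abs_re_le_norm _
    _ ≤ β y * D.dualBound β φN y * normW D.τ (uh y - uN y) := norm_dual_residual_le hd hβ _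
    _ ≤ β y * D.dualBound β φN y * D.primalBound β uN y := by
        gcongr
        exact normW_sub_le_primalBound hd hβ hβh huh
    _ = D.outputBound β uN φN y := mul_right_comm _ _ _

lemma continuousOn_hdgOutput (hd : 0 < d) {K : Set (Fin Q → ℝ)} (hK : ∀ y ∈ K, 0 < D.infSup y)
    (huh : ∀ y ∈ K, D.IsHDG y (uh y)) : ContinuousOn (D.hdgOutput uh) K := by
  obtain ⟨A, hA, hcont⟩ := D.exists_continuous_sesqForm_a hd
  refine Complex.continuous_re.comp_continuousOn (continuousOn_solution hcont (b := D.b)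
    (fun y hy w hw => ?_) (fun y hy w => (hA _ _ _).trans (huh y hy w)) D.ℓ)
  by_contra w_ne_zero
  obtain ⟨v, hv⟩ := exists_a_ne_zero_of_infSup_pos (hK y hy) w_ne_zero
  exact hv ((hA y w v).symm.trans (hw v))

end OutputBound

end Problem

/-! ## The law of the random parameters -/

lemma memLp_of_continuousOn_isCompact {X E : Type*} [TopologicalSpace X] [MeasurableSpace X]
    [OpensMeasurableSpace X] [T2Space X] [NormedAddCommGroup E] {μ : Measure X}
    [IsFiniteMeasure μ] {K : Set X} (hK : IsCompact K) (hμ : ∀ᵐ x ∂μ, x ∈ K) {f : X → E}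
    (hf : ContinuousOn f K) (q : ENNReal) :
    MemLp f q μ := by
  obtain ⟨C, hC⟩ := hK.exists_bound_of_continuousOn hf
  have hfm := hf.aestronglyMeasurable_of_isCompact (μ := μ) hK hK.measurableSet
  rw [Measure.restrict_eq_self_of_ae_mem hμ] at hfm
  exact MemLp.of_bound hfm C (hμ.mono hC)

lemma isCompact_paramBox (γ : Fin Q → ℝ) : IsCompact (paramBox γ) :=
  isCompact_univ_pi fun _ => isCompact_Icc

lemma ae_mem_paramBox (γ : Fin Q → ℝ) (ρ : Fin Q → ℝ → ℝ) :
    ∀ᵐ y ∂paramLaw γ ρ, y ∈ paramBox γ :=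
  (withDensity_absolutelyContinuous _ _).ae_le
    (ae_restrict_mem (isCompact_paramBox γ).measurableSet)

lemma expect_eq_integral_paramLaw {γ : Fin Q → ℝ} {ρ : Fin Q → ℝ → ℝ} (hρ : IsDensity γ ρ)
    (s : (Fin Q → ℝ) → ℝ) : expect γ ρ s = ∫ y, s y ∂paramLaw γ ρ := by
  have measurable_jointDensity : Measurable (jointDensity ρ) :=
    Finset.measurable_fun_prod _ fun q _ => (hρ.measurable q).comp (measurable_pi_apply q)
  rw [paramLaw, integral_withDensity_eq_integral_toReal_smul
    measurable_jointDensity.ennreal_ofReal (ae_of_all _ fun _ => ENNReal.ofReal_lt_top), expect]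
  refine setIntegral_congr_fun (isCompact_paramBox γ).measurableSet fun y hy => ?_
  have jointDensity_nonneg : 0 ≤ jointDensity ρ y :=
    Finset.prod_nonneg fun q _ => hρ.nonneg q _ (hy q (Set.mem_univ q))
  simp only [ENNReal.toReal_ofReal jointDensity_nonneg, smul_eq_mul, mul_comm]

end HDG

theorem mainTheorem5_general {d p Q : ℕ} (hd : 0 < d) {𝒯 : HDG.Mesh d} (D : HDG.Problem 𝒯 p Q)
    {K : Set (Fin Q → ℝ)} (hK : IsCompact K) {μ : Measure (Fin Q → ℝ)} (hμ : ∀ᵐ y ∂μ, y ∈ K)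
    {uh : (Fin Q → ℝ) → HDG.Space 𝒯 p} (huh : ∀ y ∈ K, D.IsHDG y (uh y))
    {uN φN : (Fin Q → ℝ) → HDG.Space 𝒯 p}
    {β : (Fin Q → ℝ) → ℝ} (hβ : ∀ y ∈ K, 0 < β y ∧ β y ≤ D.infSup y)
    (hsN : AEMeasurable (D.rbOutput uN φN) μ) (hΔs : AEMeasurable (D.outputBound β uN φN) μ)
    {Ω : Type*} [MeasurableSpace Ω] {P : Measure Ω} [IsProbabilityMeasure P]
    {Y : ℕ → Ω → Fin Q → ℝ} (hYi : iIndepFun Y P) (hY : ∀ m, HasLaw (Y m) μ P)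
    {a : ℝ} (ha : 0 < a) :
    ∃ L : ℝ,
      Tendsto (fun M : ℕ => P.real {ω |
          |∫ y, D.hdgOutput uh y ∂μ - HDG.mcMean (D.rbOutput uN φN) (fun m => Y m ω) M|
            ≤ HDG.mcTotalBound a (D.rbOutput uN φN) (D.outputBound β uN φN)
                (fun m => Y m ω) M})
        atTop (𝓝 L)
      ∧ HDG.erf (a / √2) ≤ L := by
  have : IsProbabilityMeasure μ := (hY 0).isProbabilityMeasure_iff.1 inferInstance
  have continuousOn_output : ContinuousOn (D.hdgOutput uh) K :=
    HDG.Problem.continuousOn_hdgOutput hd (fun y hy => (hβ y hy).1.trans_le (hβ y hy).2) huh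
  have output_error_le : ∀ᵐ y ∂μ,
      |D.hdgOutput uh y - D.rbOutput uN φN y| ≤ D.outputBound β uN φN y :=
    hμ.mono fun y hy =>
      HDG.Problem.abs_hdgOutput_sub_rbOutput_le hd (hβ y hy).1 (hβ y hy).2 (huh y hy)
  exact HDG.exists_tendsto_measureReal_mcTotalBound hYi hY
    (HDG.memLp_of_continuousOn_isCompact hK hμ continuousOn_output 2) hsN hΔs output_error_le ha

theorem mainTheorem5 {d p Q : ℕ} (hd : 0 < d)
    -- the triangulation and the parametrized HDG problem on it
    (𝒯 : HDG.Mesh d) (D : HDG.Problem 𝒯 p Q)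
    -- the parameter domain and the densities of the independent parameters
    (γ : Fin Q → ℝ) (ρ : Fin Q → ℝ → ℝ) (hρ : HDG.IsDensity γ ρ)
    -- the HDG solution
    (uh : (Fin Q → ℝ) → HDG.Space 𝒯 p)
    (huh : ∀ y ∈ HDG.paramBox γ, D.IsHDG y (uh y))
    -- the orthonormal primal and dual bases, and the reduced basis approximations
    {Nmax : ℕ} (ζpr ζdu : Fin Nmax → HDG.Space 𝒯 p)
    (hζpr : ∀ m n, HDG.innerW D.τ (ζpr m) (ζpr n) = if m = n then 1 else 0)
    (hζdu : ∀ m n, HDG.innerW D.τ (ζdu m) (ζdu n) = if m = n then 1 else 0)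
    (N : ℕ) (hN : 1 ≤ N) (hNmax : N ≤ Nmax)
    (uN φN : (Fin Q → ℝ) → HDG.Space 𝒯 p)
    (huN : ∀ y ∈ HDG.paramBox γ, D.IsPrimalRB (HDG.rbSpace ζpr N) y (uN y))
    (hφN : ∀ y ∈ HDG.paramBox γ, D.IsDualRB (HDG.rbSpace ζdu N) y (φN y))
    -- the positive lower bound for the inf-sup constant
    (β : (Fin Q → ℝ) → ℝ)
    (hβ : ∀ y ∈ HDG.paramBox γ, 0 < β y ∧ β y ≤ D.infSup y)
    -- the reduced basis output and its error bound are random variables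
    (hsN : AEMeasurable (D.rbOutput uN φN) (HDG.paramLaw γ ρ))
    (hΔs : AEMeasurable (D.outputBound β uN φN) (HDG.paramLaw γ ρ))
    -- the random samples
    {Ω : Type*} [MeasurableSpace Ω] (P : Measure Ω) [IsProbabilityMeasure P]
    (Y : ℕ → Ω → Fin Q → ℝ) (hYm : ∀ m, Measurable (Y m)) (hYi : iIndepFun Y P)
    (hYl : ∀ m, P.map (Y m) = HDG.paramLaw γ ρ)
    (a : ℝ) (ha : 0 < a) :
    ∃ L : ℝ,
      Tendsto (fun M : ℕ => P.real {ω |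
          |HDG.expect γ ρ (D.hdgOutput uh)
              - HDG.mcMean (D.rbOutput uN φN) (fun m => Y m ω) M|
            ≤ HDG.mcTotalBound a (D.rbOutput uN φN) (D.outputBound β uN φN)
                (fun m => Y m ω) M})
        atTop (𝓝 L)
      ∧ HDG.erf (a / √2) ≤ L := by
  rw [HDG.expect_eq_integral_paramLaw hρ]
  exact mainTheorem5_general hd D (HDG.isCompact_paramBox γ) (HDG.ae_mem_paramBox γ ρ) huh hβ
    hsN hΔs hYi (fun m => ⟨(hYm m).aemeasurable, hYl m⟩) ha
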